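/- **Setting.** Let $N_C, N_I, N_G, N_L$ be countable sets of concept names, individual names, global role names and local role names ($N_G\cap N_L=\emptyset$). A role $R$ is a role name $S\in N_G\cup N_L$ or its inverse $S^-$; $\mathrm{inv}(S)=S^-$, $\mathrm{inv}(S^-)=S$; $R$ is global if its role name is in $N_G$. Concepts of $\mathrm{T}^{\mathbb N}\mathrm{DL\text{-}Lite}$ are $$C ::= \bot\mid A\mid {\geq}q\,R\mid \neg C\mid C_1\sqcap C_2\mid \bigcirc_F C\mid \Diamond_F C\qquad(A\in N_C,\ q\in\mathbb N,\ q>0).$$ A knowledge base $\mathcal K=(\mathcal T,\mathcal A)$ is a finite TBox $\mathcal T$ of inclusions $C_1\sqsubseteq C_2$ and a finite ABox $\mathcal A$ of assertions $\bigcirc^nA(a)$, $\bigcirc^n\neg A(a)$, $\bigcirc^nS(a,b)$, $\bigcirc^n\neg S(a,b)$ with $n\in\mathbb N$, $A$ a concept name, $S$ a role name, $a,b\in N_I$. An interpretation is a non-empty domain $\Delta$ with, for every $n\in\mathbb N$, sets $A^{\mathcal I_n}\subseteq\Delta$ and relations $S^{\mathcal I_n}\subseteq\Delta\times\Delta$,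 where $S^{\mathcal I_n}$ does not depend on $n$ for $S\in N_G$, and with time-independent elements $a^{\mathcal I}\in\Delta$ that are distinct for distinct $a\in N_I$. Concepts are interpreted as usual: $({\geq}q\,R)^{\mathcal I_n}$ is the set of $d$ with at least $q$ distinct $R^{\mathcal I_n}$-successors, $(\bigcirc_FC)^{\mathcal I_n}=C^{\mathcal I_{n+1}}$, $(\Diamond_FC)^{\mathcal I_n}=\bigcup_{m\ge n}C^{\mathcal I_m}$. The inclusion $C_1\sqsubseteq C_2$ holds if $C_1^{\mathcal I_n}\subseteq C_2^{\mathcal I_n}$ for all $n\in\mathbb N$; an assertion $\bigcirc^n\alpha$ holds if $\alpha$ holds at time $n$. $\mathcal K$ is satisfiable if all its axioms hold in some interpretation. $\mathcal{QTL}_1$-formulas are first-order temporal formulas with a single variable $x$, constants from $N_I$, unary predicates $A$ ($A\in N_C$) and $E_qR$, connectives $\bot,\neg,\wedge$, the quantifier $\forall x$ and the operators $\bigcirc_F,\Diamond_F$ (with $\to$, $\exists x$ and $\Box_F=\neg\Diamond_F\neg$ as abbreviations). They are interpreted over $\mathbb N$ with a constant non-empty domain, rigid constants and the non-strict reading of $\Diamond_F$;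 such a formula is satisfiable if it is true at time $0$ in some model. **Translation.** $C^*(t)$ is obtained from $C$ by $A^*(t)=A(t)$, $({\geq}q\,R)^*(t)=E_qR(t)$, commuting with $\bot$ and all connectives and temporal operators. Let $\mathrm{role}_{\mathcal K}$ be the set of role names occurring in $\mathcal K$ and their inverses, and $Q_{\mathcal T}$ the set of $1$ and all numbers occurring in $\mathcal T$. Then $\mathcal T^\dagger$ is the conjunction of - $\Box_F\forall x\,(C_1^*(x)\to C_2^*(x))$ for $C_1\sqsubseteq C_2\in\mathcal T$; - $\Box_F\forall x\,(E_{q'}R(x)\to E_qR(x))$ for $R\in\mathrm{role}_{\mathcal K}$ and $q,q'\in Q_{\mathcal T}$ with $q'>q$; - $\Box_F\forall x\,(\Diamond_FE_qR(x)\to\Box_FE_qR(x))$ for global $R\in\mathrm{role}_{\mathcal K}$ and $q\in Q_{\mathcal T}$; - $\Box_F\forall x\,(E_1R(x)\to\exists x\,E_1\mathrm{inv}(R)(x))$ for $R\in\mathrm{role}_{\mathcal K}$. Close $\mathcal A$ under inverses: with $\bigcirc^nS(a,b)$ it also contains $\bigcirc^nS^-(b,a)$. For a role $R$ and $n\in\mathbb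 N$ let $\mathcal A_n^R$ be the set of all $R(a,b)$ with $\bigcirc^mR(a,b)\in\mathcal A$ for some $m$ if $R$ is global, and with $\bigcirc^nR(a,b)\in\mathcal A$ if $R$ is local. Let $q^{R,n}_{\mathcal A(a)}$ be the largest $q\in Q_{\mathcal T}$ such that $R(a,b)\in\mathcal A_n^R$ for at least $q$ distinct $b$. Then $\mathcal A^\dagger$ is the conjunction of all concept assertions in $\mathcal A$, of $\bigcirc_F^n E_qR(a)$ with $q=q^{R,n}_{\mathcal A(a)}$ for every $\bigcirc^nR(a,b)\in\mathcal A$, and of $\bot$ for every $\bigcirc^n\neg S(a,b)\in\mathcal A$ with $S(a,b)\in\mathcal A_n^S$. Finally, $\mathcal K^\dagger=\mathcal T^\dagger\wedge\mathcal A^\dagger$. **Corollary.** A $\mathrm{T}^{\mathbb N}\mathrm{DL\text{-}Lite}$ knowledge base $\mathcal K$ is satisfiable if and only if the $\mathcal{QTL}_1$-formula $\mathcal K^\dagger$ is satisfiable. Moreover, $\mathcal K^\dagger$ can be constructed from $\mathcal K$ in time polynomial in the size of $\mathcal K$ (numbers $q$ being written in binary, and $\bigcirc^n$ as $n$ symbols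 $\bigcirc_F$). -/

import Mathlib

open Computability

namespace TDLLite

/-! ## Syntax of the future-only temporal DL-Lite -/

section DLSyntax

variable (NC NI NG NL : Type)

/-- Role names: global (time-invariant) or local ones. -/
inductive RoleName where
  | glob (G : NG)
  | loc (L : NL)
  deriving DecidableEq

/-- Roles: role names `S` and inverses `S⁻` of role names. -/
inductive Role where
  | name (S : RoleName NG NL)
  | inv (S : RoleName NG NL)
  deriving DecidableEq

/-- Temporal concepts
`C ::= ⊥ | A | ≥ q R | ¬ C | C₁ ⊓ C₂ | ○_F C | ◇_F C`, with `q > 0`. -/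
inductive Concept where
  | bot
  | atom (A : NC)
  | atLeast (q : ℕ+) (R : Role NG NL)
  | neg (C : Concept)
  | and (C₁ C₂ : Concept)
  | next (C : Concept)
  | dia (C : Concept)

/-- A concept inclusion `lhs ⊑ rhs`. -/
structure CI where
  lhs : Concept NC NG NL
  rhs : Concept NC NG NL

/-- Assertions: `○ⁿ A(a)`, `○ⁿ ¬A(a)`, `○ⁿ S(a,b)` and `○ⁿ ¬S(a,b)`, where `n ∈ ℕ`, `A` is a
concept name and `S` a role name; the sign is `true` for the assertions without negation. -/
inductive Assertion where
  | concept (n : ℕ) (sign : Bool) (A : NC) (a : NI)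
  | role (n : ℕ) (sign : Bool) (S : RoleName NG NL) (a b : NI)

/-- A knowledge base: a finite TBox and a finite ABox, each presented by a list of its axioms. -/
structure KB where
  tbox : List (CI NC NG NL)
  abox : List (Assertion NC NI NG NL)

end DLSyntax

/-! ## Semantics over `ℕ` -/

section DLSemantics

variable (NC NI NG NL : Type)

/-- Interpretations over `ℕ`: constant non-empty domain, rigid individual names with the unique
name assumption, global role names interpreted rigidly. -/
structure Interpretation where
  Dom : Type
  nonempty : Nonempty Dom
  conceptI : ℕ → NC → Set Dom
  roleI : ℕ → RoleName NG NL → Set (Dom × Dom)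
  indI : NI → Dom
  una : Function.Injective indI
  rigid : ∀ (G : NG) (i j : ℕ), roleI i (.glob G) = roleI j (.glob G)

variable {NC NI NG NL}

namespace Interpretation

variable (M : Interpretation NC NI NG NL)

/-- The interpretation of a role at time `n`. -/
def role (n : ℕ) : Role NG NL → Set (M.Dom × M.Dom)
  | .name S => M.roleI n S
  | .inv S => {p | (p.2, p.1) ∈ M.roleI n S}

/-- The interpretation of a concept at time `n` (the diamond is non-strict). -/
def concept : Concept NC NG NL → ℕ → Set M.Dom
  | .bot, _ => ∅
  | .atom A, n => M.conceptI n A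
  | .atLeast q R, n => {d | ((q : ℕ) : ℕ∞) ≤ Set.encard {d' | (d, d') ∈ M.role n R}}
  | .neg C, n => (concept C n)ᶜ
  | .and C₁ C₂, n => concept C₁ n ∩ concept C₂ n
  | .next C, n => concept C (n + 1)
  | .dia C, n => {d | ∃ m, n ≤ m ∧ d ∈ concept C m}

def SatCI (c : CI NC NG NL) : Prop :=
  ∀ n, M.concept c.lhs n ⊆ M.concept c.rhs n

def SatAssertion : Assertion NC NI NG NL → Prop
  | .concept n true A a => M.indI a ∈ M.conceptI n A
  | .concept n false A a => M.indI a ∉ M.conceptI n A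
  | .role n true S a b => (M.indI a, M.indI b) ∈ M.roleI n S
  | .role n false S a b => (M.indI a, M.indI b) ∉ M.roleI n S

end Interpretation

def KB.Satisfiable (K : KB NC NI NG NL) : Prop :=
  ∃ M : Interpretation NC NI NG NL,
    (∀ c ∈ K.tbox, M.SatCI c) ∧ ∀ α ∈ K.abox, M.SatAssertion α

end DLSemantics

/-! ## One-variable first-order temporal formulas -/

section QTL

/-- Terms: the single individual variable `x`, or a constant. -/
inductive Term (I : Type) where
  | var
  | const (a : I)

/-- Formulas of the (future) one-variable first-order temporal language with unary predicates in
`P` and constants in `I`. The only variable is `x`, which may be quantified again within the scope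
of a quantifier. -/
inductive Formula (P I : Type) where
  | bot
  | atom (p : P) (t : Term I)
  | neg (φ : Formula P I)
  | and (φ ψ : Formula P I)
  | next (φ : Formula P I)
  | dia (φ : Formula P I)
  | all (φ : Formula P I)

/-- First-order temporal models over `ℕ`: constant non-empty domain and rigid constants. -/
structure Model (P I : Type) where
  Dom : Type
  nonempty : Nonempty Dom
  predI : ℕ → P → Set Dom
  constI : I → Dom

variable {P I : Type}

/-- The value of a term, where `d` is the value of `x`. -/
def Model.term (M : Model P I) (d : M.Dom) : Term I → M.Dom
  | .var => d
  | .const a => M.constI a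

/-- `M.Sat n d φ`: the formula `φ` is true in `M` at time `n` when `x` has the value `d`. -/
def Model.Sat (M : Model P I) : ℕ → M.Dom → Formula P I → Prop
  | _, _, .bot => False
  | n, d, .atom p t => M.term d t ∈ M.predI n p
  | n, d, .neg φ => ¬ M.Sat n d φ
  | n, d, .and φ ψ => M.Sat n d φ ∧ M.Sat n d ψ
  | n, d, .next φ => M.Sat (n + 1) d φ
  | n, d, .dia φ => ∃ m, n ≤ m ∧ M.Sat m d φ
  | n, _, .all φ => ∀ e, M.Sat n e φ

namespace Formula

/-- Satisfiability: truth at time `0` in some model over `ℕ`. -/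
def Satisfiable (φ : Formula P I) : Prop :=
  ∃ (M : Model P I) (d : M.Dom), M.Sat 0 d φ

def top : Formula P I := neg bot

def imp (φ ψ : Formula P I) : Formula P I := neg (and φ (neg ψ))

/-- `□_F` -/
def box (φ : Formula P I) : Formula P I := neg (dia (neg φ))

/-- `∃ x` -/
def ex (φ : Formula P I) : Formula P I := neg (all (neg φ))

/-- The conjunction of a finite list of formulas. -/
def conj : List (Formula P I) → Formula P I
  | [] => top
  | φ :: l => and φ (conj l)

/-- `○ⁿ φ` -/
def nexts : ℕ → Formula P I → Formula P I
  | 0, φ => φ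
  | n + 1, φ => next (nexts n φ)

end Formula

end QTL

/-! ## The translation -/

section Translation

variable {NC NI NG NL : Type}

/-- The unary predicates of the translation: the concept names `A` and the predicates `E_q R`. -/
inductive Pred (NC NG NL : Type) where
  | concept (A : NC)
  | atLeast (q : ℕ+) (R : Role NG NL)

/-- The one-variable formulas in which the translation takes its values. -/
abbrev QTL (NC NI NG NL : Type) := Formula (Pred NC NG NL) NI

open Formula

/-- The inverse of a role. -/
def Role.inverse : Role NG NL → Role NG NL
  | .name S => .inv S
  | .inv S => .name S

/-- The role name of a role. -/
def Role.roleName : Role NG NL → RoleName NG NL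
  | .name S => S
  | .inv S => S

/-- A role is global if its role name is. -/
def RoleName.isGlobal : RoleName NG NL → Bool
  | .glob _ => true
  | .loc _ => false

def Role.isGlobal (R : Role NG NL) : Bool := R.roleName.isGlobal

/-- The numbers that occur in a concept. -/
def Concept.numbers : Concept NC NG NL → List ℕ+
  | .bot => []
  | .atom _ => []
  | .atLeast q _ => [q]
  | .neg C => C.numbers
  | .and C₁ C₂ => C₁.numbers ++ C₂.numbers
  | .next C => C.numbers
  | .dia C => C.numbers

/-- The role names that occur in a concept. -/
def Concept.roleNames : Concept NC NG NL → List (RoleName NG NL)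
  | .bot => []
  | .atom _ => []
  | .atLeast _ R => [R.roleName]
  | .neg C => C.roleNames
  | .and C₁ C₂ => C₁.roleNames ++ C₂.roleNames
  | .next C => C.roleNames
  | .dia C => C.roleNames

/-- The role names that occur in an assertion. -/
def Assertion.roleNames : Assertion NC NI NG NL → List (RoleName NG NL)
  | .concept _ _ _ _ => []
  | .role _ _ S _ _ => [S]

/-- `C*(t)`, the translation of a concept. -/
def Concept.star (t : Term NI) : Concept NC NG NL → QTL NC NI NG NL
  | .bot => Formula.bot
  | .atom A => Formula.atom (.concept A) t
  | .atLeast q R => Formula.atom (.atLeast q R) t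
  | .neg C => Formula.neg (C.star t)
  | .and C₁ C₂ => Formula.and (C₁.star t) (C₂.star t)
  | .next C => Formula.next (C.star t)
  | .dia C => Formula.dia (C.star t)

namespace KB

/-- The set of `1` and all numbers that occur in the TBox. -/
def numbers (K : KB NC NI NG NL) : List ℕ+ :=
  (1 :: K.tbox.flatMap fun c => c.lhs.numbers ++ c.rhs.numbers).dedup

/-- The positive role assertions `○ⁿ R(a,b)`, as quadruples `(n, R, a, b)`, after closing the ABox
under inverses: with `○ⁿ S(a,b)` it contains `○ⁿ S⁻(b,a)`. -/
def roleAssertions (K : KB NC NI NG NL) : List (ℕ × Role NG NL × NI × NI) :=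
  K.abox.flatMap fun
    | .role n true S a b => [(n, .name S, a, b), (n, .inv S, b, a)]
    | _ => []

section

variable [DecidableEq NI] [DecidableEq NG] [DecidableEq NL]

/-- The set of the role names that occur in the knowledge base and their inverses. -/
def roles (K : KB NC NI NG NL) : List (Role NG NL) :=
  ((K.tbox.flatMap fun c => c.lhs.roleNames ++ c.rhs.roleNames) ++
    K.abox.flatMap Assertion.roleNames).dedup.flatMap fun S => [.name S, .inv S]

/-- The temporal slice of the ABox at `n` for the role `R`: the pairs `(a,b)` with `○ᵐ R(a,b)` in
the ABox, for some `m` if `R` is global, and for `m = n` if `R` is local. -/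
def slice (K : KB NC NI NG NL) (n : ℕ) (R : Role NG NL) : List (NI × NI) :=
  (K.roleAssertions.filter fun r => r.2.1 = R ∧ (R.isGlobal ∨ r.1 = n)).map
    fun r => (r.2.2.1, r.2.2.2)

/-- The number of distinct `b` such that `R(a,b)` is in the slice at `n`. -/
def succCount (K : KB NC NI NG NL) (n : ℕ) (R : Role NG NL) (a : NI) : ℕ :=
  (((K.slice n R).filter fun p => p.1 = a).map Prod.snd).dedup.length

/-- The largest number in `K.numbers` that does not exceed the number of distinct `b` such that
`R(a,b)` is in the slice at `n` (and `1` if there is no such `b`). -/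
def succNumber (K : KB NC NI NG NL) (n : ℕ) (R : Role NG NL) (a : NI) : ℕ+ :=
  (K.numbers.filter fun (q : ℕ+) => (q : ℕ) ≤ K.succCount n R a).foldr max 1

/-- The conjuncts of the translation of the TBox. -/
def tboxConjuncts (K : KB NC NI NG NL) : List (QTL NC NI NG NL) :=
  (K.tbox.map fun c => box (all (imp (c.lhs.star .var) (c.rhs.star .var)))) ++
  (K.roles.flatMap fun R => K.numbers.flatMap fun q =>
    (K.numbers.filter fun q' => q < q').map fun q' =>
      box (all (imp (atom (.atLeast q' R) .var) (atom (.atLeast q R) .var)))) ++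
  ((K.roles.filter fun R => R.isGlobal).flatMap fun R => K.numbers.map fun q =>
    box (all (imp (dia (atom (.atLeast q R) .var)) (box (atom (.atLeast q R) .var))))) ++
  (K.roles.map fun R =>
    box (all (imp (atom (.atLeast 1 R) .var) (ex (atom (.atLeast 1 R.inverse) .var)))))

/-- The conjuncts of the translation of the ABox. -/
def aboxConjuncts (K : KB NC NI NG NL) : List (QTL NC NI NG NL) :=
  (K.abox.flatMap fun
    | .concept n true A a => [nexts n (atom (.concept A) (.const a))]
    | .concept n false A a => [nexts n (neg (atom (.concept A) (.const a)))]
    | _ => []) ++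
  (K.roleAssertions.map fun r =>
    nexts r.1 (atom (.atLeast (K.succNumber r.1 r.2.1 r.2.2.1) r.2.1) (.const r.2.2.1))) ++
  (K.abox.flatMap fun
    | .role n false S a b => if (a, b) ∈ K.slice n (.name S) then [bot] else []
    | _ => [])

/-- The translation `K†`. -/
def dagger (K : KB NC NI NG NL) : QTL NC NI NG NL :=
  and (conj K.tboxConjuncts) (conj K.aboxConjuncts)

end

end KB

end Translation

/-! ## Knowledge bases and formulas as strings

Names are given by the binary notation of their index in a fixed enumeration, numerical parameters
are in binary, and `○ⁿ` is written as `n` symbols. -/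

section Strings

/-- The alphabet. -/
inductive Sym where
  | bit (b : Bool)
  | endNum
  | conceptName | globalRole | localRole | inverse | variable | constant
  | bot | atLeast | neg | and | next | dia | all
  | subsumed | item | endList
  deriving DecidableEq, Fintype

/-- Binary notation, followed by an end marker. -/
def encodeNumber (n : ℕ) : List Sym := (encodeNat n).map Sym.bit ++ [.endNum]

variable {NC NI NG NL : Type}

section
variable [Encodable NG] [Encodable NL]

def RoleName.encode : RoleName NG NL → List Sym
  | .glob G => .globalRole :: encodeNumber (Encodable.encode G)
  | .loc L => .localRole :: encodeNumber (Encodable.encode L)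

def Role.encode : Role NG NL → List Sym
  | .name S => S.encode
  | .inv S => .inverse :: S.encode

variable [Encodable NC]

/-- Concepts in prefix notation. -/
def Concept.encode : Concept NC NG NL → List Sym
  | .bot => [.bot]
  | .atom A => .conceptName :: encodeNumber (Encodable.encode A)
  | .atLeast q R => .atLeast :: (encodeNumber q ++ R.encode)
  | .neg C => .neg :: C.encode
  | .and C₁ C₂ => .and :: (C₁.encode ++ C₂.encode)
  | .next C => .next :: C.encode
  | .dia C => .dia :: C.encode

def CI.encode (c : CI NC NG NL) : List Sym :=
  c.lhs.encode ++ .subsumed :: c.rhs.encode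

/-- The sign of an assertion: nothing, or a negation symbol. -/
def encodeSign : Bool → List Sym
  | true => []
  | false => [.neg]

variable [Encodable NI]

def Assertion.encode : Assertion NC NI NG NL → List Sym
  | .concept n s A a => List.replicate n .next ++ (encodeSign s ++
      .conceptName :: (encodeNumber (Encodable.encode A) ++ encodeNumber (Encodable.encode a)))
  | .role n s S a b => List.replicate n .next ++ (encodeSign s ++
      (S.encode ++ (encodeNumber (Encodable.encode a) ++ encodeNumber (Encodable.encode b))))

/-- Lists: every item is announced by a marker, and an end marker follows the last one. -/
def encodeItems {α : Type} (f : α → List Sym) : List α → List Sym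
  | [] => [.endList]
  | x :: l => .item :: (f x ++ encodeItems f l)

def KB.encode (K : KB NC NI NG NL) : List Sym :=
  encodeItems CI.encode K.tbox ++ encodeItems Assertion.encode K.abox

def Pred.encode : Pred NC NG NL → List Sym
  | .concept A => .conceptName :: encodeNumber (Encodable.encode A)
  | .atLeast q R => .atLeast :: (encodeNumber q ++ R.encode)

def Term.encode : Term NI → List Sym
  | .var => [.variable]
  | .const a => .constant :: encodeNumber (Encodable.encode a)

/-- Formulas in prefix notation. -/
def QTL.encode : QTL NC NI NG NL → List Sym
  | .bot => [.bot]
  | .atom p t => p.encode ++ t.encode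
  | .neg φ => .neg :: QTL.encode φ
  | .and φ ψ => .and :: (QTL.encode φ ++ QTL.encode ψ)
  | .next φ => .next :: QTL.encode φ
  | .dia φ => .dia :: QTL.encode φ
  | .all φ => .all :: QTL.encode φ

/-! The strings determine the objects that they encode. -/

theorem encodeNumber_inj : ∀ {m n : ℕ} {u v : List Sym},
    encodeNumber m ++ u = encodeNumber n ++ v → m = n ∧ u = v := by
  have key : ∀ (k l : List Bool) (u v : List Sym),
      k.map Sym.bit ++ .endNum :: u = l.map Sym.bit ++ .endNum :: v → k = l ∧ u = v := by
    intro k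
    induction k with
    | nil => intro l u v h; cases l <;> simp_all
    | cons b k ih =>
      intro l u v h
      cases l with
      | nil => simp at h
      | cons c l =>
        simp only [List.map_cons, List.cons_append, List.cons.injEq, Sym.bit.injEq] at h
        obtain ⟨h1, h2⟩ := ih l u v h.2
        exact ⟨by rw [h.1, h1], h2⟩
  intro m n u v h
  simp only [encodeNumber, List.append_assoc, List.singleton_append] at h
  obtain ⟨h1, h2⟩ := key _ _ _ _ h
  have := congrArg decodeNat h1
  simp only [decode_encodeNat] at this
  exact ⟨this, h2⟩

theorem encodeName_inj {α : Type} [Encodable α] {x y : α} {u v : List Sym}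
    (h : encodeNumber (Encodable.encode x) ++ u = encodeNumber (Encodable.encode y) ++ v) :
    x = y ∧ u = v :=
  ⟨Encodable.encode_injective (encodeNumber_inj h).1, (encodeNumber_inj h).2⟩

theorem RoleName.encode_inj {x y : RoleName NG NL} {u v : List Sym}
    (h : x.encode ++ u = y.encode ++ v) : x = y ∧ u = v := by
  cases x <;> cases y <;> simp [RoleName.encode] at h
  all_goals
    obtain ⟨rfl, rfl⟩ := encodeName_inj h
    exact ⟨rfl, rfl⟩

theorem Role.encode_inj {x y : Role NG NL} {u v : List Sym}
    (h : x.encode ++ u = y.encode ++ v) : x = y ∧ u = v := by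
  rcases x with (_ | _) | S <;> rcases y with (_ | _) | S' <;>
    simp [Role.encode, RoleName.encode] at h
  · obtain ⟨rfl, rfl⟩ := encodeName_inj h
    exact ⟨rfl, rfl⟩
  · obtain ⟨rfl, rfl⟩ := encodeName_inj h
    exact ⟨rfl, rfl⟩
  · obtain ⟨rfl, rfl⟩ := RoleName.encode_inj h
    exact ⟨rfl, rfl⟩

theorem Concept.encode_inj : ∀ {x y : Concept NC NG NL} {u v : List Sym},
    x.encode ++ u = y.encode ++ v → x = y ∧ u = v := by
  intro x
  induction x with
  | bot => intro y u v h; cases y <;> simp_all [Concept.encode]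
  | atom A =>
    intro y u v h
    cases y <;> simp [Concept.encode] at h
    obtain ⟨rfl, rfl⟩ := encodeName_inj h
    exact ⟨rfl, rfl⟩
  | atLeast q R =>
    intro y u v h
    cases y <;> simp [Concept.encode] at h
    obtain ⟨h1, h2⟩ := encodeNumber_inj h
    obtain ⟨rfl, rfl⟩ := Role.encode_inj h2
    rw [PNat.coe_inj] at h1
    exact ⟨by rw [h1], rfl⟩
  | neg C ih | next C ih | dia C ih =>
    intro y u v h
    cases y <;> simp [Concept.encode] at h
    obtain ⟨rfl, rfl⟩ := ih h
    exact ⟨rfl, rfl⟩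
  | and C D ih ih' =>
    intro y u v h
    cases y <;> simp [Concept.encode] at h
    obtain ⟨rfl, h'⟩ := ih h
    obtain ⟨rfl, rfl⟩ := ih' h'
    exact ⟨rfl, rfl⟩

theorem CI.encode_inj {x y : CI NC NG NL} {u v : List Sym}
    (h : x.encode ++ u = y.encode ++ v) : x = y ∧ u = v := by
  obtain ⟨C, D⟩ := x
  obtain ⟨C', D'⟩ := y
  simp only [CI.encode, List.append_assoc, List.cons_append] at h
  obtain ⟨rfl, h'⟩ := Concept.encode_inj h
  simp only [List.cons.injEq, true_and] at h'
  obtain ⟨rfl, rfl⟩ := Concept.encode_inj h'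
  exact ⟨rfl, rfl⟩

theorem replicate_next_inj : ∀ {m n : ℕ} {u v : List Sym}, u.head? ≠ some .next →
    v.head? ≠ some .next → List.replicate m .next ++ u = List.replicate n .next ++ v →
    m = n ∧ u = v := by
  intro m
  induction m with
  | zero =>
    intro n u v hu _ h
    cases n with
    | zero => simpa using h
    | succ n => simp [List.replicate_succ] at h; simp [h] at hu
  | succ m ih =>
    intro n u v hu hv h
    cases n with
    | zero => simp [List.replicate_succ] at h; simp [← h] at hv
    | succ n =>
      simp only [List.replicate_succ, List.cons_append, List.cons.injEq, true_and] at h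
      obtain ⟨h1, h2⟩ := ih hu hv h
      exact ⟨by rw [h1], h2⟩

theorem Assertion.encode_inj {x y : Assertion NC NI NG NL} {u v : List Sym}
    (h : x.encode ++ u = y.encode ++ v) : x = y ∧ u = v := by
  rcases x with ⟨n, _ | _, A, a⟩ | ⟨n, _ | _, S | S, a, b⟩ <;>
    rcases y with ⟨n', _ | _, A', a'⟩ | ⟨n', _ | _, S' | S', a', b'⟩ <;>
    simp only [Assertion.encode, encodeSign, RoleName.encode, List.append_assoc,
      List.cons_append, List.nil_append] at h <;>
    obtain ⟨rfl, h1⟩ := replicate_next_inj (by simp) (by simp) h <;>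
    simp at h1
  all_goals
    obtain ⟨rfl, h2⟩ := encodeName_inj h1
    obtain ⟨rfl, h3⟩ := encodeName_inj h2
    first
    | exact ⟨rfl, h3⟩
    | (obtain ⟨rfl, h4⟩ := encodeName_inj h3
       exact ⟨rfl, h4⟩)

theorem encodeItems_inj {α : Type} {f : α → List Sym}
    (hf : ∀ {x y : α} {u v : List Sym}, f x ++ u = f y ++ v → x = y ∧ u = v) :
    ∀ {k l : List α} {u v : List Sym},
      encodeItems f k ++ u = encodeItems f l ++ v → k = l ∧ u = v := by
  intro k
  induction k with
  | nil => intro l u v h; cases l <;> simp_all [encodeItems]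
  | cons x k ih =>
    intro l u v h
    cases l <;> simp [encodeItems] at h
    obtain ⟨rfl, h'⟩ := hf h
    obtain ⟨rfl, rfl⟩ := ih h'
    exact ⟨rfl, rfl⟩

theorem KB.encode_injective :
    Function.Injective (KB.encode : KB NC NI NG NL → List Sym) := by
  rintro ⟨T, A⟩ ⟨T', A'⟩ h
  simp only [KB.encode] at h
  obtain ⟨rfl, h'⟩ := encodeItems_inj CI.encode_inj h
  rw [← List.append_nil (encodeItems _ A), ← List.append_nil (encodeItems _ A')] at h'
  obtain ⟨rfl, -⟩ := encodeItems_inj Assertion.encode_inj h'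
  rfl

theorem Pred.encode_inj {x y : Pred NC NG NL} {u v : List Sym}
    (h : x.encode ++ u = y.encode ++ v) : x = y ∧ u = v := by
  cases x <;> cases y <;> simp [Pred.encode] at h
  · obtain ⟨rfl, rfl⟩ := encodeName_inj h
    exact ⟨rfl, rfl⟩
  · obtain ⟨h1, h2⟩ := encodeNumber_inj h
    obtain ⟨rfl, rfl⟩ := Role.encode_inj h2
    rw [PNat.coe_inj] at h1
    exact ⟨by rw [h1], rfl⟩

theorem Term.encode_inj {x y : Term NI} {u v : List Sym}
    (h : x.encode ++ u = y.encode ++ v) : x = y ∧ u = v := by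
  cases x <;> cases y <;> simp [Term.encode] at h
  · exact ⟨rfl, h⟩
  · obtain ⟨rfl, rfl⟩ := encodeName_inj h
    exact ⟨rfl, rfl⟩

theorem QTL.encode_inj : ∀ {x y : QTL NC NI NG NL} {u v : List Sym},
    QTL.encode x ++ u = QTL.encode y ++ v → x = y ∧ u = v := by
  intro x
  induction x with
  | bot =>
    intro y u v h
    rcases y with _ | ⟨_ | _, _⟩ | _ | _ | _ | _ | _ <;> simp_all [QTL.encode, Pred.encode]
  | atom p t =>
    intro y u v h
    rcases y with _ | ⟨p', t'⟩ | _ | _ | _ | _ | _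
    case atom =>
      simp only [QTL.encode, List.append_assoc] at h
      obtain ⟨rfl, h'⟩ := Pred.encode_inj h
      obtain ⟨rfl, rfl⟩ := Term.encode_inj h'
      exact ⟨rfl, rfl⟩
    all_goals cases p <;> simp [QTL.encode, Pred.encode] at h
  | neg C ih | next C ih | dia C ih | all C ih =>
    intro y u v h
    rcases y with _ | ⟨_ | _, _⟩ | _ | _ | _ | _ | _ <;> simp [QTL.encode, Pred.encode] at h
    obtain ⟨rfl, rfl⟩ := ih h
    exact ⟨rfl, rfl⟩
  | and C D ih ih' =>
    intro y u v h
    rcases y with _ | ⟨_ | _, _⟩ | _ | _ | _ | _ | _ <;> simp [QTL.encode, Pred.encode] at h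
    obtain ⟨rfl, h'⟩ := ih h
    obtain ⟨rfl, rfl⟩ := ih' h'
    exact ⟨rfl, rfl⟩

theorem QTL.encode_injective :
    Function.Injective (QTL.encode : QTL NC NI NG NL → List Sym) := by
  intro x y h
  rw [← List.append_nil (QTL.encode x), ← List.append_nil (QTL.encode y)] at h
  exact (QTL.encode_inj h).1

/-- The string encoding of knowledge bases. -/
noncomputable def KB.encoding (NC NI NG NL : Type)
    [Encodable NC] [Encodable NI] [Encodable NG] [Encodable NL] :
    Encoding (KB NC NI NG NL) Sym where
  encode := KB.encode
  decode := Function.partialInv KB.encode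
  decode_encode := Function.partialInv_left KB.encode_injective

/-- The string encoding of formulas. -/
noncomputable def QTL.encoding (NC NI NG NL : Type)
    [Encodable NC] [Encodable NI] [Encodable NG] [Encodable NL] :
    Encoding (QTL NC NI NG NL) Sym where
  encode := QTL.encode
  decode := Function.partialInv QTL.encode
  decode_encode := Function.partialInv_left QTL.encode_injective

end

end Strings

end TDLLite

/-! Satisfiability. An interpretation yields a model of `K†` by reading `E_q R` as `≥ q R`; the
unique name assumption turns the distinct names in a slice of the ABox into distinct successors.
Conversely, a model of `K†` prescribes for each element, role and time a degree, the largest `q ∈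
Q_T` with `E_q R`, and these degrees have to be realised by actual edges. This is done by
unravelling. The domain is a forest whose roots are the individual names and one extra root, and
where every node has potential children, numbered by `ℕ`, for each role and time. Each node copies
an element of the model (`Model.nodeVal`); a child along `R` copies a witness of `E_1 inv(R)`, which
exists by the last group of TBox conjuncts.

A node has some successors in advance: the ABox neighbours of an individual, the parent of a child.
It is linked to just as many children as are lacking, so the number of its successors is the maximum
of the degree and the number of those given in advance (`KB.encard_succs`). The latter never pass a
threshold `q ∈ Q_T` without `E_q R` being true: for individuals this is what `A†` says, and a child
has only one parent (`KB.HoldsIn.mem_of_le_own`). Hence `≥ q R` and `E_q R` agree, and by induction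
so do `C` and `C*` (`KB.HoldsIn.mem_concept`). Edges of global roles are those of time `0`, which
the rigidity conjuncts justify. Elements of the model that no node copies do not matter, since TBox
axioms are universal.

Polynomial time. Programs of a small while language on stacks are simulated step by step by stack
machines (`Exec.steps`). On this basis `PolyTime` is shown to be closed under composition, pairing,
case distinction and folds whose accumulator grows by a bounded summand per step (`PolyTime.foldl`);
all list operations are folds. Objects are represented by their strings, and no recursive parser is
needed: a string in prefix notation is cut into pieces, from which numbers, role names and even `C*`
are read off one piece at a time. The numbers `q`, being binary, are never expanded; they are
compared bit by bit with the unary counts of ABox successors. -/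

namespace TDLLite

open Function Turing

/-! ## A while language over stacks and its compilation to stack machines -/

/-- Programs on a family of stacks of symbols that is indexed by `ℕ`. -/
inductive Com where
  | skip
  | push (r : ℕ) (s : Sym)
  | pop (r : ℕ)
  | dup (r r' : ℕ)
  | seq (c d : Com)
  | ite (r r' : ℕ) (p : Option Sym → Option Sym → Bool) (c d : Com)
  | loop (r : ℕ) (p : Option Sym → Bool) (c : Com)

infixr:60 " ;; " => Com.seq

/-- The contents of the stacks. -/
abbrev Store := ℕ → List Sym

/-- `Exec c S t S'`: started in `S`, the program `c` stops after `t` steps in `S'`. -/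
inductive Exec : Com → Store → ℕ → Store → Prop
  | skip (S : Store) : Exec .skip S 1 S
  | push (S : Store) (r : ℕ) (s : Sym) : Exec (.push r s) S 1 (update S r (s :: S r))
  | pop (S : Store) (r : ℕ) : Exec (.pop r) S 1 (update S r (S r).tail)
  | dup (S : Store) (r r' : ℕ) :
      Exec (.dup r r') S 1 (update S r' ((S r).head?.toList ++ S r'))
  | seq {c d : Com} {S S' S'' : Store} {t t' : ℕ} :
      Exec c S t S' → Exec d S' t' S'' → Exec (c ;; d) S (t + t') S''
  | iteTrue {r r' : ℕ} {p : Option Sym → Option Sym → Bool} {c d : Com} {S S' : Store} {t : ℕ} :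
      p (S r).head? (S r').head? = true → Exec c S t S' → Exec (.ite r r' p c d) S (1 + t) S'
  | iteFalse {r r' : ℕ} {p : Option Sym → Option Sym → Bool} {c d : Com} {S S' : Store} {t : ℕ} :
      p (S r).head? (S r').head? = false → Exec d S t S' → Exec (.ite r r' p c d) S (1 + t) S'
  | loopFalse {r : ℕ} {p : Option Sym → Bool} {c : Com} {S : Store} :
      p (S r).head? = false → Exec (.loop r p c) S 1 S
  | loopTrue {r : ℕ} {p : Option Sym → Bool} {c : Com} {S S' S'' : Store} {t t' : ℕ} :
      p (S r).head? = true → Exec c S t S' → Exec (.loop r p c) S' t' S'' →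
      Exec (.loop r p c) S (1 + (t + t')) S''

namespace Com

/-- A bound for the indices of the stacks that a program uses. -/
def bound : Com → ℕ
  | skip => 0
  | push r _ => r + 1
  | pop r => r + 1
  | dup r r' => max (r + 1) (r' + 1)
  | seq c d => max c.bound d.bound
  | ite r r' _ c d => max (max (r + 1) (r' + 1)) (max c.bound d.bound)
  | loop r _ c => max (r + 1) c.bound

/-- The labels of the compiled program. -/
def Label : Com → Type
  | skip | push _ _ | pop _ | dup _ _ => Unit
  | seq c d => c.Label ⊕ d.Label
  | ite _ _ _ c d => Option (c.Label ⊕ d.Label)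
  | loop _ _ c => Option c.Label

instance fintypeLabel : ∀ c : Com, Fintype c.Label
  | skip | push _ _ | pop _ | dup _ _ => inferInstanceAs (Fintype Unit)
  | seq c d =>
    letI := fintypeLabel c
    letI := fintypeLabel d
    inferInstanceAs (Fintype (c.Label ⊕ d.Label))
  | ite _ _ _ c d =>
    letI := fintypeLabel c
    letI := fintypeLabel d
    inferInstanceAs (Fintype (Option (c.Label ⊕ d.Label)))
  | loop _ _ c =>
    letI := fintypeLabel c
    inferInstanceAs (Fintype (Option c.Label))

/-- The label at which the compiled program starts. -/
def entry : ∀ c : Com, c.Label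
  | skip | push _ _ | pop _ | dup _ _ => ()
  | seq c _ => .inl c.entry
  | ite _ _ _ _ _ => none
  | loop _ _ _ => none

/-- Statements of a machine with `n` stacks of symbols. -/
abbrev MStmt (n : ℕ) (Λ : Type) := TM2.Stmt (fun _ : Fin n => Sym) Λ (Option Sym)

/-- The stack of the machine that represents stack `r` of the program. -/
def reg (n : ℕ) [NeZero n] (r : ℕ) : Fin n := Fin.ofNat n r

theorem val_reg {n : ℕ} [NeZero n] {r : ℕ} (hr : r < n) : (reg n r : ℕ) = r :=
  Nat.mod_eq_of_lt hr

/-- Machine code; the labels of the program are embedded by `e`, and the code leaves to `x`. -/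
def code (n : ℕ) [NeZero n] {Λ : Type} : ∀ c : Com, (c.Label → Λ) → Λ → c.Label → MStmt n Λ
  | skip, _, x, _ => .goto fun _ => x
  | push r s, _, x, _ => .push (reg n r) (fun _ => s) (.goto fun _ => x)
  | pop r, _, x, _ => .pop (reg n r) (fun v _ => v) (.goto fun _ => x)
  | dup r r', _, x, _ =>
    .peek (reg n r) (fun _ o => o) <| .branch Option.isSome
      -- The default symbol is never pushed, since the branch has tested the state. The state is
      -- reset to `none`, the value with which every piece of code starts and ends.
      (.push (reg n r') (fun v => v.getD .item) <| .load (fun _ => none) <| .goto fun _ => x)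
      (.goto fun _ => x)
  | seq c d, e, _, .inl l => c.code n (fun l => e (.inl l)) (e (.inr d.entry)) l
  | seq _ d, e, x, .inr l => d.code n (fun l => e (.inr l)) x l
  | ite r r' p c d, e, _, none =>
    .peek (reg n r) (fun _ o => o) <|
    -- The state holds the top of the first stack here; it is overwritten by the verdict of `p`,
    -- coded as `some` or `none`.
    .peek (reg n r') (fun v o => if p v o then some .item else none) <|
    .branch Option.isSome
      (.load (fun _ => none) <| .goto fun _ => e (some (.inl c.entry)))
      (.goto fun _ => e (some (.inr d.entry)))
  | ite _ _ _ c _, e, x, some (.inl l) => c.code n (fun l => e (some (.inl l))) x l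
  | ite _ _ _ _ d, e, x, some (.inr l) => d.code n (fun l => e (some (.inr l))) x l
  | loop r p c, e, x, none =>
    .peek (reg n r) (fun _ o => if p o then some .item else none) <|
    .branch Option.isSome
      (.load (fun _ => none) <| .goto fun _ => e (some c.entry))
      (.goto fun _ => x)
  | loop _ _ c, e, _, some l => c.code n (fun l => e (some l)) (e none) l

end Com

/-! ### Step-by-step simulation of programs by stack machines -/

/-- `Steps M t C D`: the machine `M` passes from `C` to `D` in `t` steps. -/
def Steps {n : ℕ} {Λ : Type} (M : Λ → Com.MStmt n Λ) (t : ℕ)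
    (C D : TM2.Cfg (fun _ : Fin n => Sym) Λ (Option Sym)) : Prop :=
  (flip bind (TM2.step M))^[t] (some C) = some D

theorem Steps.trans {n : ℕ} {Λ : Type} {M : Λ → Com.MStmt n Λ} {t t' : ℕ}
    {C D E : TM2.Cfg (fun _ : Fin n => Sym) Λ (Option Sym)}
    (h : Steps M t C D) (h' : Steps M t' D E) : Steps M (t + t') C E := by
  unfold Steps at *
  rw [Nat.add_comm, iterate_add_apply, h, h']

theorem Steps.one {n : ℕ} {Λ : Type} {M : Λ → Com.MStmt n Λ} {l : Λ} {v : Option Sym}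
    {S : Fin n → List Sym} {D : TM2.Cfg (fun _ : Fin n => Sym) Λ (Option Sym)}
    (h : TM2.stepAux (M l) v S = D) : Steps M 1 ⟨some l, v, S⟩ D := by
  simp [Steps, flip, h]

theorem update_comp_val (n : ℕ) [NeZero n] (S : Store) {r : ℕ} (hr : r < n) (w : List Sym) :
    update (fun i : Fin n => S i) (Com.reg n r) w = fun i : Fin n => update S r w i := by
  funext i
  have : i = Com.reg n r ↔ (i : ℕ) = r := by rw [Fin.ext_iff, Com.val_reg hr]
  by_cases h : (i : ℕ) = r
  · rw [this.2 h, update_self, Com.val_reg hr, update_self]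
  · rw [update_of_ne (mt this.1 h), update_of_ne h]

/-- The compiled program simulates the program. -/
theorem Exec.steps {n : ℕ} [NeZero n] {Λ : Type} {M : Λ → Com.MStmt n Λ} {c : Com}
    {S S' : Store} {t : ℕ} (h : Exec c S t S') :
    c.bound ≤ n → ∀ (e : c.Label → Λ) (x : Λ), (∀ l, M (e l) = c.code n e x l) →
    Steps M t ⟨some (e c.entry), none, fun i => S i⟩ ⟨some x, none, fun i => S' i⟩ := by
  induction h with
  | skip S =>
    intro _ e x hM
    exact .one (by rw [hM]; simp [Com.code])
  | push S r s =>
    intro hb e x hM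
    simp only [Com.bound] at hb
    refine .one ?_
    rw [hM]
    simp [Com.code, update_comp_val n S (show r < n by omega), Com.val_reg (show r < n by omega)]
  | pop S r =>
    intro hb e x hM
    simp only [Com.bound] at hb
    refine .one ?_
    rw [hM]
    simp [Com.code, update_comp_val n S (show r < n by omega), Com.val_reg (show r < n by omega)]
  | dup S r r' =>
    intro hb e x hM
    simp only [Com.bound] at hb
    refine .one ?_
    rw [hM]
    have h1 := Com.val_reg (show r < n by omega)
    have h2 := Com.val_reg (show r' < n by omega)
    rcases h : S r with _ | ⟨s, w⟩ <;>
    simp [Com.code, update_comp_val n S (show r' < n by omega), h1, h2, h]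
  | @seq c d S S' S'' t t' _ _ ih1 ih2 =>
    intro hb e x hM
    simp only [Com.bound] at hb
    exact (ih1 (by omega) (fun l => e (.inl l)) (e (.inr d.entry)) fun l => hM (.inl l)).trans
      (ih2 (by omega) (fun l => e (.inr l)) x fun l => hM (.inr l))
  | @iteTrue r r' p c d S S' t hp _ ih =>
    intro hb e x hM
    simp only [Com.bound] at hb
    have h1 := Com.val_reg (show r < n by omega)
    have h2 := Com.val_reg (show r' < n by omega)
    refine (Steps.one ?_).trans (ih (by omega) (fun l => e (some (.inl l))) x
      fun l => hM (some (.inl l)))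
    rw [hM]
    simp [Com.code, Com.entry, h1, h2, hp]
  | @iteFalse r r' p c d S S' t hp _ ih =>
    intro hb e x hM
    simp only [Com.bound] at hb
    have h1 := Com.val_reg (show r < n by omega)
    have h2 := Com.val_reg (show r' < n by omega)
    refine (Steps.one ?_).trans (ih (by omega) (fun l => e (some (.inr l))) x
      fun l => hM (some (.inr l)))
    rw [hM]
    simp [Com.code, Com.entry, h1, h2, hp]
  | @loopFalse r p c S hp =>
    intro hb e x hM
    simp only [Com.bound] at hb
    have h1 := Com.val_reg (show r < n by omega)
    refine .one ?_
    rw [hM]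
    simp [Com.code, Com.entry, h1, hp]
  | @loopTrue r p c S S' S'' t t' hp _ _ ih1 ih2 =>
    intro hb e x hM
    have hb' := hb
    simp only [Com.bound] at hb
    have h1 := Com.val_reg (show r < n by omega)
    -- The body leaves to the label of the test, from where the remaining rounds are a run of the
    -- same loop with the same embedding of labels.
    refine (Steps.one ?_).trans ((ih1 (by omega) (fun l => e (some l)) (e none)
      fun l => hM (some l)).trans (ih2 hb' e x hM))
    rw [hM]
    simp [Com.code, Com.entry, h1, hp]

/-- The store in which the stacks have the listed contents, and all others are empty. -/
def st (l : List (List Sym)) : Store := fun r => l.getD r []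

/-- The machine that runs a program on its stack `0`. -/
def Com.machine (c : Com) : FinTM2 where
  K := Fin (c.bound + 1)
  k₀ := 0
  k₁ := 0
  Γ := fun _ => Sym
  Λ := Option c.Label
  main := some c.entry
  σ := Option Sym
  initialState := none
  Γk₀Fin := inferInstanceAs (Fintype Sym)
  m := fun
    | none => .halt
    | some l => c.code (c.bound + 1) some none l

/-- A function on strings that a program computes in polynomial time is computable in polynomial
time by a machine. -/
theorem Com.computableInPolyTime {α β : Type} {ea : α → List Sym} {eb : β → List Sym} {f : α → β}
    (c : Com) (p : Polynomial ℕ)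
    (h : ∀ a, ∃ t ≤ p.eval (ea a).length, Exec c (st [ea a]) t (st [eb (f a)])) :
    Nonempty (TM2ComputableInPolyTime ea eb f) := by
  choose t ht h using h
  -- The additional step executes `halt` at the exit label `none`.
  refine ⟨⟨⟨c.machine, Equiv.refl _, Equiv.refl _⟩, p + 1, fun a => ⟨⟨t a + 1, ?_⟩, ?_⟩⟩⟩
  · have h1 := (h a).steps (n := c.bound + 1) (M := c.machine.m) (Nat.le_succ _) some none
      fun _ => rfl
    have h2 := h1.trans (Steps.one (D := ⟨none, none, fun i => st [eb (f a)] i⟩) rfl)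
    have key : ∀ (w : List Sym) (i : Fin (c.bound + 1)),
        (if h : i = (0 : Fin (c.bound + 1)) then w else []) = st [w] i := by
      intro w i
      by_cases hi : i = 0
      · subst hi; simp [st]
      · have hi' : (i : ℕ) ≠ 0 := fun h => hi (Fin.ext h)
        obtain ⟨m, hm⟩ := Nat.exists_eq_succ_of_ne_zero hi'
        simp [st, hm, hi]
    have e1 : initList c.machine (ea a) =
        ⟨some (some c.entry), none, fun i : Fin (c.bound + 1) => st [ea a] i⟩ :=
      congrArg (TM2.Cfg.mk _ _) (funext fun i => (key (ea a) i))
    have e2 : haltList c.machine (eb (f a)) =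
        ⟨none, none, fun i : Fin (c.bound + 1) => st [eb (f a)] i⟩ :=
      congrArg (TM2.Cfg.mk _ _) (funext fun i => (key (eb (f a)) i))
    have e3 : ∀ w : List Sym, List.map (Equiv.refl Sym).invFun w = w := fun w => by
      simp
    exact ((congrArg (fun w => (flip bind c.machine.step)^[t a + 1] (some (initList c.machine w)))
      (e3 (ea a))).trans ((congrArg (fun C => (flip bind (TM2.step c.machine.m))^[t a + 1] (some C))
      e1).trans (Eq.trans h2 (congrArg some e2.symm)))).trans
      (congrArg (fun w => some (haltList c.machine w)) (e3 (eb (f a))).symm)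
  · simpa using ht a

/-! ### Time-bounded runs and elementary programs -/

/-- The program `c` passes from the store `S` to the store `S'` in at most `b` steps. -/
def Com.Runs (c : Com) (S S' : Store) (b : ℕ) : Prop := ∃ t ≤ b, Exec c S t S'

/-- The program in which the indices of all stacks are increased by one. -/
def Com.shift : Com → Com
  | skip => skip
  | push r s => push (r + 1) s
  | pop r => pop (r + 1)
  | dup r r' => dup (r + 1) (r' + 1)
  | seq c d => seq c.shift d.shift
  | ite r r' p c d => ite (r + 1) (r' + 1) p c.shift d.shift
  | loop r p c => loop (r + 1) p c.shift

/-- The store with a stack inserted at index `0`. -/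
def Store.cons (w : List Sym) (S : Store) : Store
  | 0 => w
  | r + 1 => S r

theorem Store.update_cons (w : List Sym) (S : Store) (r : ℕ) (v : List Sym) :
    update (Store.cons w S) (r + 1) v = Store.cons w (update S r v) := by
  funext i
  cases i with
  | zero => rw [update_of_ne (by omega)]; rfl
  | succ i => simp [update_apply, Store.cons]

theorem Exec.shift {c : Com} {S S' : Store} {t : ℕ} (h : Exec c S t S') (w : List Sym) :
    Exec c.shift (Store.cons w S) t (Store.cons w S') := by
  induction h with
  | skip S => exact .skip _
  | push S r s => rw [← Store.update_cons]; exact .push _ _ _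
  | pop S r => rw [← Store.update_cons]; exact .pop _ _
  | dup S r r' => rw [← Store.update_cons]; exact .dup _ _ _
  | seq _ _ ih ih' => exact .seq ih ih'
  | iteTrue h _ ih => exact .iteTrue h ih
  | iteFalse h _ ih => exact .iteFalse h ih
  | loopFalse h => exact .loopFalse h
  | loopTrue h _ _ ih ih' => exact .loopTrue h ih ih'

/-- A step adds at most one symbol to a stack. Hence a polynomial-time program has an output of
polynomial length, without which such programs could not be composed. -/
theorem Exec.length_le {c : Com} {S S' : Store} {t : ℕ} (h : Exec c S t S') (r : ℕ) :
    (S' r).length ≤ (S r).length + t := by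
  induction h with
  | skip S => omega
  | push S r' s => by_cases h : r = r' <;> simp [h]
  | pop S r' =>
    by_cases h : r = r'
    · subst h; simp; omega
    · simp [h]
  | dup S r₁ r' =>
    by_cases h : r = r'
    · subst h
      cases S r₁ <;> simp
    · simp [h]
  | seq | loopTrue => omega
  | iteTrue | iteFalse => omega
  | loopFalse => omega

theorem st_cons (w : List Sym) (l : List (List Sym)) : st (w :: l) = Store.cons w (st l) := by
  funext i
  cases i <;> simp [st, Store.cons]

theorem update_st {l : List (List Sym)} {r : ℕ} (h : r < l.length) (w : List Sym) :
    update (st l) r w = st (l.set r w) := by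
  funext i
  by_cases hi : i = r
  · subst hi; simp [st, h]
  · simp [st, hi, Ne.symm hi]

/-- Stacks that are not listed are empty, so a program may use any number of auxiliary stacks as
long as it leaves them empty. -/
theorem st_pad (w : List Sym) (n : ℕ) : st (w :: List.replicate n []) = st [w] := by
  funext i
  cases i with
  | zero => rfl
  | succ i =>
    by_cases h : i < n <;> simp [st, h]

namespace Com

theorem ext_getD {x y : List (List Sym)} (h : x.length = y.length)
    (h' : ∀ i, x.getD i [] = y.getD i []) : x = y := by
  apply List.ext_getElem h
  intro i h1 h2
  simpa [h1, h2] using h' i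

theorem Runs.mono {c : Com} {S S' : Store} {b b' : ℕ} (h : c.Runs S S' b) (hb : b ≤ b') :
    c.Runs S S' b' := by
  obtain ⟨t, ht, h⟩ := h
  exact ⟨t, ht.trans hb, h⟩

theorem Runs.congr {c : Com} {S : Store} {l l' : List (List Sym)} {b : ℕ} (h : c.Runs S (st l) b)
    (hl : l.length = l'.length) (hi : ∀ i, l.getD i [] = l'.getD i []) : c.Runs S (st l') b := by
  rwa [← ext_getD hl hi]

theorem Runs.seq {c d : Com} {S S' S'' : Store} {b b' : ℕ} (h : c.Runs S S' b)
    (h' : d.Runs S' S'' b') : (c ;; d).Runs S S'' (b + b') := by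
  obtain ⟨t, ht, h⟩ := h
  obtain ⟨t', ht', h'⟩ := h'
  exact ⟨t + t', by omega, .seq h h'⟩

/-- The frame rule: a subroutine runs beside a saved stack that it cannot touch. -/
theorem Runs.shift {c : Com} {l l' : List (List Sym)} {b : ℕ} (h : c.Runs (st l) (st l') b)
    (w : List Sym) : c.shift.Runs (st (w :: l)) (st (w :: l')) b := by
  obtain ⟨t, ht, h⟩ := h
  rw [st_cons, st_cons]
  exact ⟨t, ht, h.shift w⟩

theorem Runs.pad {c : Com} {w w' : List Sym} {b : ℕ} (h : c.Runs (st [w]) (st [w']) b) (n : ℕ) :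
    c.Runs (st (w :: List.replicate n [])) (st (w' :: List.replicate n [])) b := by
  rwa [st_pad, st_pad]

theorem Runs.unpad {c : Com} {w w' : List Sym} {b : ℕ} (n : ℕ)
    (h : c.Runs (st (w :: List.replicate n [])) (st (w' :: List.replicate n [])) b) :
    c.Runs (st [w]) (st [w']) b := by
  rwa [st_pad, st_pad] at h

section

variable {l : List (List Sym)}

theorem runs_skip : skip.Runs (st l) (st l) 1 := ⟨1, le_rfl, .skip _⟩

theorem runs_push (r : ℕ) (s : Sym) (h : r < l.length := by simp) :
    (push r s).Runs (st l) (st (l.set r (s :: l.getD r []))) 1 := by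
  rw [← update_st h]
  exact ⟨1, le_rfl, .push _ _ _⟩

theorem runs_pop (r : ℕ) (h : r < l.length := by simp) :
    (pop r).Runs (st l) (st (l.set r (l.getD r []).tail)) 1 := by
  rw [← update_st h]
  exact ⟨1, le_rfl, .pop _ _⟩

theorem runs_dup (r r' : ℕ) (h : r' < l.length := by simp) :
    (dup r r').Runs (st l) (st (l.set r' ((l.getD r []).head?.toList ++ l.getD r' []))) 1 := by
  rw [← update_st h]
  exact ⟨1, le_rfl, .dup _ _ _⟩

theorem runs_ite_true {r r' : ℕ} {p : Option Sym → Option Sym → Bool} {c d : Com} {S' : Store}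
    {b : ℕ} (h : p (l.getD r []).head? (l.getD r' []).head? = true) (hc : c.Runs (st l) S' b) :
    (ite r r' p c d).Runs (st l) S' (1 + b) := by
  obtain ⟨t, ht, hc⟩ := hc
  exact ⟨1 + t, by omega, .iteTrue h hc⟩

theorem runs_ite_false {r r' : ℕ} {p : Option Sym → Option Sym → Bool} {c d : Com} {S' : Store}
    {b : ℕ} (h : p (l.getD r []).head? (l.getD r' []).head? = false) (hd : d.Runs (st l) S' b) :
    (ite r r' p c d).Runs (st l) S' (1 + b) := by
  obtain ⟨t, ht, hd⟩ := hd
  exact ⟨1 + t, by omega, .iteFalse h hd⟩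

theorem runs_loop_false {r : ℕ} {p : Option Sym → Bool} {c : Com}
    (h : p (l.getD r []).head? = false) : (loop r p c).Runs (st l) (st l) 1 :=
  ⟨1, le_rfl, .loopFalse h⟩

theorem runs_loop_true {r : ℕ} {p : Option Sym → Bool} {c : Com} {l' : List (List Sym)}
    {S'' : Store} {b b' : ℕ} (h : p (l.getD r []).head? = true) (hc : c.Runs (st l) (st l') b)
    (h' : (loop r p c).Runs (st l') S'' b') : (loop r p c).Runs (st l) S'' (1 + (b + b')) := by
  obtain ⟨t, ht, hc⟩ := hc
  obtain ⟨t', ht', h'⟩ := h'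
  exact ⟨1 + (t + t'), by omega, .loopTrue h hc h'⟩

end

/-- Empty a stack. -/
def clear (r : ℕ) : Com := loop r Option.isSome (pop r)

theorem runs_clear (r : ℕ) : ∀ {l : List (List Sym)} (_ : r < l.length := by simp),
    (clear r).Runs (st l) (st (l.set r [])) (2 * (l.getD r []).length + 1) := by
  suffices ∀ (w : List Sym) (l : List (List Sym)), r < l.length → l.getD r [] = w →
      (clear r).Runs (st l) (st (l.set r [])) (2 * w.length + 1) from fun {l} h => this _ l h rfl
  intro w
  induction w with
  | nil =>
    intro l h hw
    have e : l.set r [] = l := by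
      apply ext_getD (by simp)
      intro i
      simp only [List.getD_eq_getElem?_getD, List.getElem?_set] at hw ⊢
      grind
    rw [e]
    exact runs_loop_false (by rw [hw]; rfl)
  | cons s w ih =>
    intro l h hw
    have h2 := ih (l.set r w) (by simpa) (by simp [h])
    rw [List.set_set] at h2
    have h1 := runs_pop (l := l) r h
    rw [hw] at h1
    refine (runs_loop_true ?_ h1 h2).mono ?_
    · rw [hw]; rfl
    · simp; omega

/-- Move a stack to another one, which reverses it. -/
def rev (a b : ℕ) : Com := loop a Option.isSome (dup a b ;; pop a)

theorem runs_rev (a b : ℕ) {l : List (List Sym)} (hab : a ≠ b := by decide)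
    (ha : a < l.length := by simp) (hb : b < l.length := by simp) :
    (rev a b).Runs (st l) (st ((l.set b ((l.getD a []).reverse ++ l.getD b [])).set a []))
      (3 * (l.getD a []).length + 1) := by
  suffices ∀ (w : List Sym) (l : List (List Sym)), a < l.length → b < l.length → l.getD a [] = w →
      (rev a b).Runs (st l) (st ((l.set b (w.reverse ++ l.getD b [])).set a []))
      (3 * w.length + 1) from this _ l ha hb rfl
  clear ha hb l
  intro w
  induction w with
  | nil =>
    intro l ha hb hw
    have e : (l.set b (([] : List Sym).reverse ++ l.getD b [])).set a [] = l := by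
      apply ext_getD (by simp)
      intro i
      simp only [List.getD_eq_getElem?_getD, List.getElem?_set] at hw ⊢
      grind
    rw [e]
    exact runs_loop_false (by rw [hw]; rfl)
  | cons s w ih =>
    intro l ha hb hw
    have h2 := ih ((l.set b (s :: l.getD b [])).set a w) (by simpa) (by simpa) (by simp [ha])
    have h1 := (runs_dup (l := l) a b hb).seq (runs_pop a (by simpa))
    refine (runs_loop_true (l' := (l.set b (s :: l.getD b [])).set a w) (b := 2) ?_ ?_
      (S'' := st ((l.set b ((s :: w).reverse ++ l.getD b [])).set a [])) (b' := 3 * w.length + 1)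
      ?_).mono ?_
    · rw [hw]; rfl
    · refine h1.congr (by simp) fun i => ?_
      clear ih h1 h2
      simp only [List.getD_eq_getElem?_getD, List.getElem?_set] at hw ⊢
      grind
    · refine h2.congr (by simp) fun i => ?_
      clear ih h1 h2
      simp only [List.getD_eq_getElem?_getD, List.getElem?_set] at hw ⊢
      grind
    · simp; omega

/-- Move a stack to two other ones, which reverses it. -/
def copy (a b c : ℕ) : Com := loop a Option.isSome (dup a b ;; dup a c ;; pop a)

theorem runs_copy (a b c : ℕ) {l : List (List Sym)} (hab : a ≠ b := by decide)
    (hac : a ≠ c := by decide) (hbc : b ≠ c := by decide)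
    (ha : a < l.length := by simp) (hb : b < l.length := by simp) (hc : c < l.length := by simp) :
    (copy a b c).Runs (st l) (st (((l.set b ((l.getD a []).reverse ++ l.getD b [])).set c
      ((l.getD a []).reverse ++ l.getD c [])).set a [])) (4 * (l.getD a []).length + 1) := by
  suffices ∀ (w : List Sym) (l : List (List Sym)), a < l.length → b < l.length → c < l.length →
      l.getD a [] = w →
      (copy a b c).Runs (st l) (st (((l.set b (w.reverse ++ l.getD b [])).set c
      (w.reverse ++ l.getD c [])).set a [])) (4 * w.length + 1) from this _ l ha hb hc rfl
  clear ha hb hc l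
  intro w
  induction w with
  | nil =>
    intro l ha hb hc hw
    have e : ((l.set b (([] : List Sym).reverse ++ l.getD b [])).set c
        (([] : List Sym).reverse ++ l.getD c [])).set a [] = l := by
      apply ext_getD (by simp)
      intro i
      simp only [List.getD_eq_getElem?_getD, List.getElem?_set] at hw ⊢
      grind
    rw [e]
    exact runs_loop_false (by rw [hw]; rfl)
  | cons s w ih =>
    intro l ha hb hc hw
    have h2 := ih (((l.set b (s :: l.getD b [])).set c (s :: l.getD c [])).set a w) (by simpa)
      (by simpa) (by simpa) (by simp [ha])
    have h1 := (runs_dup (l := l) a b hb).seq ((runs_dup a c (by simpa)).seq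
      (runs_pop a (by simpa)))
    refine (runs_loop_true (l' := ((l.set b (s :: l.getD b [])).set c
      (s :: l.getD c [])).set a w) (b := 3) ?_ ?_
      (S'' := st (((l.set b ((s :: w).reverse ++ l.getD b [])).set c
      ((s :: w).reverse ++ l.getD c [])).set a [])) (b' := 4 * w.length + 1) ?_).mono ?_
    · rw [hw]; rfl
    · refine h1.congr (by simp) fun i => ?_
      clear ih h1 h2
      simp only [List.getD_eq_getElem?_getD, List.getElem?_set] at hw ⊢
      grind
    · refine h2.congr (by simp) fun i => ?_
      clear ih h1 h2
      simp only [List.getD_eq_getElem?_getD, List.getElem?_set] at hw ⊢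
      grind
    · simp; omega

end Com

/-! ## Functions that are computable in polynomial time, on data represented by binary trees -/

/-- Binary trees whose leaves are symbols. -/
inductive Sexp where
  | leaf (s : Sym)
  | cons (x y : Sexp)

namespace Sexp

/-- Binary trees as strings, in prefix notation. -/
def str : Sexp → List Sym
  | leaf s => [.endList, s]
  | cons x y => .item :: (x.str ++ y.str)

theorem str_inj : ∀ {x y : Sexp} {u v : List Sym}, x.str ++ u = y.str ++ v → x = y ∧ u = v := by
  intro x
  induction x with
  | leaf s => intro y u v h; cases y <;> simp_all [str]
  | cons x x' ih ih' =>
    intro y u v h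
    cases y <;> simp [str] at h
    obtain ⟨rfl, h'⟩ := ih h
    obtain ⟨rfl, rfl⟩ := ih' h'
    exact ⟨rfl, rfl⟩

end Sexp

/-- Types whose elements are represented by binary trees. -/
class Rep (α : Type) where
  rep : α → Sexp

open TDLLite.Rep (rep)

namespace Com

/-- The loop that moves the first tree of stack `0` to stack `1`, which reverses it; stack `2` is a
counter. -/
def splitLoop : Com :=
  loop 2 Option.isSome <| ite 0 0 (fun o _ => o == some .item)
    (dup 0 1 ;; pop 0 ;; push 2 .item)
    (dup 0 1 ;; pop 0 ;; dup 0 1 ;; pop 0 ;; pop 2)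

/-- The counter is the number of trees still to be moved: an inner node raises it by one, a leaf
lowers it. The hypothesis is a run that continues after the tree, so that the induction hypothesis
for the right subtree can be fed into the one for the left subtree. A round takes at most 7 steps
and moves at least one symbol. -/
theorem runs_splitLoop : ∀ (x : Sexp) (w u v : List Sym) (s : Sym) (l : List (List Sym))
    {S' : Store} {b : ℕ}, splitLoop.Runs (st (w :: (x.str.reverse ++ u) :: v :: l)) S' b →
    splitLoop.Runs (st ((x.str ++ w) :: u :: (s :: v) :: l)) S' (b + 7 * x.str.length) := by
  intro x
  induction x with
  | leaf a =>
    intro w u v s l S' b h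
    have h1 := (runs_dup (l := (.endList :: a :: w) :: u :: (s :: v) :: l) 0 1).seq
      ((runs_pop 0).seq ((runs_dup 0 1).seq ((runs_pop 0).seq (runs_pop 2))))
    exact (runs_loop_true (l := (.endList :: a :: w) :: u :: (s :: v) :: l) rfl
      (runs_ite_false rfl h1) h).mono (by simp [Sexp.str]; omega)
  | cons x y ih ih' =>
    intro w u v s l S' b h
    simp only [Sexp.str, List.reverse_cons, List.append_assoc, List.reverse_append] at h
    have h1 := (runs_dup (l := (.item :: (x.str ++ (y.str ++ w))) :: u :: (s :: v) :: l) 0 1).seq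
      ((runs_pop 0).seq (runs_push 2 .item))
    have h2 := ih (y.str ++ w) (.item :: u) (s :: v) .item l (ih' _ _ _ _ _ h)
    simp only [Sexp.str, List.cons_append, List.append_assoc]
    exact (runs_loop_true (l := (.item :: (x.str ++ (y.str ++ w))) :: u :: (s :: v) :: l) rfl
      (runs_ite_true rfl h1) h2).mono (by simp; omega)

/-- Move the first tree of stack `0` to stack `1`, which reverses it; stack `2` is a counter. -/
def split : Com := push 2 .item ;; splitLoop

theorem runs_split (x : Sexp) (w u : List Sym) (l : List (List Sym)) :
    split.Runs (st ((x.str ++ w) :: u :: [] :: l)) (st (w :: (x.str.reverse ++ u) :: [] :: l))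
      (7 * x.str.length + 2) :=
  ((runs_push (l := (x.str ++ w) :: u :: [] :: l) 2 .item).seq
    (runs_splitLoop x w u [] .item l (runs_loop_false rfl))).mono (by omega)

/-- Duplicate a string. -/
def double : Com := rev 0 2 ;; copy 2 0 1

theorem runs_double (w : List Sym) (l : List (List Sym)) :
    double.Runs (st (w :: [] :: [] :: l)) (st (w :: w :: [] :: l)) (7 * w.length + 2) := by
  have h := (runs_rev (l := w :: [] :: [] :: l) 0 2).seq (runs_copy 2 0 1)
  simp at h
  exact h.mono (by omega)

/-- Push the symbols of a string. -/
def pushes : List Sym → Com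
  | [] => skip
  | s :: w => pushes w ;; push 0 s

theorem runs_pushes (w u : List Sym) (l : List (List Sym)) :
    (pushes w).Runs (st (u :: l)) (st ((w ++ u) :: l)) (w.length + 1) := by
  induction w with
  | nil => exact runs_skip
  | cons s w ih => exact (ih.seq (runs_push 0 s)).mono (by simp)

/-- Exchange two strings. -/
def swap : Com := rev 0 2 ;; rev 1 3 ;; rev 2 1 ;; rev 3 0

theorem runs_swap (u v : List Sym) : swap.Runs (st [u, v, [], []]) (st [v, u, [], []])
    (6 * u.length + 6 * v.length + 4) := by
  have h := (runs_rev (l := [u, v, [], []]) 0 2).seq ((runs_rev 1 3).seq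
    ((runs_rev 2 1).seq (runs_rev 3 0)))
  simp at h
  exact h.mono (by omega)

/-- Compare stacks `2` and `0`; a difference is recorded on stack `1`. -/
def compareLoop : Com :=
  loop 2 Option.isSome <| ite 2 0 (fun o o' => o == o') (pop 2 ;; pop 0) (push 1 .item ;; pop 2)

/-- A difference shows up either as a mark on stack `1` or as a remainder on stack `0`, the latter
when the second string is longer. The bounds on the lengths limit the time that is needed to clear
both stacks afterwards. -/
theorem runs_compareLoop : ∀ a b m : List Sym, ∃ b' m' : List Sym,
    compareLoop.Runs (st [b, m, a]) (st [b', m', []]) (4 * a.length + 1) ∧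
    b'.length ≤ b.length ∧ m'.length ≤ m.length + a.length ∧
    (b' = [] ∧ m' = [] ↔ m = [] ∧ a = b) := by
  intro a
  induction a with
  | nil => exact fun b m => ⟨b, m, runs_loop_false rfl, le_rfl, by simp, by grind⟩
  | cons s a ih =>
    intro b m
    by_cases hb : b.head? = some s
    · obtain ⟨b, rfl⟩ : ∃ c, b = s :: c := by
        cases b <;> simp_all
      obtain ⟨b', m', h, h1, h2, h3⟩ := ih b m
      refine ⟨b', m', (runs_loop_true (l := [s :: b, m, s :: a]) rfl
        (runs_ite_true (by simp) ((runs_pop 2).seq (runs_pop 0))) h).mono ?_, ?_, ?_, ?_⟩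
      · simp; omega
      · simp; omega
      · simp; omega
      · simpa using h3
    · obtain ⟨b', m', h, h1, h2, h3⟩ := ih b (.item :: m)
      refine ⟨b', m', (runs_loop_true (l := [b, m, s :: a]) rfl
        (runs_ite_false ?_ ((runs_push 1 .item).seq (runs_pop 2))) h).mono ?_, ?_, ?_, ?_⟩
      · simp
        grind
      · simp; omega
      · omega
      · simp at h2 ⊢; omega
      · grind

end Com

/-! ### Polynomial-time functions and their basic closure properties -/

/-- The representation of an object as a string. -/
def repStr {α : Type} [Rep α] (a : α) : List Sym := (rep a).str

/-- The size of the representation of an object. -/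
def size {α : Type} [Rep α] (a : α) : ℕ := (repStr a).length

/-- Functions that are computable in polynomial time. -/
@[fun_prop]
def PolyTime {α β : Type} [Rep α] [Rep β] (f : α → β) : Prop :=
  ∃ (c : Com) (p : Polynomial ℕ), ∀ a, c.Runs (st [repStr a]) (st [repStr (f a)]) (p.eval (size a))

/-- The coefficients are natural numbers, hence nonnegative. -/
theorem eval_mono (p : Polynomial ℕ) : Monotone fun n => p.eval n := by
  intro m n h
  simp only [Polynomial.eval_eq_sum, Polynomial.sum]
  gcongr

instance : Rep Sym := ⟨.leaf⟩

instance : Rep Bool := ⟨fun b => .leaf (.bit b)⟩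

instance {α β : Type} [Rep α] [Rep β] : Rep (α × β) := ⟨fun x => .cons (rep x.1) (rep x.2)⟩

/-- Lists of objects as binary trees. -/
def listRep {α : Type} [Rep α] : List α → Sexp
  | [] => .leaf .endList
  | a :: l => .cons (rep a) (listRep l)

instance {α : Type} [Rep α] : Rep (List α) := ⟨listRep⟩

section

variable {α β γ δ : Type} [Rep α] [Rep β] [Rep γ] [Rep δ]

theorem repStr_pair (a : α) (b : β) : repStr (a, b) = .item :: (repStr a ++ repStr b) := rfl

theorem repStr_nil : repStr ([] : List α) = [.endList, .endList] := rfl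

theorem repStr_cons (a : α) (l : List α) : repStr (a :: l) = .item :: (repStr a ++ repStr l) := rfl

theorem size_pair (a : α) (b : β) : size (a, b) = size a + size b + 1 := by
  simp [size, repStr_pair]

theorem size_nil : size ([] : List α) = 2 := rfl

theorem size_cons (a : α) (l : List α) : size (a :: l) = size a + size l + 1 := by
  simp [size, repStr_cons]

theorem size_sym (s : Sym) : size s = 2 := rfl

theorem size_bool (b : Bool) : size b = 2 := rfl

theorem size_append (l l' : List α) : size (l ++ l') + 2 = size l + size l' := by
  induction l with
  | nil => simp [size_nil, Nat.add_comm]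
  | cons a l ih => simp only [List.cons_append, size_cons]; omega

theorem length_le_size (l : List α) : l.length ≤ size l := by
  induction l with
  | nil => simp
  | cons a l ih => simp only [List.length_cons, size_cons]; omega

theorem size_le_of_mem {l : List α} {a : α} (h : a ∈ l) : size a ≤ size l := by
  induction l with
  | nil => simp at h
  | cons b l ih =>
    rw [size_cons]
    rcases List.mem_cons.1 h with rfl | h
    · omega
    · have := ih h; omega

namespace PolyTime

theorem size_le {f : α → β} (hf : PolyTime f) :
    ∃ p : Polynomial ℕ, ∀ a, size (f a) ≤ p.eval (size a) := by
  obtain ⟨c, p, h⟩ := hf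
  refine ⟨.X + p, fun a => ?_⟩
  obtain ⟨t, ht, h⟩ := h a
  have := h.length_le 0
  simp only [st, List.getD_cons_zero] at this
  simp only [Polynomial.eval_add, Polynomial.eval_X]
  unfold size at *
  omega

theorem of_rep {f : α → β} (h : ∀ a, rep (f a) = rep a) : PolyTime f :=
  ⟨.skip, 1, fun a => by
    unfold repStr
    rw [h, Polynomial.eval_one]
    exact Com.runs_skip⟩

@[fun_prop]
theorem id : PolyTime (fun a : α => a) := of_rep fun _ => rfl

@[fun_prop]
theorem comp {g : β → γ} {f : α → β} (hg : PolyTime g) (hf : PolyTime f) :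
    PolyTime (fun a => g (f a)) := by
  obtain ⟨r, hr⟩ := hf.size_le
  obtain ⟨c, p, hc⟩ := hf
  obtain ⟨d, q, hd⟩ := hg
  refine ⟨c ;; d, p + q.comp r, fun a => ((hc a).seq (hd (f a))).mono ?_⟩
  simpa using eval_mono q (hr a)

@[fun_prop]
theorem const (b : β) : PolyTime (fun _ : α => b) := by
  refine ⟨.clear 0 ;; .pushes (repStr b), 2 * .X + ((repStr b).length + 2 : ℕ), fun a => ?_⟩
  have h := (Com.runs_clear (l := [repStr a]) 0).seq (Com.runs_pushes (repStr b) [] [])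
  simp only [List.append_nil] at h
  refine h.mono ?_
  simp [size]
  omega

@[fun_prop]
theorem pair {f : α → β} {g : α → γ} (hf : PolyTime f) (hg : PolyTime g) :
    PolyTime (fun a => (f a, g a)) := by
  obtain ⟨q, hq⟩ := hf.size_le
  obtain ⟨r, hr⟩ := hg.size_le
  obtain ⟨c, p, hc⟩ := hf
  obtain ⟨d, p', hd⟩ := hg
  -- The second component is computed on stack `1` beside a copy of the input; after the exchange
  -- the first one is computed in the same way. Two reversals then put it in front of the second,
  -- and `.item` completes the pair.
  refine ⟨.double ;; d.shift ;; .swap ;; c.shift ;; .rev 1 2 ;; .rev 2 0 ;; .push 0 .item,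
    13 * .X + p' + 6 * r + p + 6 * q + 9, fun a => .unpad 3 ?_⟩
  have h := (Com.runs_rev (l := [repStr (g a), repStr (f a), [], []]) 1 2).seq
    ((Com.runs_rev 2 0).seq (Com.runs_push 0 .item))
  simp at h
  refine ((Com.runs_double (repStr a) [[]]).seq ((((hd a).pad 2).shift (repStr a)).seq
    ((Com.runs_swap _ _).seq ((((hc a).pad 2).shift (repStr (g a))).seq h)))).mono ?_
  have h1 := hq a
  have h2 := hr a
  simp [size] at *
  omega

@[fun_prop]
theorem ite {p : α → Prop} [∀ a, Decidable (p a)] {f g : α → β}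
    (hp : PolyTime (fun a => decide (p a))) (hf : PolyTime f) (hg : PolyTime g) :
    PolyTime (fun a => if p a then f a else g a) := by
  obtain ⟨e, r, he⟩ := hp
  obtain ⟨c, q, hc⟩ := hf
  obtain ⟨d, q', hd⟩ := hg
  -- A Boolean is written as `.endList` followed by its bit; the first is popped so that the bit can
  -- be inspected.
  refine ⟨.double ;; e.shift ;; .pop 1 ;; .ite 1 1 (fun o _ => o == some (.bit true))
    (.pop 1 ;; c) (.pop 1 ;; d), 7 * .X + r + q + q' + 5, fun a => .unpad 2 ?_⟩
  have h1 := fun k S' b (h : Com.Runs k _ S' b) => (Com.runs_double (repStr a) []).seq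
    ((((he a).pad 1).shift (repStr a)).seq ((Com.runs_pop 1).seq h))
  by_cases h : p a
  · simp only [h, decide_true, if_true] at h1 ⊢
    refine (h1 _ _ _ (Com.runs_ite_true rfl ((Com.runs_pop 1).seq ((hc a).pad 2)))).mono ?_
    simp [size]; omega
  · simp only [h, decide_false, if_false] at h1 ⊢
    refine (h1 _ _ _ (Com.runs_ite_false rfl ((Com.runs_pop 1).seq ((hd a).pad 2)))).mono ?_
    simp [size]; omega

theorem fst : PolyTime (Prod.fst : α × β → α) := by
  refine ⟨.pop 0 ;; .split ;; .clear 0 ;; .rev 1 0, 12 * .X + 5, fun x => .unpad 2 ?_⟩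
  have h := (Com.runs_clear (l := [repStr x.2, (repStr x.1).reverse, []]) 0).seq (Com.runs_rev 1 0)
  have h1 := Com.runs_split (rep x.1) (repStr x.2) [] []
  simp at h h1
  refine ((Com.runs_pop (l := [repStr x, [], []]) 0).seq (h1.seq h)).mono ?_
  simp [size, repStr]
  simp [rep, Sexp.str]
  omega

theorem snd : PolyTime (Prod.snd : α × β → β) := by
  refine ⟨.pop 0 ;; .split ;; .clear 1, 12 * .X + 5, fun x => .unpad 2 ?_⟩
  have h := Com.runs_clear (l := [repStr x.2, (repStr x.1).reverse, []]) 1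
  have h1 := Com.runs_split (rep x.1) (repStr x.2) [] []
  simp at h h1
  refine ((Com.runs_pop (l := [repStr x, [], []]) 0).seq (h1.seq h)).mono ?_
  simp [size, repStr]
  simp [rep, Sexp.str]
  omega

theorem decide_eq [DecidableEq α] (hα : Injective (rep : α → Sexp)) :
    PolyTime (fun x : α × α => decide (x.1 = x.2)) := by
  -- After the comparison, a remainder on stack `0` is turned into a mark on stack `1`, so that one
  -- test of stack `1` detects both kinds of difference.
  refine ⟨.pop 0 ;; .split ;; .rev 1 2 ;; .compareLoop ;;
    .ite 0 0 (fun o _ => o.isSome) (.push 1 .item) .skip ;; .clear 0 ;;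
    .ite 1 1 (fun o _ => o.isSome) (.clear 1 ;; .push 0 (.bit false) ;; .push 0 .endList)
      (.push 0 (.bit true) ;; .push 0 .endList), 30 * .X + 30, fun x => .unpad 2 ?_⟩
  have h1 := Com.runs_split (rep x.1) (repStr x.2) [] []
  have h2 := Com.runs_rev (l := [repStr x.2, (repStr x.1).reverse, []]) 1 2
  simp only [List.getD_cons_succ, List.getD_cons_zero, List.reverse_reverse, List.set_cons_succ,
    List.set_cons_zero, List.append_nil] at h1 h2
  obtain ⟨b, m, h3, hb, hm, h4⟩ := Com.runs_compareLoop (repStr x.1) (repStr x.2) []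
  have e : b = [] ∧ m = [] ↔ x.1 = x.2 := by
    rw [h4]
    constructor
    · intro h
      refine hα (Sexp.str_inj (u := []) (v := []) ?_).1
      simpa [repStr] using h.2
    · intro h
      exact ⟨rfl, congrArg repStr h⟩
  have h0 := fun k S' t (h : Com.Runs k _ S' t) => (Com.runs_pop (l := [repStr x, [], []]) 0).seq
    (h1.seq (h2.seq (h3.seq h)))
  have hs : size x = (repStr x.1).length + (repStr x.2).length + 1 := size_pair _ _
  have hr : (rep x.1).str.length = (repStr x.1).length := rfl
  simp only [List.length_nil, List.length_reverse] at h0 hm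
  by_cases hx : x.1 = x.2
  · obtain ⟨rfl, rfl⟩ := e.2 hx
    simp only [hx, decide_true]
    refine (h0 _ _ _ ((Com.runs_ite_false rfl Com.runs_skip).seq ((Com.runs_clear 0).seq
      (Com.runs_ite_false rfl ((Com.runs_push 0 (.bit true)).seq
        (Com.runs_push 0 .endList)))))).mono ?_
    simp [hs, hr]; omega
  · obtain ⟨s, m₁, h5, h6⟩ : ∃ s m₁, m₁.length ≤ m.length ∧
        (Com.ite 0 0 (fun o _ => o.isSome) (.push 1 .item) .skip).Runs (st [b, m, []])
          (st [b, s :: m₁, []]) 2 := by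
      cases b with
      | nil =>
        cases m with
        | nil => exact absurd (e.1 ⟨rfl, rfl⟩) hx
        | cons s m => exact ⟨s, m, by simp, Com.runs_ite_false rfl Com.runs_skip⟩
      | cons a b => exact ⟨.item, m, le_rfl, Com.runs_ite_true rfl (Com.runs_push 1 .item)⟩
    simp only [hx, decide_false]
    refine (h0 _ _ _ (h6.seq ((Com.runs_clear 0).seq
      (Com.runs_ite_true rfl ((Com.runs_clear 1).seq ((Com.runs_push 0 (.bit false)).seq
        (Com.runs_push 0 .endList))))))).mono ?_
    simp [hs, hr]; omega

end PolyTime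

end

/-! ### Folds and case distinction over lists -/

namespace Com

/-- The body of the loop for a left fold whose step is computed by `c`. Stack `0` holds the list,
stack `3` the parameter, stack `4` the accumulator. -/
def foldBody (c : Com) : Com :=
  -- The first entry `b` is cut off the list and placed below the accumulator `s` on stack `4`,
  -- which becomes the pair `(s, b)`. The parameter `a` is copied in front, which makes it `(a, s,
  -- b)`, and the step is run on stack `4` in place.
  pop 0 ;; split ;; rev 4 5 ;; rev 1 4 ;; rev 5 4 ;; push 4 .item ;; rev 3 5 ;; copy 5 3 4 ;;
    push 4 .item ;; c.shift.shift.shift.shift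

/-- The loop for a left fold. -/
def foldLoop (c : Com) : Com := loop 0 (· == some .item) (foldBody c)

variable {α β σ : Type} [Rep α] [Rep β] [Rep σ]

theorem runs_foldBody {c : Com} {p : Polynomial ℕ} {h : α → σ → β → σ}
    (hc : ∀ x : α × σ × β, c.Runs (st [repStr x]) (st [repStr (h x.1 x.2.1 x.2.2)])
      (p.eval (size x))) (a : α) (s : σ) (b : β) (l : List β) :
    (foldBody c).Runs (st [repStr (b :: l), [], [], repStr a, repStr s, []])
      (st [repStr l, [], [], repStr a, repStr (h a s b), []])
      (10 * size b + 6 * size s + 7 * size a + p.eval (size a + size s + size b + 2) + 10) := by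
  have h1 := runs_split (rep b) (repStr l) [] [repStr a, repStr s, []]
  have h2 := (runs_rev (l := [repStr l, (repStr b).reverse, [], repStr a, repStr s, []]) 4 5).seq
    ((runs_rev 1 4).seq ((runs_rev 5 4).seq ((runs_push 4 .item).seq ((runs_rev 3 5).seq
      ((runs_copy 5 3 4).seq (runs_push 4 .item))))))
  have h3 := (((((hc (a, s, b)).pad 1).shift (repStr a)).shift []).shift []).shift (repStr l)
  simp only [List.append_nil] at h1
  simp at h2
  obtain ⟨t1, ht1, h1⟩ := h1
  obtain ⟨t2, ht2, h2⟩ := h2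
  obtain ⟨t3, ht3, h3⟩ := h3
  -- The run is taken apart because sequencing in the program associates to the right.
  cases h2 with | seq e1 h2 =>
  cases h2 with | seq e2 h2 =>
  cases h2 with | seq e3 h2 =>
  cases h2 with | seq e4 h2 =>
  cases h2 with | seq e5 h2 =>
  cases h2 with | seq e6 e7 =>
  have h0 : (pop 0).Runs (st [repStr (b :: l), [], [], repStr a, repStr s, []])
    (st [repStr b ++ repStr l, [], [], repStr a, repStr s, []]) 1 := runs_pop 0
  obtain ⟨t0, ht0, h0⟩ := h0
  refine ⟨_, ?_, h0.seq (h1.seq (e1.seq (e2.seq (e3.seq (e4.seq (e5.seq (e6.seq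
    (e7.seq h3))))))))⟩
  have hs : size (a, s, b) = size a + size s + size b + 2 := by simp [size_pair]; omega
  rw [hs] at ht3
  have hb : (rep b).str.length = size b := rfl
  simp only [size] at *
  omega

/-- `M` bounds the list, the parameter and all accumulators at once: a round adds at most `D` to the
accumulator, and the last hypothesis reserves room for all rounds to come. So every round obeys the
same bound, in which `3 * M + 2` bounds the size of the argument of the step. -/
theorem runs_foldLoop {c : Com} {p : Polynomial ℕ} {h : α → σ → β → σ}
    (hc : ∀ x : α × σ × β, c.Runs (st [repStr x]) (st [repStr (h x.1 x.2.1 x.2.2)])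
      (p.eval (size x))) (a : α) (D M : ℕ) (ha : size a ≤ M) : ∀ (l : List β) (s : σ),
    (∀ s, ∀ b ∈ l, size (h a s b) ≤ size s + D) → size l ≤ M → size s + l.length * D ≤ M →
    (foldLoop c).Runs (st [repStr l, [], [], repStr a, repStr s, []])
      (st [repStr ([] : List β), [], [], repStr a, repStr (l.foldl (h a) s), []])
      (l.length * (23 * M + p.eval (3 * M + 2) + 11) + 1) ∧
      size (l.foldl (h a) s) ≤ size s + l.length * D := by
  intro l
  induction l with
  | nil => exact fun s _ _ _ => ⟨(runs_loop_false rfl).mono (by simp), by simp⟩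
  | cons b l ih =>
    intro s hD hl hs
    have h1 := hD s b (by simp)
    simp only [size_cons, List.length_cons, Nat.add_mul, Nat.one_mul] at hl hs ⊢
    obtain ⟨h2, h3⟩ := ih (h a s b) (fun s b hb => hD s b (by simp [hb])) (by omega) (by omega)
    refine ⟨(runs_loop_true rfl (runs_foldBody hc a s b l) h2).mono ?_, ?_⟩
    · have := eval_mono p (show size a + size s + size b + 2 ≤ 3 * M + 2 by omega)
      simp only at this
      omega
    · simp only [List.foldl_cons]; omega

end Com

section

variable {α β γ σ : Type} [Rep α] [Rep β] [Rep γ] [Rep σ]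

namespace PolyTime

/-- Left folds are computable in polynomial time if the step is, and if a step increases the size
of the accumulator only by a summand that does not depend on the accumulator. -/
theorem foldl {f : α → List β} {g : α → σ} {h : α → σ → β → σ} (hf : PolyTime f)
    (hg : PolyTime g) (hh : PolyTime fun x : α × σ × β => h x.1 x.2.1 x.2.2) (r : Polynomial ℕ)
    (hr : ∀ a s b, size (h a s b) ≤ size s + r.eval (size a + size b)) :
    PolyTime (fun a => (f a).foldl (h a) (g a)) := by
  -- Only the fold of a given list from a given start needs a program; `f` and `g` are supplied by
  -- composition.
  suffices key : PolyTime fun x : α × σ × List β => x.2.2.foldl (h x.1) x.2.1 from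
    key.comp (g := fun x : α × σ × List β => x.2.2.foldl (h x.1) x.2.1)
      (PolyTime.id.pair (hg.pair hf))
  obtain ⟨c, p, hc⟩ := hh
  -- A bound for the accumulator when the input has size `N`: it starts below `N`, and in each of at
  -- most `N` rounds it grows by at most `r(2N)`, parameter and entry together having size at most
  -- `2N`.
  let Q : Polynomial ℕ := .X + .X * r.comp (2 * .X)
  refine ⟨.pop 0 ;; .split ;; .rev 1 3 ;; .pop 0 ;; .split ;; .rev 1 4 ;; .foldLoop c ;;
    .clear 0 ;; .clear 3 ;; .rev 4 1 ;; .rev 1 0,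
    30 * .X + 30 + .X * (23 * Q + p.comp (3 * Q + 2) + 11) + 6 * Q, fun x => .unpad 5 ?_⟩
  obtain ⟨a, s, l⟩ := x
  have h1 := (Com.runs_pop (l := [repStr (a, s, l), [], [], [], [], []]) 0).seq
    (Com.runs_split (rep a) (repStr (s, l)) [] [[], [], []])
  have h2 := Com.runs_rev (l := [repStr (s, l), (repStr a).reverse, [], [], [], []]) 1 3
  have h3 := Com.runs_pop (l := [repStr (s, l), [], [], repStr a, [], []]) 0
  have h4 := Com.runs_split (rep s) (repStr l) [] [repStr a, [], []]
  have h5 := Com.runs_rev (l := [repStr l, (repStr s).reverse, [], repStr a, [], []]) 1 4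
  simp only [List.append_nil] at h1 h4
  simp only [List.getD_cons_succ, List.getD_cons_zero, List.reverse_reverse, List.set_cons_succ,
    List.set_cons_zero, List.append_nil, List.length_reverse] at h2 h5
  have hx : size (a, s, l) = size a + size s + size l + 2 := by simp [size_pair]; omega
  have hx1 : size (a, s, l) * r.eval (2 * size (a, s, l)) ≥
      l.length * r.eval (2 * size (a, s, l)) := by
    have := length_le_size l
    gcongr
    omega
  have hQ : Q.eval (size (a, s, l)) =
      size (a, s, l) + size (a, s, l) * r.eval (2 * size (a, s, l)) := by simp [Q]
  obtain ⟨h6, h7⟩ := Com.runs_foldLoop hc a (r.eval (2 * size (a, s, l)))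
    (Q.eval (size (a, s, l))) (by omega) l s (fun s' b hb => (hr a s' b).trans (by
      have := eval_mono r (show size a + size b ≤ 2 * size (a, s, l) by
        have := size_le_of_mem hb; omega)
      simp only at this
      omega)) (by omega) (by omega)
  have h8 := Com.runs_clear
    (l := [repStr ([] : List β), [], [], repStr a, repStr (l.foldl (h a) s), []]) 0
  have h9 := (Com.runs_clear
    (l := [[], [], [], repStr a, repStr (l.foldl (h a) s), []]) 3).seq
    ((Com.runs_rev 4 1).seq (Com.runs_rev 1 0))
  simp at h9
  obtain ⟨t1, ht1, h1⟩ := h1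
  cases h1 with | seq e1 e2 =>
  obtain ⟨t2, ht2, h2⟩ := h2
  obtain ⟨t3, ht3, h3⟩ := h3
  obtain ⟨t4, ht4, h4⟩ := h4
  obtain ⟨t5, ht5, h5⟩ := h5
  obtain ⟨t6, ht6, h6⟩ := h6
  obtain ⟨t8, ht8, h8⟩ := h8
  obtain ⟨t9, ht9, h9⟩ := h9
  refine ⟨_, ?_, e1.seq (e2.seq (h2.seq (h3.seq (h4.seq (h5.seq (h6.seq (h8.seq h9)))))))⟩
  have hb : (rep s).str.length = size s := rfl
  have hb' : (rep a).str.length = size a := rfl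
  have hl : l.length * (23 * Q.eval (size (a, s, l)) + p.eval (3 * Q.eval (size (a, s, l)) + 2)
      + 11) ≤ size (a, s, l) * (23 * Q.eval (size (a, s, l)) +
        p.eval (3 * Q.eval (size (a, s, l)) + 2) + 11) := by
    have := length_le_size l
    gcongr
    omega
  simp only [Polynomial.eval_add, Polynomial.eval_mul, Polynomial.eval_X, Polynomial.eval_comp,
    Polynomial.eval_ofNat]
  simp only [List.getD_cons_zero, repStr_nil, List.length_cons, List.length_nil] at ht8
  simp only [size] at *
  omega

/-- A nonempty list has the same representation as the pair of its head and its tail, so the program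
only looks at the first symbol. -/
theorem listCasesOn (b : γ) {g : α × List α → γ} (hg : PolyTime g) :
    PolyTime (fun l : List α => match l with | [] => b | a :: t => g (a, t)) := by
  obtain ⟨c, p, hc⟩ := hg
  obtain ⟨d, q, hd⟩ := const (α := List α) b
  refine ⟨.ite 0 0 (fun o _ => o == some .item) c d, p + q + 1, fun l => ?_⟩
  cases l with
  | nil =>
    refine (Com.runs_ite_false rfl (hd [])).mono ?_
    simp; omega
  | cons a t =>
    refine (Com.runs_ite_true rfl (hc (a, t))).mono ?_
    have : size (a :: t) = size (a, t) := rfl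
    simp [this]; omega

end PolyTime

end

/-! ### Passing between strings and their representations -/

namespace Com

/-- Pass from a string to its representation. -/
def readLoop : Com := loop 1 Option.isSome (dup 1 0 ;; pop 1 ;; push 0 .endList ;; push 0 .item)

theorem runs_readLoop : ∀ w u : List Sym, readLoop.Runs (st [repStr u, w])
    (st [repStr (w.reverse ++ u), []]) (5 * w.length + 1) := by
  intro w
  induction w with
  | nil => exact fun u => runs_loop_false rfl
  | cons s w ih =>
    intro u
    have h := ih (s :: u)
    rw [List.reverse_cons, List.append_assoc]
    refine (runs_loop_true (l := [repStr u, s :: w]) rfl ((runs_dup 1 0).seq ((runs_pop 1).seq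
      ((runs_push 0 .endList).seq (runs_push 0 .item)))) h).mono ?_
    simp; omega

/-- Pass from the representation of a string to the string. -/
def writeLoop : Com := loop 0 (· == some .item) (pop 0 ;; pop 0 ;; dup 0 1 ;; pop 0)

theorem runs_writeLoop : ∀ w u : List Sym, writeLoop.Runs (st [repStr w, u])
    (st [repStr ([] : List Sym), w.reverse ++ u]) (5 * w.length + 1) := by
  intro w
  induction w with
  | nil => exact fun u => runs_loop_false rfl
  | cons s w ih =>
    intro u
    have h := ih (s :: u)
    rw [List.reverse_cons, List.append_assoc]
    refine (runs_loop_true (l := [repStr (s :: w), u]) rfl ((runs_pop 0).seq ((runs_pop 0).seq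
      ((runs_dup 0 1).seq (runs_pop 0)))) h).mono ?_
    simp; omega

end Com

theorem repStr_string_length (w : List Sym) : (repStr w).length = 3 * w.length + 2 := by
  induction w with
  | nil => rfl
  | cons s w ih =>
    rw [repStr_cons, List.length_cons, List.length_append, ih]
    simp [repStr, rep, Sexp.str]; omega

/-- If objects are represented by the representations of their encodings as strings, then
computability in polynomial time is computability by machines in polynomial time. -/
theorem PolyTime.computableInPolyTime {α β : Type} [Rep α] [Rep β] {ea : α → List Sym}
    {eb : β → List Sym} (hα : ∀ a : α, rep a = rep (ea a)) (hβ : ∀ b : β, rep b = rep (eb b))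
    {f : α → β} (hf : PolyTime f) : Nonempty (TM2ComputableInPolyTime ea eb f) := by
  obtain ⟨q, hq⟩ := hf.size_le
  obtain ⟨c, p, hc⟩ := hf
  -- The two symbols `.endList` represent the empty list, to which the reading loop adds the input
  -- from its end. The writing loop leaves them behind, whence the two pops, and its output is
  -- reversed.
  refine Com.computableInPolyTime (.rev 0 1 ;; .push 0 .endList ;; .push 0 .endList ;; .readLoop ;;
    c ;; .writeLoop ;; .pop 0 ;; .pop 0 ;; .rev 1 0)
    (8 * .X + 8 + p.comp (3 * .X + 2) + 8 * q.comp (3 * .X + 2)) fun a => Com.Runs.unpad 1 ?_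
  have h1 := Com.runs_rev (l := [ea a, []]) 0 1
  have h2 := (Com.runs_push (l := [[], (ea a).reverse]) 0 .endList).seq
    (Com.runs_push 0 .endList)
  have h3 := Com.runs_readLoop (ea a).reverse []
  have h4 := (hc a).pad 1
  have h5 := Com.runs_writeLoop (eb (f a)) []
  have h6 := (Com.runs_pop (l := [repStr ([] : List Sym), (eb (f a)).reverse]) 0).seq
    ((Com.runs_pop 0).seq (Com.runs_rev 1 0))
  have e1 : repStr a = repStr (ea a) := congrArg Sexp.str (hα a)
  have e2 : repStr (f a) = repStr (eb (f a)) := congrArg Sexp.str (hβ (f a))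
  rw [e1, e2] at h4
  simp only [List.reverse_reverse, List.append_nil] at h1 h3 h5
  simp [repStr_nil] at h6
  simp at h1
  obtain ⟨t2, ht2, h2⟩ := h2
  obtain ⟨t6, ht6, h6⟩ := h6
  cases h2 with | seq d1 d2 =>
  obtain ⟨t1, ht1, h1⟩ := h1
  obtain ⟨t3, ht3, h3⟩ := h3
  obtain ⟨t4, ht4, h4⟩ := h4
  obtain ⟨t5, ht5, h5⟩ := h5
  refine ⟨_, ?_, h1.seq (d1.seq (d2.seq (h3.seq (h4.seq (h5.seq h6)))))⟩
  have hs : size a = 3 * (ea a).length + 2 := by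
    rw [size, e1, repStr_string_length]
  have hs' : size (f a) = 3 * (eb (f a)).length + 2 := by
    rw [size, e2, repStr_string_length]
  have := hq a
  rw [hs] at ht4 this
  simp at ht3 ht5
  simp
  omega

/-! ### List operations in polynomial time -/

section

variable {α β γ δ σ : Type} [Rep α] [Rep β] [Rep γ] [Rep δ] [Rep σ]

namespace PolyTime

/-- Only representations count: encoding an object as a string, and constructors that do not change
the string, cost nothing. -/
theorem congr_rep {f : α → β} {g : α → γ} (hf : PolyTime f) (h : ∀ a, rep (f a) = rep (g a)) :
    PolyTime g := by
  obtain ⟨c, p, hc⟩ := hf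
  refine ⟨c, p, fun a => ?_⟩
  have := hc a
  unfold repStr at *
  rwa [h] at this

@[fun_prop]
theorem fst_comp {f : α → β × γ} (hf : PolyTime f) : PolyTime fun a => (f a).1 := fst.comp hf

@[fun_prop]
theorem snd_comp {f : α → β × γ} (hf : PolyTime f) : PolyTime fun a => (f a).2 := snd.comp hf

@[fun_prop]
theorem cons {f : α → β} {g : α → List β} (hf : PolyTime f) (hg : PolyTime g) :
    PolyTime fun a => f a :: g a :=
  (hf.pair hg).congr_rep fun _ => rfl

@[fun_prop]
theorem tail {f : α → List β} (hf : PolyTime f) : PolyTime fun a => (f a).tail := by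
  have h := (listCasesOn (α := β) [] (g := fun x => x.2) (by fun_prop)).comp hf
  exact h.congr_rep fun a => by cases f a <;> rfl

@[fun_prop]
theorem headD {f : α → List β} (hf : PolyTime f) (b : β) : PolyTime fun a => (f a).headD b := by
  have h := (listCasesOn (α := β) b (g := fun x => x.1) (by fun_prop)).comp hf
  exact h.congr_rep fun a => by cases f a <;> rfl

@[fun_prop]
theorem isEmpty {f : α → List β} (hf : PolyTime f) : PolyTime fun a => (f a).isEmpty := by
  have h := (listCasesOn (α := β) true (g := fun x => false) (by fun_prop)).comp hf
  exact h.congr_rep fun a => by cases f a <;> rfl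

@[fun_prop]
theorem decide_eq_true {f : α → Bool} (hf : PolyTime f) :
    PolyTime fun a => decide (f a = true) := by
  simpa using hf

@[fun_prop]
theorem decide_and {p q : α → Prop} [∀ a, Decidable (p a)] [∀ a, Decidable (q a)]
    (hp : PolyTime fun a => decide (p a)) (hq : PolyTime fun a => decide (q a)) :
    PolyTime fun a => decide (p a ∧ q a) := by
  have h : PolyTime fun a => if p a then decide (q a) else false := by fun_prop
  convert h using 2 with a
  by_cases h : p a <;> simp [h]

@[fun_prop]
theorem decide_or {p q : α → Prop} [∀ a, Decidable (p a)] [∀ a, Decidable (q a)]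
    (hp : PolyTime fun a => decide (p a)) (hq : PolyTime fun a => decide (q a)) :
    PolyTime fun a => decide (p a ∨ q a) := by
  have h : PolyTime fun a => if p a then true else decide (q a) := by fun_prop
  convert h using 2 with a
  by_cases h : p a <;> simp [h]

@[fun_prop]
theorem not {f : α → Bool} (hf : PolyTime f) : PolyTime fun a => !f a := by
  have h : PolyTime fun a => if f a = true then false else true := by fun_prop
  convert h using 2 with a
  cases f a <;> rfl

theorem eq [DecidableEq β] (hβ : Injective (rep : β → Sexp)) {f g : α → β} (hf : PolyTime f)
    (hg : PolyTime g) : PolyTime fun a => decide (f a = g a) :=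
  (decide_eq hβ).comp (hf.pair hg)

/-- A right fold is the left fold of the reversed list, and reversing is itself a left fold. -/
theorem foldr {f : α → List β} {g : α → σ} {h : α → β → σ → σ} (hf : PolyTime f)
    (hg : PolyTime g) (hh : PolyTime fun x : α × β × σ => h x.1 x.2.1 x.2.2) (r : Polynomial ℕ)
    (hr : ∀ a b s, size (h a b s) ≤ size s + r.eval (size a + size b)) :
    PolyTime (fun a => (f a).foldr (h a) (g a)) := by
  have h1 : PolyTime fun a => (f a).foldl (fun l b => b :: l) [] :=
    foldl hf (const []) (by fun_prop) (.X + 1) fun a s b => by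
      simp only [size_cons, Polynomial.eval_add, Polynomial.eval_X, Polynomial.eval_one]
      omega
  have h2 : PolyTime fun x : α × σ × β => h x.1 x.2.2 x.2.1 :=
    hh.comp (f := fun x : α × σ × β => (x.1, x.2.2, x.2.1)) (by fun_prop)
  have h3 := foldl h1 hg (h := fun a s b => h a b s) h2 r fun a s b => hr a b s
  convert h3 using 2 with a
  rw [List.foldl_flip_cons_eq_append' , List.append_nil, List.foldl_reverse]

@[fun_prop]
theorem append {f g : α → List β} (hf : PolyTime f) (hg : PolyTime g) :
    PolyTime fun a => f a ++ g a := by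
  have h := foldr hf hg (h := fun _ b l => b :: l) (by fun_prop) (.X + 1) fun a b s => by
    simp only [size_cons, Polynomial.eval_add, Polynomial.eval_X, Polynomial.eval_one]
    omega
  simpa using h

@[fun_prop]
theorem flatMap {f : α → List β} {g : α → β → List γ} (hf : PolyTime f)
    (hg : PolyTime fun x : α × β => g x.1 x.2) : PolyTime fun a => (f a).flatMap (g a) := by
  obtain ⟨p, hp⟩ := hg.size_le
  have h1 : PolyTime fun x : α × β × List γ => g x.1 x.2.1 :=
    hg.comp (f := fun x : α × β × List γ => (x.1, x.2.1)) (by fun_prop)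
  -- The accumulator grows by at most the size of the list `g a b`, which is polynomial in the size
  -- of the pair `(a, b)`, one more than the sum of the sizes.
  have h := foldr hf (const []) (h := fun a b l => g a b ++ l) (by fun_prop) (p.comp (.X + 1))
    fun a b s => by
      have h2 := size_append (g a b) s
      have h3 := hp (a, b)
      rw [size_pair] at h3
      simp only [Polynomial.eval_comp, Polynomial.eval_add, Polynomial.eval_X,
        Polynomial.eval_one] at h3 ⊢
      omega
  convert h using 2 with a
  induction f a with
  | nil => rfl
  | cons b l ih => rw [List.flatMap_cons, List.foldr_cons, ih]

@[fun_prop]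
theorem map {f : α → List β} {g : α → β → γ} (hf : PolyTime f)
    (hg : PolyTime fun x : α × β => g x.1 x.2) : PolyTime fun a => (f a).map (g a) := by
  have h : PolyTime fun a => (f a).flatMap fun b => [g a b] := by fun_prop
  simpa only [List.map_eq_flatMap] using h

@[fun_prop]
theorem filter {f : α → List β} {g : α → β → Bool} (hf : PolyTime f)
    (hg : PolyTime fun x : α × β => g x.1 x.2) : PolyTime fun a => (f a).filter (g a) := by
  have h : PolyTime fun a => (f a).flatMap fun b => if g a b then [b] else [] := by fun_prop
  convert h using 2 with a
  induction f a with
  | nil => rfl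
  | cons b l ih => by_cases hb : g a b <;> simp [hb, ih]

@[fun_prop]
theorem any {f : α → List β} {g : α → β → Bool} (hf : PolyTime f)
    (hg : PolyTime fun x : α × β => g x.1 x.2) : PolyTime fun a => (f a).any (g a) := by
  have h : PolyTime fun a => !((f a).filter (g a)).isEmpty := by fun_prop
  convert h using 2 with a
  induction f a with
  | nil => rfl
  | cons b l ih => by_cases hb : g a b <;> simp [hb, ih]

theorem mem [DecidableEq β] (hβ : Injective (rep : β → Sexp)) {f : α → β} {g : α → List β}
    (hf : PolyTime f) (hg : PolyTime g) : PolyTime fun a => decide (f a ∈ g a) := by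
  have h1 : PolyTime fun x : α × β => decide (f x.1 = x.2) := eq hβ (by fun_prop) (by fun_prop)
  have h : PolyTime fun a => (g a).any fun b => decide (f a = b) := by fun_prop
  have e : (fun a => decide (f a ∈ g a)) = fun a => (g a).any fun b => decide (f a = b) :=
    funext fun a => by rw [Bool.eq_iff_iff]; simp
  rwa [e]

/-- Membership may be tested in the deduplicated tail, which has the same members as the tail. -/
theorem dedup [DecidableEq β] (hβ : Injective (rep : β → Sexp)) {f : α → List β}
    (hf : PolyTime f) : PolyTime fun a => (f a).dedup := by
  have h1 : PolyTime fun x : α × β × List β => decide (x.2.1 ∈ x.2.2) :=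
    mem hβ (by fun_prop) (by fun_prop)
  have h := foldr hf (const []) (h := fun _ (b : β) (l : List β) => if b ∈ l then l else b :: l)
    (by fun_prop)
    (.X + 1) fun a b s => by
      simp only [Polynomial.eval_add, Polynomial.eval_X, Polynomial.eval_one]
      split_ifs
      · omega
      · rw [size_cons]; omega
  convert h using 2 with a
  induction f a with
  | nil => rfl
  | cons b l ih =>
    rw [List.foldr_cons, ← ih]
    by_cases hb : b ∈ l
    · rw [List.dedup_cons_of_mem hb, if_pos (List.mem_dedup.2 hb)]
    · rw [List.dedup_cons_of_notMem hb, if_neg (mt List.mem_dedup.1 hb)]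

theorem rep_sym_injective : Injective (rep : Sym → Sexp) := fun _ _ h => by
  cases h; rfl

/-- The alphabet is finite, so a predicate on symbols is membership in a constant list. -/
theorem of_sym (p : Sym → Bool) : PolyTime p := by
  have h : PolyTime fun s : Sym => decide (s ∈ (Finset.univ.filter fun s => p s = true).toList) :=
    mem rep_sym_injective (by fun_prop) (by fun_prop)
  convert h using 2 with s
  simp

@[fun_prop]
theorem sym_comp (p : Sym → Bool) {f : α → Sym} (hf : PolyTime f) : PolyTime fun a => p (f a) :=
  (of_sym p).comp hf

end PolyTime

theorem listRep_injective (hα : Injective (rep : α → Sexp)) :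
    Injective (rep : List α → Sexp) := by
  intro l
  induction l with
  | nil => intro l' h; cases l' <;> [rfl; cases h]
  | cons a l ih =>
    intro l' h
    cases l' with
    | nil => cases h
    | cons b l' =>
      injection h with h1 h2
      rw [hα h1, ih h2]

theorem pairRep_injective (hα : Injective (rep : α → Sexp)) (hβ : Injective (rep : β → Sexp)) :
    Injective (rep : α × β → Sexp) := by
  intro x y h
  injection h with h1 h2
  exact Prod.ext (hα h1) (hβ h2)

end

/-! ### Cutting strings at marked symbols -/

/-- Cut a string into pieces that start with the symbols that satisfy `p`; the first component is
the part before the first of these symbols. -/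
def cut (p : Sym → Bool) (w : List Sym) : List Sym × List (Sym × List Sym) :=
  w.foldr (fun s x => if p s then ([], (s, x.1) :: x.2) else (s :: x.1, x.2)) ([], [])

/-- The places where `p` holds determine the cuts, so a concatenation can be undone if `p` holds
exactly at the first symbols of the pieces. -/
theorem cut_append {p : Sym → Bool} {u : List Sym} (hu : ∀ s ∈ u, p s = false)
    {l : List (Sym × List Sym)} (hl : ∀ x ∈ l, p x.1 = true ∧ ∀ s ∈ x.2, p s = false) :
    cut p (u ++ l.flatMap fun x => x.1 :: x.2) = (u, l) := by
  induction l generalizing u with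
  | nil =>
    induction u with
    | nil => rfl
    | cons s u ih =>
      simp only [List.flatMap_nil, List.append_nil] at ih ⊢
      have := ih fun s hs => hu s (by simp [hs])
      unfold cut at this ⊢
      rw [List.foldr_cons, this, if_neg (by simp [hu s])]
  | cons x l ih =>
    induction u with
    | nil =>
      have := ih (u := x.2) (hl x (by simp)).2 fun y hy => hl y (by simp [hy])
      unfold cut at this ⊢
      rw [List.nil_append, List.flatMap_cons, List.cons_append, List.foldr_cons, this,
        if_pos (hl x (by simp)).1]
    | cons s u ihu =>
      have := ihu fun s hs => hu s (by simp [hs])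
      unfold cut at this ⊢
      rw [List.cons_append, List.foldr_cons, this, if_neg (by simp [hu s])]

@[fun_prop]
theorem PolyTime.cut {α : Type} [Rep α] (p : Sym → Bool) {f : α → List Sym} (hf : PolyTime f) :
    PolyTime fun a => cut p (f a) := by
  refine PolyTime.foldr hf (.const _) (h := fun _ s (x : List Sym × List (Sym × List Sym)) =>
    if p s then ([], (s, x.1) :: x.2) else (s :: x.1, x.2)) (by fun_prop) (.X + 4) fun a s x => ?_
  simp only [Polynomial.eval_add, Polynomial.eval_X, Polynomial.eval_ofNat]
  have : size x = size x.1 + size x.2 + 1 := size_pair _ _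
  split_ifs
  · simp only [size_cons, size_pair, size_nil]; omega
  · simp only [size_cons, size_pair]; omega

/-! ## The computability of the translation in polynomial time -/

/-- Numbers in unary notation. -/
instance : Rep ℕ := ⟨fun n => rep (List.replicate n Sym.next)⟩

/-- Positive numbers in binary notation. -/
instance : Rep ℕ+ := ⟨fun q => rep (encodeNumber q)⟩

/-- Names, represented by the binary notation of their codes. -/
class NameRep (α : Type) [Encodable α] extends Rep α where
  rep_eq : ∀ a : α, rep a = Rep.rep (encodeNumber (Encodable.encode a))

/-- With `congr_rep` this lets a list of strings computed from an encoding count as the list of the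
objects encoded by them. -/
theorem rep_map {α β : Type} [Rep α] [Rep β] {f : α → β} (h : ∀ a, rep (f a) = rep a)
    (l : List α) : rep (l.map f) = rep l := by
  induction l with
  | nil => rfl
  | cons a l ih => exact congrArg₂ Sexp.cons (h a) ih

theorem rep_string_injective : Injective (rep : List Sym → Sexp) :=
  listRep_injective PolyTime.rep_sym_injective

theorem rep_pnat_injective : Injective (rep : ℕ+ → Sexp) := fun p q h => by
  have h1 : encodeNumber p ++ [] = encodeNumber q ++ [] := by
    simpa using rep_string_injective h
  exact PNat.coe_inj.1 (encodeNumber_inj h1).1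

theorem rep_name_injective {α : Type} [Encodable α] [NameRep α] :
    Injective (rep : α → Sexp) := fun a b h => by
  rw [NameRep.rep_eq, NameRep.rep_eq] at h
  have h1 : encodeNumber (Encodable.encode a) ++ [] = encodeNumber (Encodable.encode b) ++ [] := by
    simpa using rep_string_injective h
  exact (encodeName_inj h1).1

/-! ### Arithmetic of unary and binary numbers -/

section Numbers

variable {α β : Type} [Rep α] [Rep β]

namespace PolyTime

@[fun_prop]
theorem replicate_next {f : α → ℕ} (hf : PolyTime f) :
    PolyTime fun a => List.replicate (f a) Sym.next :=
  hf.congr_rep fun _ => rfl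

theorem of_replicate_next {f : α → ℕ} (hf : PolyTime fun a => List.replicate (f a) Sym.next) :
    PolyTime f :=
  hf.congr_rep fun _ => rfl

@[fun_prop]
theorem encodeNumber_pnat {f : α → ℕ+} (hf : PolyTime f) :
    PolyTime fun a => encodeNumber (f a) :=
  hf.congr_rep fun _ => rfl

@[fun_prop]
theorem length {f : α → List β} (hf : PolyTime f) : PolyTime fun a => (f a).length := by
  apply of_replicate_next
  have h : PolyTime fun a => (f a).map fun _ => Sym.next := by fun_prop
  simpa using h

@[fun_prop]
theorem pred {f : α → ℕ} (hf : PolyTime f) : PolyTime fun a => f a - 1 := by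
  apply of_replicate_next
  have h : PolyTime fun a => (List.replicate (f a) Sym.next).tail := by fun_prop
  simpa using h

@[fun_prop]
theorem eq_zero {f : α → ℕ} (hf : PolyTime f) : PolyTime fun a => decide (f a = 0) := by
  have h : PolyTime fun a => (List.replicate (f a) Sym.next).isEmpty := by fun_prop
  simpa [List.isEmpty_replicate] using h

/-- The Boolean is the parity of the symbols read so far, and every second symbol produces one
symbol of output. -/
theorem foldl_halve (n m : ℕ) (b : Bool) : (List.replicate n Sym.next).foldl
    (fun (x : Bool × List Sym) _ => if x.1 then (false, .next :: x.2) else (true, x.2))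
      (b, List.replicate m .next) =
    ((n + b.toNat) % 2 == 1, List.replicate (m + (n + b.toNat) / 2) .next) := by
  induction n generalizing m b with
  | zero => cases b <;> simp
  | succ n ih =>
    rw [List.replicate_succ, List.foldl_cons]
    cases b
    · simpa using ih m true
    · have h := ih (m + 1) false
      have h1 : (n + 1 + 1) / 2 = n / 2 + 1 := by omega
      have h2 : (n + 1 + 1) % 2 = n % 2 := by omega
      simp [h1] at h ⊢
      rw [← List.replicate_succ, h, Nat.add_right_comm, Nat.add_assoc, h2]

@[fun_prop]
theorem half {f : α → ℕ} (hf : PolyTime f) : PolyTime fun a => f a / 2 := by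
  apply of_replicate_next
  have h := foldl (replicate_next hf) (const (false, ([] : List Sym)))
    (h := fun _ (x : Bool × List Sym) (_ : Sym) =>
      if x.1 then (false, .next :: x.2) else (true, x.2)) (by fun_prop) 3 fun a s b => by
        have : size s = size s.1 + size s.2 + 1 := size_pair _ _
        simp only [Polynomial.eval_ofNat]
        split_ifs <;> simp only [size_pair, size_cons, size_bool, size_sym] at * <;> omega
  have e := fun a => foldl_halve (f a) 0 false
  have h' : PolyTime fun a => (List.foldl (fun (x : Bool × List Sym) (_ : Sym) =>
      if x.1 then (false, .next :: x.2) else (true, x.2)) (false, ([] : List Sym))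
      (List.replicate (f a) Sym.next)).2 := h.snd_comp
  simp only [List.replicate_zero] at e
  simp only [e] at h'
  simpa using h'

/-- The value of a binary notation, with the least significant bit first. -/
def bitsValue (l : List Bool) : ℕ := l.foldr (fun b n => b.toNat + 2 * n) 0

theorem bitsValue_encodeNat (n : ℕ) : bitsValue (encodeNat n) = n := by
  have key : ∀ p : PosNum, bitsValue (encodePosNum p) = p := by
    intro p
    induction p with
    | one => rfl
    | bit0 p ih =>
      simp only [encodePosNum, bitsValue, List.foldr_cons] at ih ⊢
      rw [ih]; simp [PosNum.cast_bit0]; omega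
    | bit1 p ih =>
      simp only [encodePosNum, bitsValue, List.foldr_cons] at ih ⊢
      rw [ih]; simp [PosNum.cast_bit1]; omega
  conv_rhs => rw [← Num.to_of_nat n]
  unfold encodeNat
  cases (n : Num) with
  | zero => rfl
  | pos p => exact key p

@[fun_prop]
theorem encodeNat_pnat {f : α → ℕ+} (hf : PolyTime f) : PolyTime fun a => encodeNat (f a) := by
  have h : PolyTime fun a => ((encodeNumber (f a)).filter fun s => s != .endNum).map
      fun s => s == .bit true :=
    (PolyTime.filter (by fun_prop) (sym_comp (fun s => s != .endNum) (by fun_prop))).map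
      (sym_comp (fun s => s == .bit true) (by fun_prop))
  convert h using 2 with a
  have h1 : (fun b => Sym.bit b == Sym.bit true) = fun b => b := by
    funext b; cases b <;> rfl
  have h2 : (fun b => Sym.bit b != Sym.endNum) = fun _ => true := by
    funext b; cases b <;> rfl
  simp [encodeNumber, List.filter_map, comp_def, h1, h2]

/-- For a bit `b`, the inequality `b + 2q ≤ m` holds iff `b ≤ m` and `q ≤ (m - b) / 2`. The
singleton carries the current `m` while the bits are consumed, and becomes empty for good when `b ≤
m` fails. Thus a binary number is compared with a unary one without being expanded. -/
theorem foldl_le (l : List Bool) (m : ℕ) : l.foldl (fun (s : List ℕ) (b : Bool) =>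
    s.flatMap fun m => if b then (if m = 0 then [] else [(m - 1) / 2]) else [m / 2]) [m] = [] ↔
    m < bitsValue l := by
  have h0 : ∀ l : List Bool, l.foldl (fun (s : List ℕ) (b : Bool) =>
    s.flatMap fun m => if b then (if m = 0 then [] else [(m - 1) / 2]) else [m / 2]) [] = [] := by
    intro l; induction l <;> simp_all
  induction l generalizing m with
  | nil => simp [bitsValue]
  | cons b l ih =>
    have hv : bitsValue (b :: l) = b.toNat + 2 * bitsValue l := rfl
    rw [List.foldl_cons, hv]
    cases b
    · simp only [List.flatMap_singleton, Bool.false_eq_true, if_false, ih]; simp; omega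
    · by_cases hm : m = 0
      · subst hm; simp [h0]
      · simp only [List.flatMap_singleton, if_true, hm, if_false, ih]; simp; omega

theorem size_nat (n : ℕ) : size n = 3 * n + 2 := by
  have : size n = (repStr (List.replicate n Sym.next)).length := rfl
  rw [this, repStr_string_length, List.length_replicate]

@[fun_prop]
theorem pnat_le_nat {f : α → ℕ+} {g : α → ℕ} (hf : PolyTime f) (hg : PolyTime g) :
    PolyTime fun a => decide ((f a : ℕ) ≤ g a) := by
  have h1 : PolyTime fun a => [g a] := by fun_prop
  have h := foldl (encodeNat_pnat hf) h1 (h := fun _ (s : List ℕ) (b : Bool) =>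
    s.flatMap fun m => if b then (if m = 0 then [] else [(m - 1) / 2]) else [m / 2])
    -- The state does not grow: every entry is replaced by at most one entry that is not larger.
    (by fun_prop) 0 fun a s b => by
      simp only [Polynomial.eval_zero, Nat.add_zero]
      induction s with
      | nil => simp
      | cons m s ih =>
        rw [List.flatMap_cons]
        have := size_append (if b = true then (if m = 0 then [] else [(m - 1) / 2]) else [m / 2])
          (s.flatMap fun m => if b then (if m = 0 then [] else [(m - 1) / 2]) else [m / 2])
        rw [size_cons]
        split_ifs at this ih ⊢ <;> simp only [size_cons, size_nil, size_nat] at * <;> omega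
  have h' := h.isEmpty.not
  convert h' using 2 with a
  rw [Bool.eq_iff_iff, Bool.not_eq_true', ← Bool.not_eq_true, List.isEmpty_iff, foldl_le,
    bitsValue_encodeNat]
  simp

/-- A step of the comparison of two numbers in binary notation. -/
def ltStep (x : Bool × List Bool) (b : Bool) : Bool × List Bool :=
  (if b = x.2.headD false then x.1 else !b, x.2.tail)

/-- With the least significant bits first, `c` tells whether the part of `l` read so far is less
than that of `l'`. A later difference of bits overrides `c`, and missing bits of `l'` count as `0`.
If a bit `1` of `l'` is left at the end, the first number is the smaller one in any case. -/
theorem foldl_ltStep (l l' : List Bool) (c : Bool) :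
    ((l.foldl ltStep (c, l')).2.any (fun b => b) || (l.foldl ltStep (c, l')).1) =
    decide (bitsValue l < bitsValue l' ∨ bitsValue l = bitsValue l' ∧ c = true) := by
  have h0 : ∀ l : List Bool, (l.any fun b => b) = decide (0 < bitsValue l) := by
    intro l
    induction l with
    | nil => rfl
    | cons b l ih =>
      rw [List.any_cons, ih, show bitsValue (b :: l) = b.toNat + 2 * bitsValue l from rfl]
      cases b <;> simp
  induction l generalizing l' c with
  | nil =>
    simp only [List.foldl_nil, h0]
    rw [Bool.eq_iff_iff]
    simp [bitsValue]
    grind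
  | cons b l ih =>
    have hv : bitsValue (b :: l) = b.toNat + 2 * bitsValue l := rfl
    have hv' : bitsValue l' = (l'.headD false).toNat + 2 * bitsValue l'.tail := by
      cases l' <;> rfl
    have h1 := ih l'.tail (if b = l'.headD false then c else !b)
    rw [List.foldl_cons]
    refine h1.trans ?_
    rw [hv, hv', Bool.eq_iff_iff, decide_eq_true_iff, decide_eq_true_iff]
    cases b <;> cases l'.headD false <;> simp <;> grind

@[fun_prop]
theorem pnat_lt {f g : α → ℕ+} (hf : PolyTime f) (hg : PolyTime g) :
    PolyTime fun a => decide (f a < g a) := by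
  have h1 : PolyTime fun a => (false, encodeNat (g a)) := by fun_prop
  have hb : PolyTime fun x : α × (Bool × List Bool) × Bool =>
      decide (x.2.2 = x.2.1.2.headD false) :=
    eq (fun a b h => by injection h with h; injection h) (by fun_prop) (by fun_prop)
  have h := foldl (encodeNat_pnat hf) h1 (h := fun _ => ltStep) (by unfold ltStep; fun_prop) 0
    fun a s b => by
      obtain ⟨c, l⟩ := s
      unfold ltStep
      cases l <;> simp only [size_pair, size_bool, size_cons, List.tail_cons, List.tail_nil] <;>
        omega
  have h2 : PolyTime fun a =>
      if ((encodeNat (f a)).foldl ltStep (false, encodeNat (g a))).2.any fun b => b then true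
      else ((encodeNat (f a)).foldl ltStep (false, encodeNat (g a))).1 := by
    fun_prop
  convert h2 using 2 with a
  have := foldl_ltStep (encodeNat (f a)) (encodeNat (g a)) false
  simp only [bitsValue_encodeNat] at this
  have e : decide (f a < g a) = decide ((f a : ℕ) < g a ∨ (f a : ℕ) = g a ∧ false = true) := by
    simp
  rw [e, ← this]
  cases List.any _ _ <;> rfl

theorem pnat_max {f g : α → ℕ+} (hf : PolyTime f) (hg : PolyTime g) :
    PolyTime fun a => max (f a) (g a) := by
  have h : PolyTime fun a => if f a < g a then g a else f a := by fun_prop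
  convert h using 2 with a
  split_ifs with h
  · exact max_eq_right h.le
  · exact max_eq_left (not_lt.1 h)

end PolyTime

end Numbers

/-! ### Reading off syntax from strings without parsing -/

section Encodings

variable {NC NI NG NL : Type} [Encodable NC] [Encodable NI] [Encodable NG] [Encodable NL]

instance : Rep (RoleName NG NL) := ⟨fun S => rep S.encode⟩
instance : Rep (Role NG NL) := ⟨fun R => rep R.encode⟩
instance : Rep (Concept NC NG NL) := ⟨fun C => rep C.encode⟩
instance : Rep (CI NC NG NL) := ⟨fun c => rep c.encode⟩
instance : Rep (Assertion NC NI NG NL) := ⟨fun x => rep x.encode⟩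
instance : Rep (KB NC NI NG NL) := ⟨fun K => rep K.encode⟩
instance : Rep (Pred NC NG NL) := ⟨fun P => rep P.encode⟩
instance : Rep (Term NI) := ⟨fun t => rep t.encode⟩
instance : Rep (Formula (Pred NC NG NL) NI) := ⟨fun φ => rep (QTL.encode φ)⟩

theorem rep_roleName_injective : Injective (rep : RoleName NG NL → Sexp) := fun x y h =>
  (RoleName.encode_inj (u := []) (v := []) (by simpa using rep_string_injective h)).1

theorem rep_role_injective : Injective (rep : Role NG NL → Sexp) := fun x y h =>
  (Role.encode_inj (u := []) (v := []) (by simpa using rep_string_injective h)).1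

/-- The symbols other than those of numbers. -/
def Sym.isHead : Sym → Bool
  | .bit _ | .endNum => false
  | _ => true

/-- The first symbols of role names. -/
def Sym.isRoleHead (s : Sym) : Bool := s == .globalRole || s == .localRole

/-- The symbols that do not occur in concepts. -/
def Sym.isSeparator (s : Sym) : Bool := s == .subsumed || s == .item || s == .endList

theorem Sym.of_isSeparator : ∀ s : Sym, s.isSeparator = false →
    (s == .subsumed) = false ∧ (s == .item) = false ∧ (s == .endList) = false := by
  decide

/-- A string that is cut into pieces, each of which consists of a symbol and of a number. -/
abbrev Pieces := List (Sym × List Sym)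

/-- The string of which the pieces are given. -/
def Pieces.join (l : Pieces) : List Sym := l.flatMap fun x => x.1 :: x.2

theorem Pieces.join_append (l l' : Pieces) : join (l ++ l') = join l ++ join l' := by
  simp [join]

/-- Every piece begins with a symbol that does not belong to a number, and continues with symbols
that do. -/
def Pieces.Valid (l : Pieces) : Prop :=
  ∀ x ∈ l, (x.1.isHead = true ∧ x.1.isSeparator = false) ∧ ∀ s ∈ x.2, s.isHead = false

theorem Pieces.Valid.append {l l' : Pieces} (h : l.Valid) (h' : l'.Valid) :
    (l ++ l' : Pieces).Valid := by
  intro x hx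
  rcases List.mem_append.1 hx with hx | hx
  exacts [h x hx, h' x hx]

theorem Pieces.Valid.cut {l : Pieces} (h : l.Valid) : cut Sym.isHead l.join = ([], l) :=
  cut_append (u := []) (by simp) fun x hx => ⟨(h x hx).1.1, (h x hx).2⟩

theorem Pieces.Valid.isSeparator {l : Pieces} (h : l.Valid) :
    ∀ s ∈ l.join, s.isSeparator = false := by
  intro s hs
  simp only [join, List.mem_flatMap, List.mem_cons] at hs
  obtain ⟨x, hx, rfl | hs⟩ := hs
  · exact (h x hx).1.2
  · have := (h x hx).2 s hs
    cases s <;> simp_all [Sym.isHead, Sym.isSeparator]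

theorem isHead_encodeNumber {n : ℕ} : ∀ s ∈ encodeNumber n, s.isHead = false := by
  intro s hs
  simp only [encodeNumber, List.mem_append, List.mem_map, List.mem_singleton] at hs
  rcases hs with ⟨b, -, rfl⟩ | rfl <;> rfl

theorem Pieces.Valid.singleton {s : Sym} {u : List Sym} (hs : s.isHead = true)
    (hs' : s.isSeparator = false) (hu : ∀ s ∈ u, s.isHead = false) :
    Pieces.Valid [(s, u)] := by
  intro x hx
  rw [List.mem_singleton] at hx
  subst hx
  exact ⟨⟨hs, hs'⟩, hu⟩

def RoleName.pieces : RoleName NG NL → Pieces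
  | .glob G => [(.globalRole, encodeNumber (Encodable.encode G))]
  | .loc L => [(.localRole, encodeNumber (Encodable.encode L))]

def Role.pieces : Role NG NL → Pieces
  | .name S => S.pieces
  | .inv S => (.inverse, []) :: S.pieces

def Concept.pieces : Concept NC NG NL → Pieces
  | .bot => [(.bot, [])]
  | .atom A => [(.conceptName, encodeNumber (Encodable.encode A))]
  | .atLeast q R => (.atLeast, encodeNumber q) :: R.pieces
  | .neg C => (.neg, []) :: C.pieces
  | .and C₁ C₂ => (.and, []) :: (C₁.pieces ++ C₂.pieces)
  | .next C => (.next, []) :: C.pieces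
  | .dia C => (.dia, []) :: C.pieces

theorem RoleName.valid_pieces (S : RoleName NG NL) : S.pieces.Valid := by
  cases S <;> exact .singleton rfl rfl isHead_encodeNumber

theorem Role.valid_pieces (R : Role NG NL) : R.pieces.Valid := by
  cases R with
  | name S => exact S.valid_pieces
  | inv S => exact .append (l := [_]) (.singleton rfl rfl (by simp)) S.valid_pieces

theorem Concept.valid_pieces (C : Concept NC NG NL) : C.pieces.Valid := by
  induction C with
  | bot => exact .singleton rfl rfl (by simp)
  | atom A => exact .singleton rfl rfl isHead_encodeNumber
  | atLeast q R =>
    exact .append (l := [_]) (.singleton rfl rfl isHead_encodeNumber) R.valid_pieces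
  | and C D ih ih' => exact .append (l := [_]) (.singleton rfl rfl (by simp)) (ih.append ih')
  | neg C ih | next C ih | dia C ih =>
    exact .append (l := [_]) (.singleton rfl rfl (by simp)) ih

theorem RoleName.join_pieces (S : RoleName NG NL) : S.pieces.join = S.encode := by
  cases S <;> simp [pieces, encode, Pieces.join]

theorem Role.join_pieces (R : Role NG NL) : R.pieces.join = R.encode := by
  rcases R with S | S
  · exact S.join_pieces
  · exact congrArg (.inverse :: ·) S.join_pieces

theorem Concept.join_pieces (C : Concept NC NG NL) : C.pieces.join = C.encode := by
  induction C with
  | bot => rfl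
  | atom A => simp [pieces, encode, Pieces.join]
  | atLeast q R => rw [encode, ← R.join_pieces]; rfl
  | and C D ih ih' => rw [encode, ← ih, ← ih', ← Pieces.join_append]; rfl
  | neg C ih | next C ih | dia C ih => rw [encode, ← ih]; rfl

/-- In prefix notation a numerical parameter directly follows its symbol `atLeast`, so the nesting
of the concept is irrelevant. -/
theorem Concept.map_numbers (C : Concept NC NG NL) :
    (C.pieces.filter fun x => x.1 == .atLeast).map Prod.snd =
      C.numbers.map fun q : ℕ+ => encodeNumber q := by
  induction C with
  | bot => rfl
  | atom A => rfl
  | atLeast q R =>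
    rcases R with (_ | _) | (_ | _) <;> rfl
  | and C D ih ih' =>
    rw [numbers, List.map_append, ← ih, ← ih', ← List.map_append, ← List.filter_append]
    rfl
  | neg C ih | next C ih | dia C ih => exact ih

theorem Concept.map_roleNames (C : Concept NC NG NL) :
    ((C.pieces.filter fun x => x.1.isRoleHead).map fun x => x.1 :: x.2) =
      C.roleNames.map RoleName.encode := by
  induction C with
  | bot => rfl
  | atom A => rfl
  | atLeast q R =>
    rcases R with (_ | _) | (_ | _) <;> rfl
  | and C D ih ih' =>
    rw [roleNames, List.map_append, ← ih, ← ih', ← List.map_append, ← List.filter_append]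
    rfl
  | neg C ih | next C ih | dia C ih => exact ih

/-- On strings the translation only inserts the variable at the end of every atom, and an atom ends
with the piece of a concept name or of a role name. So the pieces can be treated one by one. -/
theorem Concept.encode_star_var (C : Concept NC NG NL) :
    QTL.encode (C.star (.var : Term NI)) = C.pieces.flatMap fun x => x.1 :: (x.2 ++
      if x.1 == .conceptName || x.1.isRoleHead then [Sym.variable] else []) := by
  induction C with
  | bot => rfl
  | atom A => simp [star, pieces, QTL.encode, Pred.encode, Term.encode]
  | atLeast q R =>
    rcases R with (_ | _) | (_ | _) <;>
      simp [star, pieces, QTL.encode, Pred.encode, Term.encode, Role.pieces, RoleName.pieces,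
        Role.encode, RoleName.encode, Sym.isRoleHead]
  | and C D ih ih' => simp [star, pieces, QTL.encode, ih, ih', Sym.isRoleHead]
  | neg C ih | next C ih | dia C ih => simp [star, pieces, QTL.encode, ih, Sym.isRoleHead]

theorem CI.cut_encode (c : CI NC NG NL) :
    cut (· == .subsumed) c.encode = (c.lhs.encode, [(.subsumed, c.rhs.encode)]) := by
  have h : ∀ (C : Concept NC NG NL), ∀ s ∈ C.encode, (s == .subsumed) = false := by
    intro C s hs
    rw [← C.join_pieces] at hs
    exact (Sym.of_isSeparator s (C.valid_pieces.isSeparator s hs)).1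
  have := cut_append (p := (· == .subsumed)) (h c.lhs) (l := [(.subsumed, c.rhs.encode)])
    (by simpa using h c.rhs)
  simpa [CI.encode] using this

theorem CI.encode_isSeparator (c : CI NC NG NL) :
    ∀ s ∈ c.encode, (s == .item) = false ∧ (s == .endList) = false := by
  intro s hs
  simp only [CI.encode, List.mem_append, List.mem_cons, ← Concept.join_pieces] at hs
  rcases hs with hs | rfl | hs
  · exact (Sym.of_isSeparator s (c.lhs.valid_pieces.isSeparator s hs)).2
  · decide
  · exact (Sym.of_isSeparator s (c.rhs.valid_pieces.isSeparator s hs)).2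

/-- The final piece contains several numerals in succession, the names of the assertion; `numerals`
separates them. -/
def Assertion.pieces : Assertion NC NI NG NL → Pieces
  | .concept n s A a => List.replicate n (.next, []) ++ ((encodeSign s).map fun s => (s, [])) ++
      [(.conceptName, encodeNumber (Encodable.encode A) ++ encodeNumber (Encodable.encode a))]
  | .role n s S a b => List.replicate n (.next, []) ++ ((encodeSign s).map fun s => (s, [])) ++
      S.pieces.map fun x => (x.1, x.2 ++ (encodeNumber (Encodable.encode a) ++
        encodeNumber (Encodable.encode b)))

theorem Assertion.join_pieces (x : Assertion NC NI NG NL) : x.pieces.join = x.encode := by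
  have h : ∀ n, Pieces.join (List.replicate n (.next, [])) = List.replicate n .next := by
    intro n
    induction n with
    | zero => rfl
    | succ n ih => exact congrArg (.next :: ·) ih
  rcases x with ⟨n, s, A, a⟩ | ⟨n, s, S | S, a, b⟩ <;>
    simp only [pieces, Pieces.join_append, h, encode] <;> cases s <;>
    simp [encodeSign, Pieces.join, RoleName.pieces, RoleName.encode]

theorem Assertion.valid_pieces (x : Assertion NC NI NG NL) : x.pieces.Valid := by
  have h : ∀ n, Pieces.Valid (List.replicate n (.next, [])) := by
    intro n x hx
    obtain rfl := List.eq_of_mem_replicate hx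
    exact ⟨⟨rfl, rfl⟩, by simp⟩
  have h' : ∀ s, Pieces.Valid ((encodeSign s).map fun s => (s, [])) := by
    intro s
    cases s
    · exact .singleton rfl rfl (by simp)
    · intro x hx; cases hx
  have h3 : ∀ {u v : List Sym}, (∀ s ∈ u, s.isHead = false) → (∀ s ∈ v, s.isHead = false) →
      ∀ s ∈ u ++ v, s.isHead = false := by
    intro u v hu hv s hs
    rcases List.mem_append.1 hs with hs | hs
    exacts [hu s hs, hv s hs]
  rcases x with ⟨n, s, A, a⟩ | ⟨n, s, S | S, a, b⟩ <;>
    refine ((h n).append (h' s)).append (.singleton rfl rfl ?_)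
  · exact h3 isHead_encodeNumber isHead_encodeNumber
  all_goals exact h3 isHead_encodeNumber (h3 isHead_encodeNumber isHead_encodeNumber)

theorem encodeItems_eq {α : Type} (f : α → List Sym) (l : List α) :
    encodeItems f l = ((l.map fun x => (Sym.item, f x)).flatMap fun x => x.1 :: x.2) ++
      [.endList] := by
  induction l with
  | nil => rfl
  | cons a l ih => simp [encodeItems, ih]

theorem cut_items {α : Type} {f : α → List Sym}
    (hf : ∀ x, ∀ s ∈ f x, (s == Sym.item) = false ∧ (s == .endList) = false) (l : List α) :
    cut (· == .item) ((l.map fun x => (Sym.item, f x)).flatMap fun x => x.1 :: x.2) =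
      ([], l.map fun x => (Sym.item, f x)) :=
  cut_append (u := []) (by simp) fun x hx => by
    obtain ⟨y, -, rfl⟩ := List.mem_map.1 hx
    exact ⟨rfl, fun s hs => (hf y s hs).1⟩

theorem Assertion.encode_isSeparator (x : Assertion NC NI NG NL) :
    ∀ s ∈ x.encode, (s == .item) = false ∧ (s == .endList) = false := by
  intro s hs
  rw [← x.join_pieces] at hs
  exact (Sym.of_isSeparator s (x.valid_pieces.isSeparator s hs)).2

/-- The end marker occurs once after the TBox and once after the ABox, which is why there is an
empty last piece. -/
theorem KB.cut_encode (K : KB NC NI NG NL) : cut (· == .endList) K.encode =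
    ((K.tbox.map fun x => (Sym.item, x.encode)).flatMap fun x => x.1 :: x.2,
      [(.endList, (K.abox.map fun x => (Sym.item, x.encode)).flatMap fun x => x.1 :: x.2),
        (.endList, [])]) := by
  have h : ∀ {α : Type} {f : α → List Sym}
      (hf : ∀ x, ∀ s ∈ f x, (s == Sym.item) = false ∧ (s == .endList) = false) (l : List α),
      ∀ s ∈ (l.map fun x => (Sym.item, f x)).flatMap fun x => x.1 :: x.2,
        (s == Sym.endList) = false := by
    intro α f hf l s hs
    simp only [List.mem_flatMap, List.mem_map, List.mem_cons] at hs
    obtain ⟨_, ⟨y, -, rfl⟩, rfl | hs⟩ := hs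
    · rfl
    · exact (hf y s hs).2
  have := cut_append (p := (· == .endList)) (h CI.encode_isSeparator K.tbox)
    (l := [(.endList, (K.abox.map fun x => (Sym.item, x.encode)).flatMap fun x => x.1 :: x.2),
        (.endList, [])]) (by
      intro x hx
      simp only [List.mem_cons, List.not_mem_nil, or_false] at hx
      rcases hx with rfl | rfl
      · exact ⟨rfl, h Assertion.encode_isSeparator K.abox⟩
      · simp)
  rw [← this]
  simp [KB.encode, encodeItems_eq]

/-- The parts of a concept assertion. -/
def Assertion.conceptParts : Assertion NC NI NG NL → List (ℕ × Bool × NC × NI)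
  | .concept n s A a => [(n, s, A, a)]
  | .role _ _ _ _ _ => []

/-- The parts of a role assertion. -/
def Assertion.roleParts : Assertion NC NI NG NL → List (ℕ × Bool × RoleName NG NL × NI × NI)
  | .concept _ _ _ _ => []
  | .role n s S a b => [(n, s, S, a, b)]

end Encodings

/-! ### Syntactic operations in polynomial time -/

section Encodings

variable {NC NI NG NL : Type} [Encodable NC] [Encodable NI] [Encodable NG] [Encodable NL]
variable {α : Type} [Rep α]

namespace PolyTime

@[fun_prop]
theorem encode_role {f : α → Role NG NL} (hf : PolyTime f) : PolyTime fun a => (f a).encode :=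
  hf.congr_rep fun _ => rfl

@[fun_prop]
theorem encode_pred {f : α → Pred NC NG NL} (hf : PolyTime f) :
    PolyTime fun a => (f a).encode :=
  hf.congr_rep fun _ => rfl

@[fun_prop]
theorem encode_term {f : α → Term NI} (hf : PolyTime f) : PolyTime fun a => (f a).encode :=
  hf.congr_rep fun _ => rfl

@[fun_prop]
theorem encode_formula {f : α → QTL NC NI NG NL} (hf : PolyTime f) :
    PolyTime fun a => QTL.encode (f a) :=
  hf.congr_rep fun _ => rfl

theorem of_encode_formula {f : α → QTL NC NI NG NL} (hf : PolyTime fun a => QTL.encode (f a)) :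
    PolyTime f :=
  hf.congr_rep fun _ => rfl

theorem encodeName {β : Type} [Encodable β] [NameRep β] {f : α → β} (hf : PolyTime f) :
    PolyTime fun a => encodeNumber (Encodable.encode (f a)) :=
  hf.congr_rep fun _ => NameRep.rep_eq _

@[fun_prop]
theorem formula_neg {f : α → QTL NC NI NG NL} (hf : PolyTime f) :
    PolyTime fun a => Formula.neg (f a) := by
  apply of_encode_formula
  simp only [QTL.encode]
  fun_prop

@[fun_prop]
theorem formula_dia {f : α → QTL NC NI NG NL} (hf : PolyTime f) :
    PolyTime fun a => Formula.dia (f a) := by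
  apply of_encode_formula
  simp only [QTL.encode]
  fun_prop

@[fun_prop]
theorem formula_all {f : α → QTL NC NI NG NL} (hf : PolyTime f) :
    PolyTime fun a => Formula.all (f a) := by
  apply of_encode_formula
  simp only [QTL.encode]
  fun_prop

@[fun_prop]
theorem formula_and {f g : α → QTL NC NI NG NL} (hf : PolyTime f) (hg : PolyTime g) :
    PolyTime fun a => Formula.and (f a) (g a) := by
  apply of_encode_formula
  simp only [QTL.encode]
  fun_prop

@[fun_prop]
theorem formula_atom {f : α → Pred NC NG NL} {g : α → Term NI} (hf : PolyTime f)
    (hg : PolyTime g) : PolyTime fun a => (Formula.atom (f a) (g a) : QTL NC NI NG NL) := by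
  apply of_encode_formula
  simp only [QTL.encode]
  fun_prop

@[fun_prop]
theorem formula_box {f : α → QTL NC NI NG NL} (hf : PolyTime f) :
    PolyTime fun a => Formula.box (f a) := by
  unfold Formula.box; fun_prop

@[fun_prop]
theorem formula_ex {f : α → QTL NC NI NG NL} (hf : PolyTime f) :
    PolyTime fun a => Formula.ex (f a) := by
  unfold Formula.ex; fun_prop

@[fun_prop]
theorem formula_imp {f g : α → QTL NC NI NG NL} (hf : PolyTime f) (hg : PolyTime g) :
    PolyTime fun a => Formula.imp (f a) (g a) := by
  unfold Formula.imp; fun_prop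

@[fun_prop]
theorem formula_conj {f : α → List (QTL NC NI NG NL)} (hf : PolyTime f) :
    PolyTime fun a => Formula.conj (f a) := by
  apply of_encode_formula
  have h : PolyTime fun a => ((f a).flatMap fun φ => .and :: QTL.encode φ) ++
    QTL.encode (Formula.top : QTL NC NI NG NL) := by fun_prop
  convert h using 2 with a
  induction f a with
  | nil => rfl
  | cons φ l ih => simp [Formula.conj, QTL.encode, ih]

@[fun_prop]
theorem formula_nexts {n : α → ℕ} {f : α → QTL NC NI NG NL} (hn : PolyTime n) (hf : PolyTime f) :
    PolyTime fun a => Formula.nexts (n a) (f a) := by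
  apply of_encode_formula
  have h : PolyTime fun a => List.replicate (n a) Sym.next ++ QTL.encode (f a) := by fun_prop
  convert h using 2 with a
  induction n a with
  | zero => rfl
  | succ n ih => simp [Formula.nexts, QTL.encode, ih, List.replicate_succ]

@[fun_prop]
theorem pred_atLeast {f : α → ℕ+} {g : α → Role NG NL} (hf : PolyTime f) (hg : PolyTime g) :
    PolyTime fun a => (Pred.atLeast (f a) (g a) : Pred NC NG NL) := by
  have h : PolyTime fun a => Sym.atLeast :: (encodeNumber (f a) ++ (g a).encode) := by fun_prop
  exact h.congr_rep fun _ => rfl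

@[fun_prop]
theorem pred_concept [NameRep NC] {f : α → NC} (hf : PolyTime f) :
    PolyTime fun a => (Pred.concept (f a) : Pred NC NG NL) := by
  have h : PolyTime fun a => Sym.conceptName :: encodeNumber (Encodable.encode (f a)) :=
    (const _).cons (encodeName hf)
  exact h.congr_rep fun _ => rfl

@[fun_prop]
theorem term_const [NameRep NI] {f : α → NI} (hf : PolyTime f) :
    PolyTime fun a => Term.const (f a) := by
  have h : PolyTime fun a => Sym.constant :: encodeNumber (Encodable.encode (f a)) :=
    (const _).cons (encodeName hf)
  exact h.congr_rep fun _ => rfl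

@[fun_prop]
theorem role_name {f : α → RoleName NG NL} (hf : PolyTime f) :
    PolyTime fun a => Role.name (f a) :=
  hf.congr_rep fun _ => rfl

@[fun_prop]
theorem role_inv {f : α → RoleName NG NL} (hf : PolyTime f) :
    PolyTime fun a => Role.inv (f a) := by
  have h1 : PolyTime fun a => (f a).encode := hf.congr_rep fun _ => rfl
  have h : PolyTime fun a => Sym.inverse :: (f a).encode := by fun_prop
  exact h.congr_rep fun _ => rfl

@[fun_prop]
theorem role_inverse {f : α → Role NG NL} (hf : PolyTime f) :
    PolyTime fun a => (f a).inverse := by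
  have h1 : PolyTime fun a => (f a).encode.headD .item == .inverse :=
    sym_comp (fun s => s == .inverse) (by fun_prop)
  have h : PolyTime fun a => if (f a).encode.headD .item == .inverse then (f a).encode.tail
      else Sym.inverse :: (f a).encode := by fun_prop
  refine h.congr_rep fun a => ?_
  rcases f a with (_ | _) | (_ | _) <;> rfl

@[fun_prop]
theorem role_isGlobal {f : α → Role NG NL} (hf : PolyTime f) :
    PolyTime fun a => (f a).isGlobal := by
  have h : PolyTime fun a => (f a).encode.any fun s => s == .globalRole :=
    any (by fun_prop) (sym_comp (fun s => s == .globalRole) (by fun_prop))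
  convert h using 2 with a
  rcases f a with (_ | _) | (_ | _) <;>
    simp [Role.encode, RoleName.encode, Role.isGlobal, RoleName.isGlobal, Role.roleName,
      encodeNumber]

@[fun_prop]
theorem concept_pieces {f : α → Concept NC NG NL} (hf : PolyTime f) :
    PolyTime fun a => (f a).pieces := by
  have h1 : PolyTime fun a => (f a).encode := hf.congr_rep fun _ => rfl
  have h : PolyTime fun a => (TDLLite.cut Sym.isHead (f a).encode).2 := by fun_prop
  convert h using 2 with a
  rw [← Concept.join_pieces, (Concept.valid_pieces _).cut]

@[fun_prop]
theorem concept_numbers {f : α → Concept NC NG NL} (hf : PolyTime f) :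
    PolyTime fun a => (f a).numbers := by
  have h1 : PolyTime fun x : α × (Sym × List Sym) => x.2.1 == Sym.atLeast :=
    sym_comp (fun s => s == .atLeast) (by fun_prop)
  have h : PolyTime fun a => ((f a).pieces.filter fun x => x.1 == .atLeast).map Prod.snd := by
    fun_prop
  refine h.congr_rep fun a => ?_
  rw [Concept.map_numbers]
  exact rep_map (f := fun q : ℕ+ => encodeNumber q) (fun _ => rfl) _

@[fun_prop]
theorem concept_roleNames {f : α → Concept NC NG NL} (hf : PolyTime f) :
    PolyTime fun a => (f a).roleNames := by
  have h1 : PolyTime fun x : α × (Sym × List Sym) => x.2.1.isRoleHead :=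
    sym_comp Sym.isRoleHead (by fun_prop)
  have h : PolyTime fun a => ((f a).pieces.filter fun x => x.1.isRoleHead).map
      fun x => x.1 :: x.2 := by
    fun_prop
  refine h.congr_rep fun a => ?_
  rw [Concept.map_roleNames]
  exact rep_map (f := RoleName.encode) (fun _ => rfl) _

@[fun_prop]
theorem concept_star_var {f : α → Concept NC NG NL} (hf : PolyTime f) :
    PolyTime fun a => ((f a).star .var : QTL NC NI NG NL) := by
  apply of_encode_formula
  have h1 : PolyTime fun x : α × (Sym × List Sym) =>
      (x.2.1 == .conceptName || x.2.1.isRoleHead) :=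
    sym_comp (fun s => s == .conceptName || s.isRoleHead) (by fun_prop)
  have h : PolyTime fun a => (f a).pieces.flatMap fun x => x.1 :: (x.2 ++
      if x.1 == .conceptName || x.1.isRoleHead then [Sym.variable] else []) := by
    fun_prop
  convert h using 2 with a
  exact Concept.encode_star_var _

@[fun_prop]
theorem ci_lhs {f : α → CI NC NG NL} (hf : PolyTime f) : PolyTime fun a => (f a).lhs := by
  have h1 : PolyTime fun a => (f a).encode := hf.congr_rep fun _ => rfl
  have h : PolyTime fun a => (TDLLite.cut (fun s => s == .subsumed) (f a).encode).1 := by fun_prop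
  refine h.congr_rep fun a => ?_
  rw [CI.cut_encode]
  rfl

@[fun_prop]
theorem ci_rhs {f : α → CI NC NG NL} (hf : PolyTime f) : PolyTime fun a => (f a).rhs := by
  have h1 : PolyTime fun a => (f a).encode := hf.congr_rep fun _ => rfl
  have h : PolyTime fun a =>
      ((TDLLite.cut (fun s => s == .subsumed) (f a).encode).2.headD (.item, [])).2 := by fun_prop
  refine h.congr_rep fun a => ?_
  rw [CI.cut_encode]
  rfl

@[fun_prop]
theorem kb_tbox {f : α → KB NC NI NG NL} (hf : PolyTime f) : PolyTime fun a => (f a).tbox := by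
  have h1 : PolyTime fun a => (f a).encode := hf.congr_rep fun _ => rfl
  have h : PolyTime fun a => (TDLLite.cut (fun s => s == .item)
      (TDLLite.cut (fun s => s == .endList) (f a).encode).1).2.map Prod.snd := by fun_prop
  refine h.congr_rep fun a => ?_
  rw [KB.cut_encode]
  simp only [cut_items CI.encode_isSeparator, List.map_map]
  exact rep_map (f := CI.encode) (fun _ => rfl) _

@[fun_prop]
theorem kb_abox {f : α → KB NC NI NG NL} (hf : PolyTime f) : PolyTime fun a => (f a).abox := by
  have h1 : PolyTime fun a => (f a).encode := hf.congr_rep fun _ => rfl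
  have h : PolyTime fun a => (TDLLite.cut (fun s => s == .item)
      ((TDLLite.cut (fun s => s == .endList) (f a).encode).2.headD (.item, [])).2).2.map
        Prod.snd := by fun_prop
  refine h.congr_rep fun a => ?_
  rw [KB.cut_encode]
  simp only [List.headD_cons, cut_items Assertion.encode_isSeparator, List.map_map]
  exact rep_map (f := Assertion.encode) (fun _ => rfl) _

@[fun_prop]
theorem assertion_pieces {f : α → Assertion NC NI NG NL} (hf : PolyTime f) :
    PolyTime fun a => (f a).pieces := by
  have h1 : PolyTime fun a => (f a).encode := hf.congr_rep fun _ => rfl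
  have h : PolyTime fun a => (TDLLite.cut Sym.isHead (f a).encode).2 := by fun_prop
  convert h using 2 with a
  rw [← Assertion.join_pieces, (Assertion.valid_pieces _).cut]

end PolyTime

theorem cut_encodeNumber (n : ℕ) (w : List Sym) :
    cut (· == .endNum) (encodeNumber n ++ w) =
      ((encodeNat n).map .bit,
        (.endNum, (cut (· == .endNum) w).1) :: (cut (· == .endNum) w).2) := by
  unfold encodeNumber
  rw [List.append_assoc]
  induction encodeNat n with
  | nil => rfl
  | cons b l ih =>
    unfold cut at *
    rw [List.map_cons, List.cons_append, List.foldr_cons, ih]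
    rfl

end Encodings

/-! ### Decomposition of assertions -/

section Assertions

variable {NC NI NG NL : Type} [Encodable NC] [Encodable NI] [Encodable NG] [Encodable NL]

theorem Assertion.length_filter_pieces (x : Assertion NC NI NG NL) :
    (x.pieces.filter fun y => y.1 == .next).length =
      match x with
      | .concept n _ _ _ => n
      | .role n _ _ _ _ => n := by
  rcases x with ⟨n, s, A, a⟩ | ⟨n, s, S | S, a, b⟩ <;> cases s <;>
    simp [pieces, encodeSign, RoleName.pieces]

theorem Assertion.any_pieces (x : Assertion NC NI NG NL) :
    (!x.pieces.any fun y => y.1 == .neg) =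
      match x with
      | .concept _ s _ _ => s
      | .role _ s _ _ _ => s := by
  rcases x with ⟨n, s, A, a⟩ | ⟨n, s, S | S, a, b⟩ <;> cases s <;>
    simp [pieces, encodeSign, RoleName.pieces]

/-- The numbers that are written one after another in a string. -/
def numerals (w : List Sym) : List Sym × List (List Sym) :=
  ((cut (fun s => s == .endNum) w).1 ++ [.endNum],
    (cut (fun s => s == .endNum) w).2.map fun x => x.2 ++ [.endNum])

/-- Cutting strips the end marker from each numeral, and `numerals` restores it. After the last
numeral a spurious one remains, which is never consulted. -/
theorem numerals_encodeNumber (n : ℕ) (w : List Sym) :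
    numerals (encodeNumber n ++ w) = (encodeNumber n, (numerals w).1 :: (numerals w).2) := by
  unfold numerals
  rw [cut_encodeNumber]
  rfl

/-- One piece starts with `conceptName` if the assertion is a concept assertion, and none does
otherwise. So filtering the pieces also decides the kind of the assertion. -/
theorem Assertion.map_conceptParts (x : Assertion NC NI NG NL) :
    ((x.pieces.filter fun y => y.1 == .conceptName).map fun y =>
      ((x.pieces.filter fun y => y.1 == .next).length, (!x.pieces.any fun y => y.1 == .neg),
        (numerals y.2).1, (numerals y.2).2.headD [])) =
    x.conceptParts.map fun y => (y.1, y.2.1, encodeNumber (Encodable.encode y.2.2.1),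
      encodeNumber (Encodable.encode y.2.2.2)) := by
  rw [length_filter_pieces, any_pieces]
  rcases x with ⟨n, s, A, a⟩ | ⟨n, s, S | S, a, b⟩
  · have h := numerals_encodeNumber (Encodable.encode a) []
    rw [List.append_nil] at h
    cases s <;> simp [pieces, encodeSign, conceptParts, numerals_encodeNumber, h]
  all_goals cases s <;> simp [pieces, encodeSign, RoleName.pieces, conceptParts]

theorem Assertion.map_roleParts (x : Assertion NC NI NG NL) :
    ((x.pieces.filter fun y => y.1.isRoleHead).map fun y =>
      ((x.pieces.filter fun y => y.1 == .next).length, (!x.pieces.any fun y => y.1 == .neg),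
        y.1 :: (numerals y.2).1, (numerals y.2).2.headD [], (numerals y.2).2.tail.headD [])) =
    x.roleParts.map fun y => (y.1, y.2.1, y.2.2.1.encode,
      encodeNumber (Encodable.encode y.2.2.2.1), encodeNumber (Encodable.encode y.2.2.2.2)) := by
  rw [length_filter_pieces, any_pieces]
  rcases x with ⟨n, s, A, a⟩ | ⟨n, s, S | S, a, b⟩
  · cases s <;> simp [pieces, encodeSign, roleParts, Sym.isRoleHead]
  all_goals
    have h := numerals_encodeNumber (Encodable.encode b) []
    rw [List.append_nil] at h
    cases s <;> simp [pieces, encodeSign, RoleName.pieces, roleParts, Sym.isRoleHead,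
      numerals_encodeNumber, h, RoleName.encode]

end Assertions

/-! ### The conjuncts of the translation in polynomial time -/

namespace PolyTime

variable {NC NI NG NL : Type} [Encodable NC] [Encodable NI] [Encodable NG] [Encodable NL]
  {α : Type} [Rep α]

@[fun_prop]
theorem kb_numbers {f : α → KB NC NI NG NL} (hf : PolyTime f) :
    PolyTime fun a => (f a).numbers :=
  dedup rep_pnat_injective (by fun_prop)

variable [NameRep NI]

@[fun_prop]
theorem roleParts {f : α → Assertion NC NI NG NL} (hf : PolyTime f) :
    PolyTime fun a => (f a).roleParts := by
  have h1 : ∀ s : Sym, PolyTime fun x : α × (Sym × List Sym) => x.2.1 == s := fun s =>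
    sym_comp (fun s' => s' == s) (by fun_prop)
  have h2 : PolyTime fun x : α × (Sym × List Sym) => x.2.1.isRoleHead :=
    sym_comp Sym.isRoleHead (by fun_prop)
  have hn : PolyTime fun a => ((f a).pieces.filter fun y => y.1 == .next).length :=
    (filter (g := fun _ y => y.1 == .next) hf.assertion_pieces (h1 .next)).length
  have hs : PolyTime fun a => !(f a).pieces.any fun y => y.1 == .neg :=
    (any (g := fun _ y => y.1 == .neg) hf.assertion_pieces (h1 .neg)).not
  have h := (filter (g := fun _ y => y.1.isRoleHead) hf.assertion_pieces h2).map (g := fun a y =>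
      (((f a).pieces.filter fun y => y.1 == .next).length,
        (!(f a).pieces.any fun y => y.1 == .neg),
        y.1 :: (TDLLite.numerals y.2).1, (TDLLite.numerals y.2).2.headD [],
        (TDLLite.numerals y.2).2.tail.headD [])) (by fun_prop)
  refine h.congr_rep fun a => ?_
  rw [Assertion.map_roleParts]
  refine rep_map (fun x => ?_) _
  exact congrArg₂ _ rfl (congrArg₂ _ rfl (congrArg₂ _ rfl
    (congrArg₂ _ (NameRep.rep_eq _).symm (NameRep.rep_eq _).symm)))

@[fun_prop]
theorem assertion_roleNames {f : α → Assertion NC NI NG NL} (hf : PolyTime f) :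
    PolyTime fun a => (f a).roleNames := by
  have h : PolyTime fun a => (f a).roleParts.map fun x => x.2.2.1 := by fun_prop
  convert h using 2 with a
  cases f a <;> rfl

@[fun_prop]
theorem kb_roleAssertions {f : α → KB NC NI NG NL} (hf : PolyTime f) :
    PolyTime fun a => (f a).roleAssertions := by
  have h : PolyTime fun a => (f a).abox.flatMap fun x => x.roleParts.flatMap fun x =>
      if x.2.1 then [(x.1, Role.name x.2.2.1, x.2.2.2.1, x.2.2.2.2),
        (x.1, Role.inv x.2.2.1, x.2.2.2.2, x.2.2.2.1)] else [] := by fun_prop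
  convert h using 2 with a
  refine congrArg (fun g => List.flatMap g (f a).abox) (funext fun x => ?_)
  rcases x with _ | ⟨n, _ | _, S, a, b⟩ <;> rfl

@[fun_prop]
theorem conceptParts [NameRep NC] {f : α → Assertion NC NI NG NL} (hf : PolyTime f) :
    PolyTime fun a => (f a).conceptParts := by
  have h1 : ∀ s : Sym, PolyTime fun x : α × (Sym × List Sym) => x.2.1 == s := fun s =>
    sym_comp (fun s' => s' == s) (by fun_prop)
  have hn : PolyTime fun a => ((f a).pieces.filter fun y => y.1 == .next).length :=
    (filter (g := fun _ y => y.1 == .next) hf.assertion_pieces (h1 .next)).length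
  have hs : PolyTime fun a => !(f a).pieces.any fun y => y.1 == .neg :=
    (any (g := fun _ y => y.1 == .neg) hf.assertion_pieces (h1 .neg)).not
  have h := (filter (g := fun _ y => y.1 == .conceptName) hf.assertion_pieces
      (h1 .conceptName)).map (g := fun a y =>
      (((f a).pieces.filter fun y => y.1 == .next).length,
        (!(f a).pieces.any fun y => y.1 == .neg),
        (TDLLite.numerals y.2).1, (TDLLite.numerals y.2).2.headD [])) (by fun_prop)
  refine h.congr_rep fun a => ?_
  rw [Assertion.map_conceptParts]
  refine rep_map (fun x => ?_) _
  exact congrArg₂ _ rfl (congrArg₂ _ rfl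
    (congrArg₂ _ (NameRep.rep_eq _).symm (NameRep.rep_eq _).symm))

variable [DecidableEq NG] [DecidableEq NL]

@[fun_prop]
theorem kb_roles {f : α → KB NC NI NG NL} (hf : PolyTime f) : PolyTime fun a => (f a).roles := by
  have h : PolyTime fun a => (((f a).tbox.flatMap fun c => c.lhs.roleNames ++ c.rhs.roleNames) ++
    (f a).abox.flatMap Assertion.roleNames).dedup :=
    dedup rep_roleName_injective (by fun_prop)
  unfold KB.roles
  fun_prop

@[fun_prop]
theorem kb_slice {f : α → KB NC NI NG NL} {n : α → ℕ} {R : α → Role NG NL} (hf : PolyTime f)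
    (hn : PolyTime n) (hR : PolyTime R) : PolyTime fun a => (f a).slice (n a) (R a) := by
  have h1 : PolyTime fun x : α × (ℕ × Role NG NL × NI × NI) => decide (x.2.2.1 = R x.1) :=
    eq rep_role_injective (by fun_prop) (by fun_prop)
  have h2 : PolyTime fun x : α × (ℕ × Role NG NL × NI × NI) => decide (x.2.1 = n x.1) := by
    have : PolyTime fun x : α × (ℕ × Role NG NL × NI × NI) =>
        decide (List.replicate x.2.1 Sym.next = List.replicate (n x.1) Sym.next) :=
      eq rep_string_injective (by fun_prop) (by fun_prop)
    simpa [List.replicate_inj] using this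
  have h3 : PolyTime fun x : α × (ℕ × Role NG NL × NI × NI) =>
      decide (x.2.2.1 = R x.1 ∧ ((R x.1).isGlobal ∨ x.2.1 = n x.1)) := by fun_prop
  exact (hf.kb_roleAssertions.filter h3).map (by fun_prop)

@[fun_prop]
theorem kb_tboxConjuncts {f : α → KB NC NI NG NL} (hf : PolyTime f) :
    PolyTime fun a => (f a).tboxConjuncts := by
  unfold KB.tboxConjuncts
  fun_prop

@[fun_prop]
theorem mem_slice [DecidableEq NI] {f : α → KB NC NI NG NL} {n : α → ℕ} {R : α → Role NG NL}
    {a b : α → NI}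
    (hf : PolyTime f) (hn : PolyTime n) (hR : PolyTime R) (ha : PolyTime a) (hb : PolyTime b) :
    PolyTime fun x => decide ((a x, b x) ∈ (f x).slice (n x) (R x)) := by
  have h : PolyTime fun x => (a x, b x) := by fun_prop
  convert mem (pairRep_injective rep_name_injective rep_name_injective) h (hf.kb_slice hn hR)

variable [DecidableEq NI]

@[fun_prop]
theorem kb_succCount {f : α → KB NC NI NG NL} {n : α → ℕ} {R : α → Role NG NL} {b : α → NI}
    (hf : PolyTime f) (hn : PolyTime n) (hR : PolyTime R) (hb : PolyTime b) :
    PolyTime fun a => (f a).succCount (n a) (R a) (b a) := by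
  have h1 : PolyTime fun x : α × (NI × NI) => decide (x.2.1 = b x.1) :=
    eq rep_name_injective (by fun_prop) (by fun_prop)
  exact (dedup rep_name_injective (((hf.kb_slice hn hR).filter h1).map (by fun_prop))).length

@[fun_prop]
theorem kb_succNumber {f : α → KB NC NI NG NL} {n : α → ℕ} {R : α → Role NG NL} {b : α → NI}
    (hf : PolyTime f) (hn : PolyTime n) (hR : PolyTime R) (hb : PolyTime b) :
    PolyTime fun a => (f a).succNumber (n a) (R a) (b a) := by
  -- A maximum is one of its two arguments, so its size is at most the sum of theirs.
  refine foldr (h := fun _ => max) (by fun_prop) (const 1) (pnat_max (by fun_prop) (by fun_prop))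
    .X fun a p q => ?_
  rw [Polynomial.eval_X]
  rcases max_choice p q with h | h <;> rw [h] <;> omega

variable [NameRep NC]

@[fun_prop]
theorem kb_aboxConjuncts {f : α → KB NC NI NG NL} (hf : PolyTime f) :
    PolyTime fun a => (f a).aboxConjuncts := by
  -- The pattern matching in the definition is replaced by a `flatMap` over lists of parts with at
  -- most one entry.
  have h1 : PolyTime fun a => ((f a).abox.flatMap fun x => x.conceptParts.map fun x =>
      if x.2.1 then Formula.nexts x.1 (.atom (.concept x.2.2.1) (.const x.2.2.2))
      else Formula.nexts x.1 (.neg (.atom (.concept x.2.2.1) (.const x.2.2.2))) :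
        List (QTL NC NI NG NL)) := by
    fun_prop
  have h2 : PolyTime fun a => ((f a).roleAssertions.map fun r =>
      Formula.nexts r.1 (.atom (.atLeast ((f a).succNumber r.1 r.2.1 r.2.2.1) r.2.1)
        (.const r.2.2.1)) : List (QTL NC NI NG NL)) := by
    fun_prop
  have h3 : PolyTime fun x : (α × Assertion NC NI NG NL) ×
      (ℕ × Bool × RoleName NG NL × NI × NI) =>
      decide ((x.2.2.2.2.1, x.2.2.2.2.2) ∈ (f x.1.1).slice x.2.1 (.name x.2.2.2.1)) :=
    mem_slice (by fun_prop) (by fun_prop) (by fun_prop) (by fun_prop) (by fun_prop)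
  have h4 : PolyTime fun a => ((f a).abox.flatMap fun x => x.roleParts.flatMap fun x =>
      if x.2.1 then [] else
        if (x.2.2.2.1, x.2.2.2.2) ∈ (f a).slice x.1 (.name x.2.2.1) then [Formula.bot] else [] :
        List (QTL NC NI NG NL)) := by
    fun_prop
  have h := (h1.append h2).append h4
  convert h using 2 with a
  refine congrArg₂ (· ++ ·) (congrArg₂ (· ++ ·) ?_ rfl) ?_
  · refine congrArg (fun g => List.flatMap g (f a).abox) (funext fun x => ?_)
    rcases x with ⟨n, _ | _, A, a⟩ | _ <;> rfl
  · refine congrArg (fun g => List.flatMap g (f a).abox) (funext fun x => ?_)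
    rcases x with _ | ⟨n, _ | _, S, a, b⟩ <;> simp [Assertion.roleParts]

theorem kb_dagger : PolyTime (KB.dagger : KB NC NI NG NL → QTL NC NI NG NL) :=
  formula_and (formula_conj (kb_tboxConjuncts .id)) (formula_conj (kb_aboxConjuncts .id))

end PolyTime

/-- Names are represented by the binary notation of their codes. Knowledge bases and formulas are
represented by their encodings by definition, so nothing has to be converted. -/
theorem dagger_computableInPolyTime (NC NI NG NL : Type)
    [Encodable NC] [Encodable NI] [Encodable NG] [Encodable NL]
    [DecidableEq NI] [DecidableEq NG] [DecidableEq NL] :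
    Nonempty (Turing.TM2ComputableInPolyTime (KB.encoding NC NI NG NL).encode
      (QTL.encoding NC NI NG NL).encode KB.dagger) := by
  let _ : NameRep NC :=
    { rep := fun a => rep (encodeNumber (Encodable.encode a)), rep_eq := fun _ => rfl }
  let _ : NameRep NI :=
    { rep := fun a => rep (encodeNumber (Encodable.encode a)), rep_eq := fun _ => rfl }
  exact PolyTime.computableInPolyTime (ea := KB.encode) (eb := QTL.encode) (fun _ => rfl)
    (fun _ => rfl) PolyTime.kb_dagger

/-! ### Truth of the derived connectives -/

namespace Model

variable {P I : Type} (M : Model P I) (n : ℕ) (d : M.Dom) (φ ψ : Formula P I)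

theorem sat_imp : M.Sat n d (φ.imp ψ) ↔ (M.Sat n d φ → M.Sat n d ψ) := by
  simp [Formula.imp, Sat]

theorem sat_box : M.Sat n d φ.box ↔ ∀ m, n ≤ m → M.Sat m d φ := by
  simp [Formula.box, Sat]

theorem sat_ex : M.Sat n d φ.ex ↔ ∃ e, M.Sat n e φ := by
  simp [Formula.ex, Sat]

theorem sat_conj (l : List (Formula P I)) :
    M.Sat n d (Formula.conj l) ↔ ∀ φ ∈ l, M.Sat n d φ := by
  induction l with
  | nil => simp [Formula.conj, Formula.top, Sat]
  | cons φ l ih => simp [Formula.conj, Sat, ih]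

theorem sat_nexts (k : ℕ) : M.Sat n d (Formula.nexts k φ) ↔ M.Sat (n + k) d φ := by
  induction k generalizing n with
  | zero => rfl
  | succ k ih =>
    rw [Formula.nexts, Sat, ih, Nat.add_right_comm, Nat.add_assoc]

end Model

variable {NC NI NG NL : Type}

theorem Role.inverse_inverse (R : Role NG NL) : R.inverse.inverse = R := by
  cases R <;> rfl

theorem Role.isGlobal_inverse (R : Role NG NL) : R.inverse.isGlobal = R.isGlobal := by
  cases R <;> rfl

theorem Interpretation.mem_role_inverse (M : Interpretation NC NI NG NL) (n : ℕ) (R : Role NG NL)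
    (d e : M.Dom) : (d, e) ∈ M.role n R.inverse ↔ (e, d) ∈ M.role n R := by
  cases R <;> rfl

theorem Interpretation.role_eq_of_isGlobal (M : Interpretation NC NI NG NL) {R : Role NG NL}
    (h : R.isGlobal) (m n : ℕ) : M.role m R = M.role n R := by
  rcases R with (G | L) | (G | L)
  · exact M.rigid G m n
  · cases h
  · simp only [role, M.rigid G m n]
  · cases h

theorem foldr_max_choice {α : Type} [LinearOrder α] (a : α) (l : List α) :
    l.foldr max a = a ∨ l.foldr max a ∈ l := by
  induction l with
  | nil => exact .inl rfl
  | cons b l ih =>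
    rw [List.foldr_cons, List.mem_cons]
    rcases max_choice b (l.foldr max a) with h | h <;> rw [h]
    · exact .inr (.inl rfl)
    · exact ih.imp_right .inr

theorem le_foldr_max {α : Type} [LinearOrder α] {a b : α} {l : List α} (h : b ∈ l) :
    b ≤ l.foldr max a := by
  induction l with
  | nil => cases h
  | cons c l ih =>
    rcases List.mem_cons.1 h with rfl | h
    · exact le_max_left _ _
    · exact (ih h).trans (le_max_right _ _)

/-! ### Slices of the ABox and the conditions expressed by the translation -/

namespace KB

variable (K : KB NC NI NG NL)

theorem mem_numbers {q : ℕ+} : q ∈ K.numbers ↔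
    q = 1 ∨ ∃ c ∈ K.tbox, q ∈ c.lhs.numbers ∨ q ∈ c.rhs.numbers := by
  simp [numbers]

theorem mem_roleAssertions {r : ℕ × Role NG NL × NI × NI} : r ∈ K.roleAssertions ↔
    ∃ n S a b, Assertion.role n true S a b ∈ K.abox ∧
      (r = (n, .name S, a, b) ∨ r = (n, .inv S, b, a)) := by
  simp only [roleAssertions, List.mem_flatMap]
  constructor
  · rintro ⟨x, hx, hr⟩
    rcases x with _ | ⟨n, _ | _, S, a, b⟩
    · simp at hr
    · simp at hr
    · exact ⟨n, S, a, b, hx, by simpa using hr⟩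
  · rintro ⟨n, S, a, b, hx, hr⟩
    exact ⟨_, hx, by simpa using hr⟩

theorem mem_roleAssertions_inverse {n : ℕ} {R : Role NG NL} {a b : NI}
    (h : (n, R, a, b) ∈ K.roleAssertions) : (n, R.inverse, b, a) ∈ K.roleAssertions := by
  rw [mem_roleAssertions] at h ⊢
  obtain ⟨n', S, a', b', hx, hr | hr⟩ := h <;> cases hr
  · exact ⟨_, _, _, _, hx, .inr rfl⟩
  · exact ⟨_, _, _, _, hx, .inl rfl⟩

variable [DecidableEq NG] [DecidableEq NL]

theorem mem_roles {R : Role NG NL} : R ∈ K.roles ↔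
    (∃ c ∈ K.tbox, R.roleName ∈ c.lhs.roleNames ∨ R.roleName ∈ c.rhs.roleNames) ∨
      ∃ α ∈ K.abox, R.roleName ∈ α.roleNames := by
  cases R <;> simp [roles, Role.roleName]

theorem inverse_mem_roles {R : Role NG NL} (h : R ∈ K.roles) : R.inverse ∈ K.roles := by
  rw [mem_roles] at h ⊢
  cases R <;> exact h

theorem mem_slice {n : ℕ} {R : Role NG NL} {a b : NI} : (a, b) ∈ K.slice n R ↔
    ∃ m, (m, R, a, b) ∈ K.roleAssertions ∧ (R.isGlobal ∨ m = n) := by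
  simp only [slice, List.mem_map, List.mem_filter, decide_eq_true_eq]
  constructor
  · rintro ⟨⟨m, R', a', b'⟩, ⟨hr, rfl, h⟩, he⟩
    cases he
    exact ⟨m, hr, h⟩
  · rintro ⟨m, hr, h⟩
    exact ⟨_, ⟨hr, rfl, h⟩, rfl⟩

theorem mem_slice_inverse {n : ℕ} {R : Role NG NL} {a b : NI} :
    (b, a) ∈ K.slice n R.inverse ↔ (a, b) ∈ K.slice n R := by
  simp only [mem_slice, Role.isGlobal_inverse]
  refine exists_congr fun m => and_congr_left fun _ => ⟨fun h => ?_, K.mem_roleAssertions_inverse⟩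
  simpa only [Role.inverse_inverse] using K.mem_roleAssertions_inverse h

theorem slice_eq_of_isGlobal {R : Role NG NL} (h : R.isGlobal) (m n : ℕ) :
    K.slice m R = K.slice n R := by
  simp [slice, h]

variable [DecidableEq NI]

theorem succNumber_eq_of_isGlobal {R : Role NG NL} (h : R.isGlobal) (m n : ℕ) (a : NI) :
    K.succNumber m R a = K.succNumber n R a := by
  have e : K.succCount m R a = K.succCount n R a := by
    unfold succCount
    rw [K.slice_eq_of_isGlobal h m n]
  unfold succNumber
  rw [e]

theorem succCount_pos {n : ℕ} {R : Role NG NL} {a : NI} :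
    0 < K.succCount n R a ↔ ∃ b, (a, b) ∈ K.slice n R := by
  rw [succCount, List.length_pos_iff_exists_mem]
  simp

theorem succNumber_mem_numbers (n : ℕ) (R : Role NG NL) (a : NI) :
    K.succNumber n R a ∈ K.numbers := by
  rcases foldr_max_choice 1 (K.numbers.filter fun (q : ℕ+) => (q : ℕ) ≤ K.succCount n R a)
    with h | h
  · exact K.mem_numbers.2 (.inl h)
  · exact (List.mem_filter.1 h).1

/-- Positivity is needed for the default value `1` only; any other value comes from the filtered
list. -/
theorem succNumber_le_succCount {n : ℕ} {R : Role NG NL} {a : NI} (h : 0 < K.succCount n R a) :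
    (K.succNumber n R a : ℕ) ≤ K.succCount n R a := by
  rcases foldr_max_choice 1 (K.numbers.filter fun (q : ℕ+) => (q : ℕ) ≤ K.succCount n R a)
    with h' | h'
  · rw [succNumber, h']
    exact h
  · exact of_decide_eq_true (List.mem_filter.1 h').2

theorem le_succNumber {n : ℕ} {R : Role NG NL} {a : NI} {q : ℕ+} (hq : q ∈ K.numbers)
    (h : (q : ℕ) ≤ K.succCount n R a) : q ≤ K.succNumber n R a :=
  le_foldr_max (List.mem_filter.2 ⟨hq, by simpa using h⟩)

/-- The conditions that the translation of a knowledge base expresses. -/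
structure HoldsIn (M : Model (Pred NC NG NL) NI) : Prop where
  tbox : ∀ c ∈ K.tbox, ∀ n d, M.Sat n d (c.lhs.star .var) → M.Sat n d (c.rhs.star .var)
  mono : ∀ R ∈ K.roles, ∀ q ∈ K.numbers, ∀ q' ∈ K.numbers, q < q' → ∀ n,
    M.predI n (.atLeast q' R) ⊆ M.predI n (.atLeast q R)
  rigid : ∀ R ∈ K.roles, R.isGlobal → ∀ q ∈ K.numbers, ∀ m n,
    M.predI m (.atLeast q R) ⊆ M.predI n (.atLeast q R)
  inverse : ∀ R ∈ K.roles, ∀ n, (M.predI n (.atLeast 1 R)).Nonempty →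
    (M.predI n (.atLeast 1 R.inverse)).Nonempty
  concept : ∀ n A a, .concept n true A a ∈ K.abox → M.constI a ∈ M.predI n (.concept A)
  not_concept : ∀ n A a, .concept n false A a ∈ K.abox → M.constI a ∉ M.predI n (.concept A)
  role : ∀ n R a b, (n, R, a, b) ∈ K.roleAssertions →
    M.constI a ∈ M.predI n (.atLeast (K.succNumber n R a) R)
  not_role : ∀ n S a b, .role n false S a b ∈ K.abox → (a, b) ∉ K.slice n (.name S)

/-- The TBox conjuncts are boxed and evaluated at time `0`, so they speak about all times, and `○ⁿ`
moves an ABox conjunct to time `n`. -/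
theorem sat_dagger (M : Model (Pred NC NG NL) NI) (d : M.Dom) :
    M.Sat 0 d K.dagger ↔ K.HoldsIn M := by
  simp only [dagger, Model.Sat, Model.sat_conj, tboxConjuncts, aboxConjuncts, List.mem_append,
    or_imp, forall_and, List.mem_map, List.mem_flatMap, List.mem_filter, forall_exists_index,
    and_imp, decide_eq_true_eq]
  constructor
  · rintro ⟨⟨⟨⟨h1, h2⟩, h3⟩, h4⟩, ⟨h5, h6⟩, h7⟩
    constructor
    · intro c hc n e
      have := (Model.sat_box ..).1 (h1 _ c hc rfl) n n.zero_le e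
      rwa [Model.sat_imp] at this
    · intro R hR q hq q' hq' hlt n e
      have := (Model.sat_box ..).1 (h2 _ R hR q hq q' hq' hlt rfl) n n.zero_le e
      rwa [Model.sat_imp] at this
    · intro R hR hg q hq m n e he
      -- The instance at time `0` suffices: both `m` and `n` are in its future, so truth also passes
      -- to times `n` before `m`.
      have := (Model.sat_box ..).1 (h3 _ R hR hg q hq rfl) 0 le_rfl e
      rw [Model.sat_imp, Model.sat_box] at this
      exact this ⟨m, m.zero_le, he⟩ n n.zero_le
    · rintro R hR n ⟨e, he⟩
      have := (Model.sat_box ..).1 (h4 _ R hR rfl) n n.zero_le e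
      rw [Model.sat_imp, Model.sat_ex] at this
      exact this he
    · intro n A a h
      have := h5 _ _ h (List.mem_singleton.2 rfl)
      rwa [Model.sat_nexts, Nat.zero_add] at this
    · intro n A a h
      have := h5 _ _ h (List.mem_singleton.2 rfl)
      rwa [Model.sat_nexts, Nat.zero_add] at this
    · intro n R a b h
      have := h6 _ _ h rfl
      rwa [Model.sat_nexts, Nat.zero_add] at this
    · intro n S a b h hs
      refine h7 .bot _ h ?_
      simp [hs]
  · intro h
    refine ⟨⟨⟨⟨?_, ?_⟩, ?_⟩, ?_⟩, ⟨?_, ?_⟩, ?_⟩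
    · rintro _ c hc rfl
      rw [Model.sat_box]
      intro n _ e
      rw [Model.sat_imp]
      exact h.tbox c hc n e
    · rintro _ R hR q hq q' hq' hlt rfl
      rw [Model.sat_box]
      intro n _ e
      rw [Model.sat_imp]
      exact fun he => h.mono R hR q hq q' hq' hlt n he
    · rintro _ R hR hg q hq rfl
      rw [Model.sat_box]
      intro n _ e
      rw [Model.sat_imp, Model.sat_box]
      rintro ⟨m, _, he⟩ m' _
      exact h.rigid R hR hg q hq m m' he
    · rintro _ R hR rfl
      rw [Model.sat_box]
      intro n _ e
      rw [Model.sat_imp, Model.sat_ex]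
      exact fun he => h.inverse R hR n ⟨e, he⟩
    · rintro φ α hα hφ
      rcases α with ⟨n, _ | _, A, a⟩ | ⟨n, s, S, a, b⟩
      · rw [List.mem_singleton.1 hφ, Model.sat_nexts, Nat.zero_add]
        exact h.not_concept n A a hα
      · rw [List.mem_singleton.1 hφ, Model.sat_nexts, Nat.zero_add]
        exact h.concept n A a hα
      · cases hφ
    · rintro _ ⟨n, R, a, b⟩ hr rfl
      rw [Model.sat_nexts, Nat.zero_add]
      exact h.role n R a b hr
    · rintro φ α hα hφ
      rcases α with _ | ⟨n, _ | _, S, a, b⟩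
      · simp at hφ
      · simp [h.not_role n S a b hα] at hφ
      · simp at hφ

end KB

/-! ### From an interpretation to a model of the translation -/

/-- The first-order temporal model in which `E_q R` is interpreted as `≥ q R`. -/
def Interpretation.toModel (M : Interpretation NC NI NG NL) : Model (Pred NC NG NL) NI where
  Dom := M.Dom
  nonempty := M.nonempty
  predI n
    | .concept A => M.conceptI n A
    | .atLeast q R => M.concept (.atLeast q R) n
  constI := M.indI

theorem Interpretation.sat_star_toModel (M : Interpretation NC NI NG NL) (C : Concept NC NG NL)
    (n : ℕ) (d : M.Dom) : M.toModel.Sat n d (C.star .var) ↔ d ∈ M.concept C n := by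
  induction C generalizing n with
  | bot => rfl
  | atom A => rfl
  | atLeast q R => rfl
  | neg C ih => exact not_congr (ih n)
  | and C D ih ih' => exact and_congr (ih n) (ih' n)
  | next C ih => exact ih (n + 1)
  | dia C ih => exact exists_congr fun m => and_congr_right fun _ => ih m

section

variable [DecidableEq NG] [DecidableEq NL]

theorem Interpretation.mem_role_of_mem_slice {K : KB NC NI NG NL}
    {M : Interpretation NC NI NG NL} (hA : ∀ α ∈ K.abox, M.SatAssertion α) {n : ℕ}
    {R : Role NG NL} {a b : NI} (h : (a, b) ∈ K.slice n R) :
    (M.indI a, M.indI b) ∈ M.role n R := by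
  obtain ⟨m, hr, hm⟩ := K.mem_slice.1 h
  have key : (M.indI a, M.indI b) ∈ M.role m R := by
    obtain ⟨m', S, a', b', hx, hr | hr⟩ := K.mem_roleAssertions.1 hr <;> cases hr <;>
      exact hA _ hx
  rcases hm with hg | rfl
  · rwa [M.role_eq_of_isGlobal hg n m]
  · exact key

variable [DecidableEq NI]

theorem Interpretation.holdsIn_toModel {K : KB NC NI NG NL} {M : Interpretation NC NI NG NL}
    (hT : ∀ c ∈ K.tbox, M.SatCI c) (hA : ∀ α ∈ K.abox, M.SatAssertion α) :
    K.HoldsIn M.toModel where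
  tbox c hc n d h :=
    (M.sat_star_toModel c.rhs n d).2 (hT c hc n ((M.sat_star_toModel c.lhs n d).1 h))
  mono R _ q _ q' _ hlt n d hd := by
    change _ ≤ Set.encard _ at hd ⊢
    exact (Nat.cast_le.2 hlt.le).trans hd
  rigid R _ hg q _ m n d hd := by
    change _ ≤ Set.encard _ at hd ⊢
    rwa [M.role_eq_of_isGlobal hg n m]
  inverse R _ n := by
    rintro ⟨d, hd⟩
    have hd' : (1 : ℕ∞) ≤ Set.encard {e | (d, e) ∈ M.role n R} := hd
    obtain ⟨e, he⟩ := Set.one_le_encard_iff_nonempty.1 hd'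
    have he' : (1 : ℕ∞) ≤ Set.encard {d | (e, d) ∈ M.role n R.inverse} :=
      Set.one_le_encard_iff_nonempty.2 ⟨d, (M.mem_role_inverse n R e d).2 he⟩
    exact ⟨e, he'⟩
  concept n A a h := hA _ h
  not_concept n A a h := hA _ h
  role n R a b h := by
    have hs : (a, b) ∈ K.slice n R := K.mem_slice.2 ⟨n, h, .inr rfl⟩
    change _ ≤ Set.encard _
    -- The assertion itself is in the slice, so the count is positive and bounds `succNumber`.
    refine le_trans (Nat.cast_le.2 (K.succNumber_le_succCount (K.succCount_pos.2 ⟨b, hs⟩))) ?_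
    -- By the unique name assumption, distinct names are distinct successors.
    have : (K.succCount n R a : ℕ∞) = (M.indI ''
        ((((K.slice n R).filter fun p => p.1 = a).map Prod.snd).toFinset : Set NI)).encard := by
      rw [M.una.encard_image, Set.encard_coe_eq_coe_finsetCard, List.card_toFinset]
      rfl
    rw [this]
    refine Set.encard_le_encard ?_
    rintro _ ⟨c, hc, rfl⟩
    exact mem_role_of_mem_slice hA (by simpa using hc)
  not_role n S a b h hs := hA _ h (mem_role_of_mem_slice hA hs)

end

/-! ### The unravelling of a model of the translation -/

/-- The elements of the unravelling of a first-order temporal model: the individual names, one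
further root, and the successors, numbered from `0`, along every role at every time. -/
inductive Node (NI NG NL : Type) where
  | root (o : Option NI)
  | child (x : Node NI NG NL) (R : Role NG NL) (n i : ℕ)

/-- Terms are well founded. This keeps the parent of a node apart from its children when successors
are counted. -/
theorem Node.child_child_ne (x : Node NI NG NL) (R R' : Role NG NL) (n n' i i' : ℕ) :
    child (child x R n i) R' n' i' ≠ x := fun h => by
  have := congrArg sizeOf h
  simp at this
  omega

namespace Model

open Classical in
/-- An element of a model that stands for an element of its unravelling. -/
noncomputable def nodeVal (M : Model (Pred NC NG NL) NI) : Node NI NG NL → M.Dom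
  | .root none => M.nonempty.some
  | .root (some a) => M.constI a
  | .child _ R n _ =>
    -- The parent is to be a successor of the child along the inverse role, so the child copies a
    -- witness of `E_1 inv(R)`. If `HoldsIn` is true, the other case arises, for roles of `K`, only
    -- for children that are not linked to their parent.
    if h : (M.predI n (.atLeast 1 R.inverse)).Nonempty then h.some else M.nonempty.some

end Model

namespace KB

variable (K : KB NC NI NG NL) (M : Model (Pred NC NG NL) NI)

open Classical in
/-- The least number of `R`-successors at `n` that the element `d` requires. -/
noncomputable def degree (d : M.Dom) (R : Role NG NL) (n : ℕ) : ℕ :=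
  ((K.numbers.filter fun q => d ∈ M.predI n (.atLeast q R)).map PNat.val).foldr max 0

variable [DecidableEq NI] [DecidableEq NG] [DecidableEq NL]

/-- The number of `R`-successors at `n` that are not children. -/
noncomputable def own : Node NI NG NL → Role NG NL → ℕ → ℕ
  | .root none, _, _ => 0
  | .root (some a), R, n => K.succCount n R a
  | .child y R' n' i, R, n =>
    -- The parent is the only such successor of a child, and only if the number `i` is among those
    -- that the parent lacks. The difference is `missing`, spelled out because it depends on `own`
    -- of the parent; children with larger numbers exist but are not linked to it.
    if R' = R.inverse ∧ n' = n ∧ i < K.degree M (M.nodeVal y) R' n' - own y R' n' then 1 else 0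

/-- The number of `R`-successors at `n` that are children. -/
noncomputable def missing (x : Node NI NG NL) (R : Role NG NL) (n : ℕ) : ℕ :=
  K.degree M (M.nodeVal x) R n - K.own M x R n

/-- The `R`-successors at `n` that are not children. -/
def ownSuccs (x : Node NI NG NL) (R : Role NG NL) (n : ℕ) : Set (Node NI NG NL) :=
  {y | (∃ a b, x = .root (some a) ∧ y = .root (some b) ∧ (a, b) ∈ K.slice n R) ∨
    ∃ i < K.missing M y R.inverse n, x = .child y R.inverse n i}

/-- The `R`-successors at `n`. -/
def succs (x : Node NI NG NL) (R : Role NG NL) (n : ℕ) : Set (Node NI NG NL) :=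
  K.ownSuccs M x R n ∪ (fun i => .child x R n i) '' Set.Iio (K.missing M x R n)

theorem encard_ownSuccs (x : Node NI NG NL) (R : Role NG NL) (n : ℕ) :
    (K.ownSuccs M x R n).encard = K.own M x R n := by
  rcases x with (_ | a) | ⟨y, R', n', i⟩
  · simp [ownSuccs, own]
  · have : K.ownSuccs M (.root (some a)) R n = (fun b => .root (some b)) ''
        ((((K.slice n R).filter fun p => p.1 = a).map Prod.snd).toFinset : Set NI) := by
      ext y
      simp [ownSuccs, eq_comm, and_comm]
    rw [this, Function.Injective.encard_image, Set.encard_coe_eq_coe_finsetCard,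
      List.card_toFinset]
    · rfl
    · intro b c h
      simpa using h
  · by_cases h : R' = R.inverse ∧ n' = n ∧ i < K.missing M y R' n'
    · have : K.ownSuccs M (.child y R' n' i) R n = {y} := by
        obtain ⟨rfl, rfl, h⟩ := h
        ext z
        simp only [ownSuccs, Set.mem_ofPred_eq, reduceCtorEq, false_and, exists_false, false_or,
          Node.child.injEq, true_and, Set.mem_singleton_iff]
        constructor
        · rintro ⟨_, _, rfl, _⟩
          rfl
        · rintro rfl
          exact ⟨i, h, rfl, rfl⟩
      rw [this, own, ← missing, if_pos h, Set.encard_singleton, Nat.cast_one]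
    · have : K.ownSuccs M (.child y R' n' i) R n = ∅ := by
        ext z
        simp only [ownSuccs, Set.mem_ofPred_eq, reduceCtorEq, false_and, exists_false, false_or,
          Node.child.injEq, Set.mem_empty_iff_false, iff_false]
        rintro ⟨j, hj, rfl, rfl, rfl, rfl⟩
        exact h ⟨rfl, rfl, hj⟩
      rw [this, own, ← missing, if_neg h, Set.encard_empty, Nat.cast_zero]

/-- Own successors and children are disjoint, and `missing` is a truncated difference, so the sum is
a maximum. -/
theorem encard_succs (x : Node NI NG NL) (R : Role NG NL) (n : ℕ) :
    (K.succs M x R n).encard =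
      (max (K.degree M (M.nodeVal x) R n) (K.own M x R n) : ℕ) := by
  rw [succs, Set.encard_union_eq, encard_ownSuccs, Function.Injective.encard_image]
  · rw [← Finset.coe_Iio, Set.encard_coe_eq_coe_finsetCard, Nat.card_Iio, missing, ← Nat.cast_add]
    congr 1
    omega
  · intro i j h
    simpa using h
  · rw [Set.disjoint_right]
    rintro _ ⟨i, _, rfl⟩ (⟨a, b, _, h, _⟩ | ⟨j, _, h⟩)
    · cases h
    · exact Node.child_child_ne _ _ _ _ _ _ _ h.symm

/-- An ABox edge can be reversed because the ABox is closed under inverses. An edge from a parent to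
a linked child along `R` is, read from the child, an edge to its own successor along the inverse
role. -/
theorem mem_succs_inverse {x y : Node NI NG NL} {R : Role NG NL} {n : ℕ} :
    x ∈ K.succs M y R.inverse n ↔ y ∈ K.succs M x R n := by
  have key : ∀ {x y : Node NI NG NL} {R : Role NG NL},
      y ∈ K.succs M x R n → x ∈ K.succs M y R.inverse n := by
    rintro x y R ((⟨a, b, rfl, rfl, h⟩ | ⟨i, hi, rfl⟩) | ⟨i, hi, rfl⟩)
    · exact .inl (.inl ⟨b, a, rfl, rfl, K.mem_slice_inverse.2 h⟩)
    · exact .inr ⟨i, hi, rfl⟩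
    · refine .inl (.inr ⟨i, ?_, ?_⟩) <;> rw [Role.inverse_inverse]
      exact hi
  refine ⟨fun h => ?_, key⟩
  simpa only [Role.inverse_inverse] using key h

/-- The time at which a role is evaluated in the unravelling: always `0` for a global role. -/
def roleTime (R : Role NG NL) (n : ℕ) : ℕ := if R.isGlobal then 0 else n

/-- The unravelling of a first-order temporal model. -/
def unravelling : Interpretation NC NI NG NL where
  Dom := Node NI NG NL
  nonempty := ⟨.root none⟩
  conceptI n A := {x | M.nodeVal x ∈ M.predI n (.concept A)}
  -- Freezing the time for global roles makes rigidity hold by definition.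
  roleI n S := {p | p.2 ∈ K.succs M p.1 (.name S) (roleTime (.name S) n)}
  indI a := .root (some a)
  una a b h := by simpa using h
  rigid _ _ _ := rfl

theorem mem_role_unravelling (x y : Node NI NG NL) (R : Role NG NL) (n : ℕ) :
    (x, y) ∈ (K.unravelling M).role n R ↔ y ∈ K.succs M x R (roleTime R n) := by
  cases R with
  | name S => rfl
  | inv S => exact (K.mem_succs_inverse M (R := .name S)).symm

/-! ### Correctness of the unravelling -/

variable {K M}

theorem HoldsIn.mem_of_le (h : K.HoldsIn M) {R : Role NG NL} (hR : R ∈ K.roles) {q q' : ℕ+}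
    (hq : q ∈ K.numbers)
    (hq' : q' ∈ K.numbers) (hle : q ≤ q') {n : ℕ} {d : M.Dom}
    (hd : d ∈ M.predI n (.atLeast q' R)) : d ∈ M.predI n (.atLeast q R) := by
  rcases hle.eq_or_lt with rfl | hlt
  · exact hd
  · exact h.mono R hR q hq q' hq' hlt n hd

theorem HoldsIn.mem_roleTime (h : K.HoldsIn M) {R : Role NG NL} (hR : R ∈ K.roles) {q : ℕ+}
    (hq : q ∈ K.numbers)
    {n : ℕ} {d : M.Dom} :
    d ∈ M.predI (roleTime R n) (.atLeast q R) ↔ d ∈ M.predI n (.atLeast q R) := by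
  unfold roleTime
  split_ifs with hg
  · exact ⟨fun hd => h.rigid R hR hg q hq _ _ hd, fun hd => h.rigid R hR hg q hq _ _ hd⟩
  · rfl

/-- The degree is the largest number of `Q_T` that is true at `d`, and the monotonicity conjuncts
make all smaller ones true as well. -/
theorem HoldsIn.le_degree (h : K.HoldsIn M) {R : Role NG NL} (hR : R ∈ K.roles) {q : ℕ+}
    (hq : q ∈ K.numbers)
    {n : ℕ} {d : M.Dom} : (q : ℕ) ≤ K.degree M d R n ↔ d ∈ M.predI n (.atLeast q R) := by
  classical
  constructor
  · intro hle
    rcases foldr_max_choice 0 ((K.numbers.filter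
      fun q => d ∈ M.predI n (.atLeast q R)).map PNat.val) with h0 | h1
    · have := q.pos
      rw [degree] at hle
      omega
    · obtain ⟨q', hq', he⟩ := List.mem_map.1 h1
      rw [List.mem_filter, decide_eq_true_eq] at hq'
      refine h.mem_of_le hR hq hq'.1 ?_ hq'.2
      rw [degree, ← he] at hle
      exact hle
  · intro hd
    exact le_foldr_max (List.mem_map.2 ⟨q, List.mem_filter.2 ⟨hq, by simpa using hd⟩, rfl⟩)

/-- The successors given in advance do not exceed what the model promises, at the thresholds in
`Q_T`. Otherwise a node could satisfy `≥ q R` while the element that it copies falsifies `E_q R`,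
and no choice of children could repair this. -/
theorem HoldsIn.mem_of_le_own (h : K.HoldsIn M) {R : Role NG NL} (hR : R ∈ K.roles) {q : ℕ+}
    (hq : q ∈ K.numbers)
    {n : ℕ} {x : Node NI NG NL} (hle : (q : ℕ) ≤ K.own M x R n) :
    M.nodeVal x ∈ M.predI n (.atLeast q R) := by
  have h0 := q.pos
  have one : (1 : ℕ+) ∈ K.numbers := K.mem_numbers.2 (.inl rfl)
  rcases x with (_ | a) | ⟨y, R', n', i⟩
  · simp only [own] at hle
    omega
  · obtain ⟨b, hb⟩ := K.succCount_pos.1 (h0.trans_le hle)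
    obtain ⟨m, hr, hm⟩ := K.mem_slice.1 hb
    -- `A†` asserts `E_q R` for the largest `q` in `Q_T` that the ABox enforces; for a global role
    -- the assertion may stand at another time `m`, from which it is transferred to `n`.
    refine h.mem_of_le hR hq (K.succNumber_mem_numbers n R a) (K.le_succNumber hq hle) ?_
    have key := h.role m R a b hr
    rcases hm with hg | rfl
    · rw [K.succNumber_eq_of_isGlobal hg m n] at key
      exact h.rigid R hR hg _ (K.succNumber_mem_numbers n R a) m n key
    · exact key
  · rw [own] at hle
    split_ifs at hle with hc
    · obtain ⟨rfl, rfl, hi⟩ := hc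
      -- There is one parent at most, so only `E_1 R` is at stake. As the link exists, the parent
      -- lacks a successor, so `E_1 inv(R)` is nonempty at this time; hence so is `E_1 R`, from
      -- which the value of the child was chosen.
      have hq1 : q = 1 := le_antisymm hle one_le
      have h1 : M.nodeVal y ∈ M.predI n' (.atLeast 1 R.inverse) := by
        rw [← h.le_degree (K.inverse_mem_roles hR) one, PNat.one_coe]
        omega
      have h2 := h.inverse _ (K.inverse_mem_roles hR) n' ⟨_, h1⟩
      rw [hq1, Model.nodeVal, dif_pos h2]
      simpa only [Role.inverse_inverse] using h2.some_mem
    · omega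

/-- The number of successors is the maximum of `degree` and `own`. The degree reaches `q` iff `E_q
R` is true, and if `own` reaches `q`, then `E_q R` is true too. -/
theorem HoldsIn.mem_concept_atLeast (h : K.HoldsIn M) {R : Role NG NL} (hR : R ∈ K.roles) {q : ℕ+}
    (hq : q ∈ K.numbers) {n : ℕ} {x : Node NI NG NL} :
    x ∈ (K.unravelling M).concept (.atLeast q R) n ↔
      M.nodeVal x ∈ M.predI n (.atLeast q R) := by
  have e : {y | (x, y) ∈ (K.unravelling M).role n R} = K.succs M x R (roleTime R n) :=
    Set.ext fun y => K.mem_role_unravelling M x y R n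
  refine (iff_of_eq
    (congrArg (fun s : Set (Node NI NG NL) => ((q : ℕ) : ℕ∞) ≤ s.encard) e)).trans ?_
  rw [encard_succs, Nat.cast_le, le_max_iff, h.le_degree hR hq, h.mem_roleTime hR hq,
    or_iff_left_iff_imp]
  exact fun hle => (h.mem_roleTime hR hq).1 (h.mem_of_le_own hR hq hle)

/-- The restriction to numbers and roles of `K` is essential, since `K†` does not constrain the
other predicates `E_q R`. -/
theorem HoldsIn.mem_concept (h : K.HoldsIn M) {C : Concept NC NG NL}
    (hq : ∀ q ∈ C.numbers, q ∈ K.numbers)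
    (hR : ∀ R : Role NG NL, R.roleName ∈ C.roleNames → R ∈ K.roles) {n : ℕ}
    {x : Node NI NG NL} :
    x ∈ (K.unravelling M).concept C n ↔ M.Sat n (M.nodeVal x) (C.star .var) := by
  induction C generalizing n with
  | bot => rfl
  | atom A => rfl
  | atLeast q R =>
    exact h.mem_concept_atLeast (hR R (List.mem_singleton.2 rfl)) (hq q (List.mem_singleton.2 rfl))
  | neg C ih => exact not_congr (ih hq hR)
  | and C D ih ih' =>
    exact and_congr
      (ih (fun q h => hq q (List.mem_append_left _ h)) fun R h => hR R (List.mem_append_left _ h))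
      (ih' (fun q h => hq q (List.mem_append_right _ h)) fun R h =>
        hR R (List.mem_append_right _ h))
  | next C ih => exact ih hq hR
  | dia C ih => exact exists_congr fun m => and_congr_right fun _ => ih hq hR

theorem HoldsIn.satCI_unravelling (h : K.HoldsIn M) {c : CI NC NG NL} (hc : c ∈ K.tbox) :
    (K.unravelling M).SatCI c := fun n _ hx =>
  (h.mem_concept (fun _ hq => K.mem_numbers.2 (.inr ⟨c, hc, .inr hq⟩))
    fun _ hR => K.mem_roles.2 (.inl ⟨c, hc, .inr hR⟩)).2 (h.tbox c hc n _
      ((h.mem_concept (fun _ hq => K.mem_numbers.2 (.inr ⟨c, hc, .inl hq⟩))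
        fun _ hR => K.mem_roles.2 (.inl ⟨c, hc, .inl hR⟩)).1 hx))

/-- A child is never a root, so the unravelling adds no edges between individuals; this is what
negative role assertions require. -/
theorem mem_roleI_unravelling {n : ℕ} {S : RoleName NG NL} {a b : NI} :
    ((K.unravelling M).indI a, (K.unravelling M).indI b) ∈ (K.unravelling M).roleI n S ↔
      (a, b) ∈ K.slice n (.name S) := by
  have e : K.slice (roleTime (.name S) n) (.name S) = K.slice n (.name S) := by
    unfold roleTime
    split_ifs with hg
    · exact K.slice_eq_of_isGlobal hg _ _
    · rfl
  change Node.root (some b) ∈ K.succs M (.root (some a)) _ (roleTime _ n) ↔ _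
  rw [← e]
  simp [succs, ownSuccs]

theorem HoldsIn.satAssertion_unravelling (h : K.HoldsIn M) {α : Assertion NC NI NG NL}
    (hα : α ∈ K.abox) :
    (K.unravelling M).SatAssertion α := by
  rcases α with ⟨n, _ | _, A, a⟩ | ⟨n, _ | _, S, a, b⟩
  · exact h.not_concept n A a hα
  · exact h.concept n A a hα
  · exact fun hs => h.not_role n S a b hα (mem_roleI_unravelling.1 hs)
  · exact mem_roleI_unravelling.2 (K.mem_slice.2
      ⟨n, K.mem_roleAssertions.2 ⟨n, S, a, b, hα, .inl rfl⟩, .inr rfl⟩)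

theorem satisfiable_iff_satisfiable_dagger (K : KB NC NI NG NL) :
    K.Satisfiable ↔ K.dagger.Satisfiable := by
  constructor
  · rintro ⟨M, hT, hA⟩
    exact ⟨M.toModel, M.nonempty.some, (K.sat_dagger _ _).2 (M.holdsIn_toModel hT hA)⟩
  · rintro ⟨M, d, hd⟩
    have h := (K.sat_dagger M d).1 hd
    exact ⟨K.unravelling M, fun _ => h.satCI_unravelling, fun _ => h.satAssertion_unravelling⟩

end KB

end TDLLite

theorem mainTheorem2 (NC NI NG NL : Type)
    [Encodable NC] [Encodable NI] [Encodable NG] [Encodable NL]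
    [DecidableEq NI] [DecidableEq NG] [DecidableEq NL] :
    (∀ K : TDLLite.KB NC NI NG NL, K.Satisfiable ↔ K.dagger.Satisfiable) ∧
    Nonempty (Turing.TM2ComputableInPolyTime
      (TDLLite.KB.encoding NC NI NG NL).encode
      (TDLLite.QTL.encoding NC NI NG NL).encode
      TDLLite.KB.dagger) :=
  ⟨TDLLite.KB.satisfiable_iff_satisfiable_dagger,
    TDLLite.dagger_computableInPolyTime NC NI NG NL⟩
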